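/- **The class $\mathcal{NF}_0$.** Let $I=\{t\in\mathbb R:\tfrac14\le|t|\le4\}$. A function $\gamma:\mathbb R\to\mathbb R$ is called smooth and non-flat near the origin if there are an integer $N\ge4$, numbers $\delta,c>0$, functions $Q\in C^N(I)$ and $r_0\in C^{N-1}(J)$ with $J:=Q'(I)$, and a sequence $a_j\to0$ such that: 1. $\gamma\in C^N(V)$ and $\gamma'\ne0$ on $V=\{0<|t|<\delta\}$, and $\sup_{\alpha>0}\#\{j\ge0:\ \alpha\le|2^{-j}\gamma'(2^{-j})|\le2\alpha\}<\infty$; 2. for all sufficiently large $j$, $\dfrac{\gamma(2^{-j}t)}{2^{-j}\gamma'(2^{-j})}=Q(t)+Q_j(t)$ for $t\in I$, where $\|Q_j\|_{C^N(I)}\le a_j$, and $\dfrac{(\gamma')^{-1}(s\gamma'(2^{-j}))}{(\gamma')^{-1}(\gamma'(2^{-j}))}=r_0(s)+r_{0,j}(s)$ for $s\in J$, where $\|r_{0,j}\|_{C^{N-1}(J)}\le a_j$; here $(\gamma')^{-1}$ is a branch of the inverse of $\gamma'$ on $V$ with $(\gamma')^{-1}(\gamma'(2^{-j}))=2^{-j}$;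 3. $|Q''|>c$ on $I$, $|r_0'|>c$ on $J$, and $|t_1r_0'(t_1)-t_2r_0'(t_2)|>c\,|t_1-t_2|$ for all distinct $t_1,t_2\in J$. **The operators.** Let $\gamma$ be smooth and non-flat near the origin. For $s>0$ put $$r(s):=\lim_{j\to\infty}2^{j}\,(\gamma')^{-1}\big(s\,\gamma'(2^{-j})\big)>0,$$ where the inverse of $\gamma'$ is taken on the positive side of the origin; this is the function $r_0$, continued from $J$ to all $s>0$. If $\gamma'$ changes sign at the origin, define $r(s)<0$ for $s<0$ by the same limit, with the inverse taken on the negative side. Let $R(s):=\int_1^s r(u)\,du$. Let $\phi\in C^\infty(\mathbb R)$ have compact support contained in $\{\tfrac1{10}<|x|<10\}$, and suppose that the phase $R$ is defined where it is used below, i.e. that either $\operatorname{supp}\phi\subset(0,\infty)$, or $r$ is defined on $\mathbb R\setminus\{0\}$ and integrable near $0$. For integers $k,m,j\ge0$ and $p_0\in[2^m,2^{m+1}]$ put $$\phi_k(\xi):=\phi\Big(\frac{\xi}{2^k}\Big),\qquad \psi_{m,p_0,j}(\xi):=2^{-\frac m2}\,e^{-i\,p_0\,R\left(\frac{\xi}{2^jp_0}\right)}\,\phi\Big(\frac{\xi}{2^{m+j}}\Big),\qquad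 \check F(x):=\frac1{2\pi}\int_{\mathbb R}F(\xi)\,e^{i\xi x}\,d\xi .$$ **Proposition.** Let $2\le p<\infty$ and $\frac1p+\frac1{p'}=1$. There is a constant $C>0$, depending only on $p$, $\gamma$ and $\phi$, such that for every integer $m\ge1$ and every $f\in L^p(\mathbb R)$ $$\Big\|\Big(\sum_{j\ge0}\ \sum_{p_0=2^m}^{2^{m+1}}\big|f*\check\phi_{m+j}*\check\psi_{m,p_0,j}\big|^2\Big)^{1/2}\Big\|_{L^p(\mathbb R)}\le C\,m^{\frac2{p'}-1}\,\|f\|_{L^p(\mathbb R)} .$$ -/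

import Mathlib

open Set Filter Topology MeasureTheory
open scoped ENNReal ContDiff Convolution

/-- The punctured neighbourhood `{t : 0 < |t| < δ}` of the origin. -/
def puncturedNhd (δ : ℝ) : Set ℝ := {t | 0 < |t| ∧ |t| < δ}

/-- The set `I = {t : 1/4 ≤ |t| ≤ 4}`. -/
def scaleSet : Set ℝ := {t | 1 / 4 ≤ |t| ∧ |t| ≤ 4}

/-- `J = Q'(I)`. -/
noncomputable def dualSet (Q : ℝ → ℝ) : Set ℝ := derivWithin Q scaleSet '' scaleSet

/-- `f ∈ C^k(S)` and `‖f‖_{C^k(S)} ≤ a`. -/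
def CkNormLE (k : ℕ) (S : Set ℝ) (f : ℝ → ℝ) (a : ℝ) : Prop :=
  ContDiffOn ℝ k f S ∧ ∀ i ≤ k, ∀ t ∈ S, |iteratedDerivWithin i f S t| ≤ a

/-- The conditions defining a smooth non-flat function `γ` near the origin, for given witnesses:
order of smoothness `N`, radius `δ`, main terms `Q` (for `γ`) and `r` (for the inverse of `γ'`),
and non-flatness constant `c`. The rescaled expansions concern arguments near the origin, hence all
sufficiently large `j`. -/
structure NonFlatWitness (γ : ℝ → ℝ) (N : ℕ) (δ : ℝ) (Q r : ℝ → ℝ) (c : ℝ) : Prop where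
  four_le : 4 ≤ N
  delta_pos : 0 < δ
  c_pos : 0 < c
  /-- smoothness -/
  smooth : ContDiffOn ℝ N γ (puncturedNhd δ)
  /-- no critical points -/
  deriv_ne_zero : ∀ t ∈ puncturedNhd δ, deriv γ t ≠ 0
  /-- variation -/
  variation : ∃ B : ℕ, ∀ α : ℝ, 0 < α →
    {j : ℕ | |(2 : ℝ) ^ (-(j : ℤ)) * deriv γ ((2 : ℝ) ^ (-(j : ℤ)))| ∈ Icc α (2 * α)}.encard ≤ B
  main_smooth : ContDiffOn ℝ N Q scaleSet
  inv_smooth : ContDiffOn ℝ (N - 1 : ℕ) r (dualSet Q)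
  /-- asymptotic behaviour of `γ` and of (a branch `g` of) the inverse function of `γ'` -/
  asymptotic : ∃ (a : ℕ → ℝ) (Qj rj : ℕ → ℝ → ℝ) (g : ℝ → ℝ),
    Tendsto a atTop (𝓝 0) ∧
    ∀ᶠ j : ℕ in atTop,
      CkNormLE N scaleSet (Qj j) (a j) ∧
      CkNormLE (N - 1) (dualSet Q) (rj j) (a j) ∧
      (∀ t ∈ scaleSet,
        γ ((2 : ℝ) ^ (-(j : ℤ)) * t) / ((2 : ℝ) ^ (-(j : ℤ)) * deriv γ ((2 : ℝ) ^ (-(j : ℤ))))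
          = Q t + Qj j t) ∧
      g (deriv γ ((2 : ℝ) ^ (-(j : ℤ)))) = (2 : ℝ) ^ (-(j : ℤ)) ∧
      ∀ s ∈ dualSet Q,
        g (s * deriv γ ((2 : ℝ) ^ (-(j : ℤ)))) ∈ puncturedNhd δ ∧
        deriv γ (g (s * deriv γ ((2 : ℝ) ^ (-(j : ℤ))))) = s * deriv γ ((2 : ℝ) ^ (-(j : ℤ))) ∧
        g (s * deriv γ ((2 : ℝ) ^ (-(j : ℤ)))) / g (deriv γ ((2 : ℝ) ^ (-(j : ℤ))))
          = r s + rj j s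
  /-- non-flatness: `|Q''| > c` on `I` -/
  nonflat : ∀ t ∈ scaleSet, c < |iteratedDerivWithin 2 Q scaleSet t|
  /-- non-flatness: `|r'| > c` on `J` -/
  nonflat_inv : ∀ s ∈ dualSet Q, c < |derivWithin r (dualSet Q) s|
  /-- non-flatness: the map `s ↦ s r'(s)` expands distances on `J` -/
  nonflat_dual : ∀ s₁ ∈ dualSet Q, ∀ s₂ ∈ dualSet Q, s₁ ≠ s₂ →
    c < |s₁ * derivWithin r (dualSet Q) s₁ - s₂ * derivWithin r (dualSet Q) s₂| / |s₁ - s₂|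

/-- The class of functions that are smooth and non-flat near the origin. -/
def NonFlatNearZero (γ : ℝ → ℝ) : Prop :=
  ∃ (N : ℕ) (δ : ℝ) (Q r : ℝ → ℝ) (c : ℝ), NonFlatWitness γ N δ Q r c

/-- `ρ = lim_j (γ')⁻¹(s γ'(2⁻ʲ)) / 2⁻ʲ`, where the inverse is taken on the side of the origin given
by the sign of `s`. For a non-flat `γ` such a `ρ` is unique; it exists for every `s > 0`, and it
exists for `s < 0` exactly when `γ'` changes sign at the origin. This is the main term of the
rescaled inverse of `γ'`, at an arbitrary `s` rather than only for `s ∈ J`. -/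
def IsInverseLimitAt (γ : ℝ → ℝ) (s ρ : ℝ) : Prop :=
  0 < s * ρ ∧ ∃ x : ℕ → ℝ,
    (∀ᶠ j : ℕ in atTop, deriv γ (x j) = s * deriv γ ((2 : ℝ) ^ (-(j : ℤ)))) ∧
    Tendsto (fun j : ℕ => x j / (2 : ℝ) ^ (-(j : ℤ))) atTop (𝓝 ρ)

/-- `R(s) = ∫₁ˢ r(u) du`. -/
noncomputable def phaseR (r : ℝ → ℝ) (s : ℝ) : ℝ := ∫ u in (1 : ℝ)..s, r u

/-- The inverse Fourier transform `F̌(x) = (2π)⁻¹ ∫ F(ξ) e^{i ξ x} dξ`. -/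
noncomputable def invFT (F : ℝ → ℂ) (x : ℝ) : ℂ :=
  (2 * (Real.pi : ℂ))⁻¹ * ∫ ξ : ℝ, F ξ * Complex.exp (Complex.I * (ξ : ℂ) * (x : ℂ))

/-- `φ_k(ξ) = φ(ξ / 2^k)`. -/
noncomputable def phiDil (φ : ℝ → ℂ) (k : ℕ) (ξ : ℝ) : ℂ := φ (ξ / 2 ^ k)

/-- `ψ_{m,p₀,j}(ξ) = 2^{-m/2} e^{-i p₀ R(ξ / (2^j p₀))} φ(ξ / 2^{m+j})`. -/
noncomputable def psiSymbol (φ : ℝ → ℂ) (r : ℝ → ℝ) (m p₀ j : ℕ) (ξ : ℝ) : ℂ :=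
  (((2 : ℝ) ^ (-(m : ℝ) / 2) : ℝ) : ℂ) *
    Complex.exp (-Complex.I * (p₀ : ℂ) * (phaseR r (ξ / (2 ^ j * (p₀ : ℝ))) : ℂ)) *
    φ (ξ / 2 ^ (m + j))

/-- `f * φ̌_{m+j} * ψ̌_{m,p₀,j}`. -/
noncomputable def piece (φ : ℝ → ℂ) (r : ℝ → ℝ) (f : ℝ → ℂ) (m p₀ j : ℕ) : ℝ → ℂ :=
  (f ⋆[ContinuousLinearMap.mul ℂ ℂ, volume] invFT (phiDil φ (m + j)))
    ⋆[ContinuousLinearMap.mul ℂ ℂ, volume] invFT (psiSymbol φ r m p₀ j)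

/-- The square function
`(∑_j ∑_{p₀ = 2^m}^{2^{m+1}} |f * φ̌_{m+j} * ψ̌_{m,p₀,j}(x)|²)^{1/2}`, with values in `[0, ∞]`. -/
noncomputable def squareFn (φ : ℝ → ℂ) (r : ℝ → ℝ) (f : ℝ → ℂ) (m : ℕ) (x : ℝ) : ℝ≥0∞ :=
  (∑' j : ℕ, ∑ p₀ ∈ Finset.Icc (2 ^ m) (2 ^ (m + 1)), ‖piece φ r f m p₀ j x‖ₑ ^ 2) ^ (1 / 2 : ℝ)

/-!
The square function is bounded on `L^p` for `2 ≤ p < ∞` with a constant that does not depend on `m`;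
since `2 / p' - 1 ≥ 0` and `m ≥ 1`, this is stronger than the stated inequality.

*The phase.* The rescaled derivatives `γ'(2^{-j} t) / γ'(2^{-j})` converge for every `t ≠ 0`, and the
limit is `C³` with nonvanishing derivative, because it is `Q'` up to the dilations `t ↦ 2t`. The
function `r` inverts the limit, so `r` is `C³` with `r' ≠ 0` (`inverseLimit_contDiffAt`).

*One scale.* For `2^m ≤ p, q ≤ 2^{m+1}` the difference of the phases of `ψ_{m,p,0}` and `ψ_{m,q,0}`
has, in the variable `ξ / 2^m`, a derivative that is `p - q` times a `C²` function bounded away from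
zero. Two integrations by parts give `|⟨ψ_{m,p,0}, ψ_{m,q,0}⟩| ≲ (1 + (p - q)²)⁻¹`
(`exists_inner_bound`), and the same for the derivatives of the symbols. By Schur's test, Plancherel's theorem and duality, the kernels
`ψ̌_{m,p,0}` satisfy Bessel's inequality `∑_p |∫ G ψ̌_{m,p,0}|² ≲ ∫ |G|² (1 + u²)⁻¹`
(`IsPhaseOn.exists_bessel`). Rescaling, with `w_j(x) = 2^j / (1 + (2^j x)²)`,
`∑_p |f * φ̌_{m+j} * ψ̌_{m,p,j}|² ≲ w_j * |f * φ̌_{m+j}|²`.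

*Locality.* The function `φ̌` factors as the convolution of a Haar function with a rapidly decreasing
kernel, since the Fourier transform of the Haar function has no zeros on the support of `φ`. As `w_j`
is almost constant at the scale `2^{-m-j}`, the cutoff `φ̌_{m+j}` may be replaced by the dilated Haar
function `η_{m+j}`, of compact support in `|x| ≤ 2^{-m-j}`
(`IsPhaseOn.exists_sum_piece_le_haarDil`).

*Summation over the scales.* By Plancherel's theorem, `∑_n ‖f * η_n‖₂² ≲ ‖f‖₂²`. On a level
set of `w_j * v`, the function `f * η_{m+j}` depends only on the part of `f` on a level set of the
maximal function `M v`, since `η_{m+j}` is supported at a scale finer than that of `w_j`; by the layer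
cake formula, the `L²` inequality for these truncations of `f` gives the weighted inequality
`∑_j ∫ |f * η_{m+j}|² (w_j * v) ≲ ∫ |f|² M v`
(`tsum_lintegral_convolution_haarDil_mul_le`). Testing with `v = F^{p/2-1}` for
`F = ∑_j w_j * |f * η_{m+j}|²` and using Hölder's inequality and the maximal theorem,
`‖F‖_{p/2} ≲ ‖f‖_p²` (`exists_lintegral_rpow_le_of_forall_dyadicMax`).
-/

/-! ### The limit profile of the rescaled derivatives and its inverse -/

lemma scaleSet_mem_nhds {t : ℝ} (h1 : 1 / 4 < |t|) (h2 : |t| < 4) : scaleSet ∈ 𝓝 t := by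
  have h3 : ∀ᶠ x : ℝ in 𝓝 t, 1 / 4 < |x| := continuous_abs.continuousAt.eventually_const_lt h1
  have h4 : ∀ᶠ x : ℝ in 𝓝 t, |x| < 4 := continuous_abs.continuousAt.eventually_lt_const h2
  filter_upwards [h3, h4] with x hx1 hx2 using ⟨hx1.le, hx2.le⟩

/-- The rescaled derivatives of `γ` converge to `Q'` in the interior of `I`, locally uniformly;
the locally uniform convergence is expressed along convergent sequences of arguments. -/
lemma NonFlatWitness.tendsto_ratio {γ : ℝ → ℝ} {N : ℕ} {δ : ℝ} {Q ρ : ℝ → ℝ} {c : ℝ}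
    (hw : NonFlatWitness γ N δ Q ρ c) {t : ℝ} (h1 : 1 / 4 < |t|) (h2 : |t| < 4)
    {x : ℕ → ℝ} (hx : Tendsto x atTop (𝓝 t)) :
    Tendsto (fun j : ℕ => deriv γ ((2 : ℝ) ^ (-(j : ℤ)) * x j) / deriv γ ((2 : ℝ) ^ (-(j : ℤ))))
      atTop (𝓝 (deriv Q t)) := by
  obtain ⟨a, Qj, rj, g, ha, hev⟩ := hw.asymptotic
  have hN := hw.four_le
  have hQ : ContDiffAt ℝ N Q t := hw.main_smooth.contDiffAt (scaleSet_mem_nhds h1 h2)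
  have hQc : ContinuousAt (deriv Q) t := by
    have : ContDiffAt ℝ (1 : ℕ) Q t := hQ.of_le (by exact_mod_cast (by omega : 1 ≤ N))
    exact (this.derivWithin (m := 0) (by simp)).continuousAt
  have hin : ∀ᶠ j in atTop, 1 / 4 < |x j| ∧ |x j| < 4 :=
    ((hx.abs).eventually_const_lt h1).and ((hx.abs).eventually_lt_const h2)
  have hrem : Tendsto (fun j => deriv (Qj j) (x j)) atTop (𝓝 0) := by
    refine squeeze_zero_norm' ?_ ha
    filter_upwards [hin, hev] with j hj hd
    have h := hd.1.2 1 (by omega) (x j) ⟨hj.1.le, hj.2.le⟩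
    rw [iteratedDerivWithin_one, derivWithin_of_mem_nhds (scaleSet_mem_nhds hj.1 hj.2)] at h
    exact h
  have hlim := (hQc.tendsto.comp hx).add hrem
  rw [add_zero] at hlim
  refine hlim.congr' ?_
  filter_upwards [hin, hev] with j hj hd
  have hmem := scaleSet_mem_nhds hj.1 hj.2
  have hdQ : DifferentiableAt ℝ Q (x j) :=
    (hw.main_smooth.contDiffAt hmem).differentiableAt (by
      exact_mod_cast (by omega : N ≠ 0))
  have hdQj : DifferentiableAt ℝ (Qj j) (x j) :=
    (hd.1.1.contDiffAt hmem).differentiableAt (by exact_mod_cast (by omega : N ≠ 0))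
  have hpow : (2 : ℝ) ^ (-(j : ℤ)) ≠ 0 := by positivity
  have heq : (fun t => γ ((2 : ℝ) ^ (-(j : ℤ)) * t) /
      ((2 : ℝ) ^ (-(j : ℤ)) * deriv γ ((2 : ℝ) ^ (-(j : ℤ))))) =ᶠ[𝓝 (x j)]
      (fun t => Q t + Qj j t) := by
    filter_upwards [hmem] with t ht using hd.2.2.1 t ht
  have h := heq.deriv_eq
  rw [deriv_div_const, deriv_fun_add hdQ hdQj, deriv_comp_mul_left, smul_eq_mul,
    mul_div_mul_left _ _ hpow] at h
  simp only [Function.comp]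
  exact h.symm

/-- The limit profile of the rescaled derivatives of `γ` exists near `t`, along convergent
sequences of arguments, and is a `C³` function with nonvanishing derivative at `t`. -/
def HasProfileAt (γ : ℝ → ℝ) (t : ℝ) : Prop :=
  ∃ h : ℝ → ℝ, ContDiffAt ℝ 3 h t ∧ deriv h t ≠ 0 ∧ ∀ᶠ s in 𝓝 t, ∀ x : ℕ → ℝ,
    Tendsto x atTop (𝓝 s) →
    Tendsto (fun j : ℕ => deriv γ ((2 : ℝ) ^ (-(j : ℤ)) * x j) / deriv γ ((2 : ℝ) ^ (-(j : ℤ))))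
      atTop (𝓝 (h s))

/-- For `1/4 < |t| < 4` the limit profile is `Q'`, and its derivative is `Q''`. -/
lemma NonFlatWitness.hasProfileAt_of_mem {γ : ℝ → ℝ} {N : ℕ} {δ : ℝ} {Q ρ : ℝ → ℝ} {c : ℝ}
    (hw : NonFlatWitness γ N δ Q ρ c) {t : ℝ} (h1 : 1 / 4 < |t|) (h2 : |t| < 4) :
    HasProfileAt γ t := by
  have hN := hw.four_le
  have hmem := scaleSet_mem_nhds h1 h2
  have h3 : ∀ᶠ x : ℝ in 𝓝 t, 1 / 4 < |x| := continuous_abs.continuousAt.eventually_const_lt h1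
  have h4 : ∀ᶠ x : ℝ in 𝓝 t, |x| < 4 := continuous_abs.continuousAt.eventually_lt_const h2
  refine ⟨deriv Q, ?_, ?_, ?_⟩
  · have hQ : ContDiffAt ℝ N Q t := hw.main_smooth.contDiffAt hmem
    have : ContDiffAt ℝ (4 : ℕ) Q t := hQ.of_le (by exact_mod_cast hN)
    exact this.derivWithin (by norm_num)
  · have hc := hw.nonflat t (mem_of_mem_nhds hmem)
    have : iteratedDerivWithin 2 Q scaleSet t = deriv (deriv Q) t := by
      have hu : (scaleSet : Set ℝ) =ᶠ[𝓝 t] univ := eventuallyEq_univ.2 hmem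
      rw [iteratedDerivWithin, iteratedFDerivWithin_congr_set hu, ← iteratedDerivWithin,
        iteratedDerivWithin_univ, iteratedDeriv_eq_iterate]
      rfl
    rw [this] at hc
    exact abs_pos.1 (hw.c_pos.trans hc)
  · filter_upwards [h3, h4] with s hs1 hs2 x hx using hw.tendsto_ratio hs1 hs2 hx

/-- The ratio of the derivatives of `γ` at consecutive dyadic points converges to `β = Q'(1/2)`.
Since also `β * Q'(2) = 1`, the limit is nonzero. -/
lemma NonFlatWitness.ratio_tendsto {γ : ℝ → ℝ} {N : ℕ} {δ : ℝ} {Q ρ : ℝ → ℝ} {c : ℝ}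
    (hw : NonFlatWitness γ N δ Q ρ c) : ∃ β : ℝ, β ≠ 0 ∧
      Tendsto (fun j : ℕ => deriv γ ((2 : ℝ) ^ (-((j + 1 : ℕ) : ℤ))) /
        deriv γ ((2 : ℝ) ^ (-(j : ℤ)))) atTop (𝓝 β) ∧
      ∀ᶠ j : ℕ in atTop, deriv γ ((2 : ℝ) ^ (-(j : ℤ))) ≠ 0 := by
  have h1 := hw.tendsto_ratio (t := 1 / 2) (by norm_num [abs_of_pos]) (by norm_num [abs_of_pos])
    (tendsto_const_nhds (x := (1 / 2 : ℝ)))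
  have h2 := hw.tendsto_ratio (t := 2) (by norm_num [abs_of_pos]) (by norm_num [abs_of_pos])
    (tendsto_const_nhds (x := (2 : ℝ)))
  have hd : ∀ᶠ j : ℕ in atTop, deriv γ ((2 : ℝ) ^ (-(j : ℤ))) ≠ 0 := by
    have h0 : Tendsto (fun j : ℕ => (2 : ℝ) ^ (-(j : ℤ))) atTop (𝓝 0) := by
      have := tendsto_pow_atTop_nhds_zero_of_lt_one (r := (2 : ℝ)⁻¹) (by norm_num) (by norm_num)
      refine this.congr fun j => ?_
      rw [zpow_neg, zpow_natCast, inv_pow]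
    filter_upwards [h0.eventually_lt_const hw.delta_pos] with j hj
    have hpos : (0 : ℝ) < (2 : ℝ) ^ (-(j : ℤ)) := by positivity
    exact hw.deriv_ne_zero _ ⟨by rwa [abs_of_pos hpos], by rwa [abs_of_pos hpos]⟩
  have e1 : ∀ j : ℕ, (2 : ℝ) ^ (-(j : ℤ)) * (1 / 2) = (2 : ℝ) ^ (-((j + 1 : ℕ) : ℤ)) := by
    intro j; push_cast; rw [neg_add, zpow_add₀ two_ne_zero]; norm_num
  have e2 : ∀ j : ℕ, (2 : ℝ) ^ (-((j + 1 : ℕ) : ℤ)) * 2 = (2 : ℝ) ^ (-(j : ℤ)) := by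
    intro j; rw [← e1]; ring
  simp_rw [e1] at h1
  have h2' := (tendsto_add_atTop_iff_nat 1).2 h2
  simp_rw [e2] at h2'
  refine ⟨_, ?_, h1, hd⟩
  intro h0
  have h3 := h1.mul h2'
  have h4 : Tendsto (fun _ : ℕ => (1 : ℝ)) atTop (𝓝 (deriv Q (1 / 2) * deriv Q 2)) := by
    refine h3.congr' ?_
    filter_upwards [hd, (tendsto_add_atTop_nat 1).eventually hd] with j hj hj1
    field_simp
  have := tendsto_nhds_unique h4 tendsto_const_nhds
  rw [h0, zero_mul] at this
  exact zero_ne_one this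

/-- The limit profile `h` satisfies `h(s) = β h(2s)`. -/
lemma HasProfileAt.half {γ : ℝ → ℝ} {β : ℝ} (hβ : β ≠ 0)
    (hr : Tendsto (fun j : ℕ => deriv γ ((2 : ℝ) ^ (-((j + 1 : ℕ) : ℤ))) /
        deriv γ ((2 : ℝ) ^ (-(j : ℤ)))) atTop (𝓝 β))
    (hd : ∀ᶠ j : ℕ in atTop, deriv γ ((2 : ℝ) ^ (-(j : ℤ))) ≠ 0) {t : ℝ}
    (h : HasProfileAt γ (2 * t)) : HasProfileAt γ t := by
  obtain ⟨h, hs, hne, hl⟩ := h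
  refine ⟨fun s => h (2 * s) * β, ?_, ?_, ?_⟩
  · exact (ContDiffAt.comp t hs (by fun_prop)).mul contDiffAt_const
  · rw [deriv_mul_const_field, deriv_comp_mul_left]
    simp [hne, hβ]
  · have hc : Tendsto (fun s : ℝ => 2 * s) (𝓝 t) (𝓝 (2 * t)) := by
      exact (continuous_const.mul continuous_id).tendsto t
    filter_upwards [hc.eventually hl] with s hs x hx
    -- shift the index by one, which turns `x j` into `2 * x (j - 1)`
    have h1 := hs (fun j => 2 * x (j - 1))
      ((tendsto_add_atTop_iff_nat 1).1 (by simpa using hx.const_mul 2))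
    have h2 := ((tendsto_add_atTop_iff_nat 1).2 h1).mul hr
    refine h2.congr' ?_
    filter_upwards [(tendsto_add_atTop_nat 1).eventually hd] with j hj
    have e : (2 : ℝ) ^ (-((j + 1 : ℕ) : ℤ)) * (2 * x (j + 1 - 1)) = (2 : ℝ) ^ (-(j : ℤ)) * x j := by
      push_cast; rw [neg_add, zpow_add₀ two_ne_zero]; simp; ring
    rw [e]
    field_simp

/-- The limit profile `h` satisfies `h(s) = β⁻¹ h(s/2)`. -/
lemma HasProfileAt.double {γ : ℝ → ℝ} {β : ℝ} (hβ : β ≠ 0)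
    (hr : Tendsto (fun j : ℕ => deriv γ ((2 : ℝ) ^ (-((j + 1 : ℕ) : ℤ))) /
        deriv γ ((2 : ℝ) ^ (-(j : ℤ)))) atTop (𝓝 β))
    (hd : ∀ᶠ j : ℕ in atTop, deriv γ ((2 : ℝ) ^ (-(j : ℤ))) ≠ 0) {t : ℝ}
    (h : HasProfileAt γ t) : HasProfileAt γ (2 * t) := by
  obtain ⟨h, hs, hne, hl⟩ := h
  have e0 : (1 / 2 : ℝ) * (2 * t) = t := by ring
  refine ⟨fun s => h ((1 / 2) * s) * β⁻¹, ?_, ?_, ?_⟩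
  · refine (ContDiffAt.comp (2 * t) ?_ (by fun_prop)).mul contDiffAt_const
    rwa [e0]
  · rw [deriv_mul_const_field, deriv_comp_mul_left, e0]
    simp [hne, hβ]
  · have hc : Tendsto (fun s : ℝ => (1 / 2) * s) (𝓝 (2 * t)) (𝓝 t) := by
      have hcont : Continuous (fun s : ℝ => (1 / 2) * s) := by fun_prop
      simpa only [e0] using hcont.tendsto (2 * t)
    filter_upwards [hc.eventually hl] with s hs x hx
    have h1 := hs (fun j => (1 / 2) * x (j + 1))
      (((tendsto_add_atTop_iff_nat 1).2 hx).const_mul _)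
    have h2 := h1.mul (hr.inv₀ hβ)
    refine (tendsto_add_atTop_iff_nat 1).1 (h2.congr' ?_)
    filter_upwards [hd] with j hj
    have e : (2 : ℝ) ^ (-((j + 1 : ℕ) : ℤ)) * x (j + 1) =
        (2 : ℝ) ^ (-(j : ℤ)) * ((1 / 2) * x (j + 1)) := by
      push_cast; rw [neg_add, zpow_add₀ two_ne_zero]; simp; ring
    rw [e]
    field_simp

/-- Away from the origin the rescaled derivatives of a non-flat function have a `C³` limit profile
with nonvanishing derivative: dyadic dilations carry the statement from `1/4 < |t| < 4` to all
`t ≠ 0`. -/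
lemma NonFlatNearZero.hasProfileAt {γ : ℝ → ℝ} (hγ : NonFlatNearZero γ) {t : ℝ} (ht : t ≠ 0) :
    HasProfileAt γ t := by
  obtain ⟨N, δ, Q, ρ, c, hw⟩ := hγ
  obtain ⟨β, hβ, hr, hd⟩ := hw.ratio_tendsto
  have hup : ∀ n : ℕ, ∀ t : ℝ, 1 ≤ |t| → |t| < 2 ^ n → HasProfileAt γ t := by
    intro n
    induction n with
    | zero => intro t h1 h2; simp at h2; linarith
    | succ n ih =>
      intro t h1 h2
      rcases lt_or_ge |t| 2 with h | h
      · exact hw.hasProfileAt_of_mem (by linarith) (by linarith)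
      · have : HasProfileAt γ (2 * (t / 2)) := by
          refine HasProfileAt.double hβ hr hd (ih (t / 2) ?_ ?_)
          · rw [abs_div, abs_two]; linarith
          · rw [abs_div, abs_two]; rw [pow_succ] at h2; linarith
        rwa [mul_div_cancel₀ _ two_ne_zero] at this
  have hdown : ∀ n : ℕ, ∀ t : ℝ, 1 ≤ 2 ^ n * |t| → HasProfileAt γ t := by
    intro n
    induction n with
    | zero =>
      intro t h1
      obtain ⟨n, hn⟩ := pow_unbounded_of_one_lt |t| (one_lt_two)
      exact hup n t (by simpa using h1) hn
    | succ n ih =>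
      intro t h1
      refine HasProfileAt.half hβ hr hd (ih _ ?_)
      rw [abs_mul, abs_two]
      rw [pow_succ] at h1; linarith
  obtain ⟨n, hn⟩ := pow_unbounded_of_one_lt |t|⁻¹ (one_lt_two)
  have := abs_pos.2 ht
  exact hdown n t (by
    rw [← inv_mul_cancel₀ this.ne']
    gcongr)

/-- The limit of the rescaled derivatives of `γ` at `t`, a junk value where there is no limit. -/
noncomputable def profile (γ : ℝ → ℝ) (t : ℝ) : ℝ :=
  limUnder atTop fun j : ℕ => deriv γ ((2 : ℝ) ^ (-(j : ℤ)) * t) / deriv γ ((2 : ℝ) ^ (-(j : ℤ)))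

lemma HasProfileAt.profile {γ : ℝ → ℝ} {t : ℝ} (h : HasProfileAt γ t) :
    ContDiffAt ℝ 3 (profile γ) t ∧ deriv (profile γ) t ≠ 0 ∧ ∀ x : ℕ → ℝ,
    Tendsto x atTop (𝓝 t) →
    Tendsto (fun j : ℕ => deriv γ ((2 : ℝ) ^ (-(j : ℤ)) * x j) / deriv γ ((2 : ℝ) ^ (-(j : ℤ))))
      atTop (𝓝 (profile γ t)) := by
  obtain ⟨h, hs, hne, hl⟩ := h
  have heq : _root_.profile γ =ᶠ[𝓝 t] h := by
    filter_upwards [hl] with s hs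
    exact (hs (fun _ => s) tendsto_const_nhds).limUnder_eq
  refine ⟨hs.congr_of_eventuallyEq heq, by rwa [heq.deriv_eq], fun x hx => ?_⟩
  rw [heq.eq_of_nhds]
  exact hl.self_of_nhds x hx

/-- The limit of the rescaled inverses of `γ'` inverts the limit of the rescaled derivatives. -/
lemma IsInverseLimitAt.profile_eq {γ : ℝ → ℝ} (hγ : NonFlatNearZero γ) {s ρ : ℝ}
    (h : IsInverseLimitAt γ s ρ) : profile γ ρ = s := by
  obtain ⟨hpos, x, hx, hlim⟩ := h
  have hρ : ρ ≠ 0 := right_ne_zero_of_mul hpos.ne'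
  have h1 := (hγ.hasProfileAt hρ).profile.2.2 _ hlim
  obtain ⟨N, δ, Q, ρ', c, hw⟩ := hγ
  obtain ⟨β, hβ, hr, hd⟩ := hw.ratio_tendsto
  refine tendsto_nhds_unique (h1.congr' ?_) tendsto_const_nhds
  filter_upwards [hx, hd] with j hj hj'
  rw [mul_div_cancel₀ _ (by positivity), hj]
  field_simp

/-- The limit profile is injective on each side of the origin. -/
lemma profile_injOn {γ : ℝ → ℝ} (hγ : NonFlatNearZero γ) {a b : ℝ} (hab : 0 < a * b)
    (h : profile γ a = profile γ b) : a = b := by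
  -- Rolle's theorem on the segment between `a` and `b`, which avoids the origin
  have key : ∀ a b : ℝ, a < b → 0 < a * b → profile γ a ≠ profile γ b := by
    intro a b hlt hab h
    have hne : ∀ x ∈ Icc a b, x ≠ 0 := by
      rintro x ⟨h1, h2⟩ rfl
      exact absurd hab (not_lt.2 (mul_nonpos_of_nonpos_of_nonneg h1 h2))
    obtain ⟨x, hx, h0⟩ := exists_deriv_eq_zero hlt (fun x hx =>
      ((hγ.hasProfileAt (hne x hx)).profile.1.continuousAt).continuousWithinAt) h
    exact (hγ.hasProfileAt (hne x ⟨hx.1.le, hx.2.le⟩)).profile.2.1 h0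
  rcases lt_trichotomy a b with hl | hl | hl
  · exact absurd h (key a b hl hab)
  · exact hl
  · exact absurd h.symm (key b a hl (by rwa [mul_comm]))

/-- On an open set where it is given by the limit of the rescaled inverses of `γ'`, the function
`r` is `C³` with nonvanishing derivative. -/
lemma inverseLimit_contDiffAt {γ : ℝ → ℝ} (hγ : NonFlatNearZero γ) {r : ℝ → ℝ} {U : Set ℝ}
    (hU : IsOpen U) (hr : ∀ s ∈ U, IsInverseLimitAt γ s (r s)) {s : ℝ} (hs : s ∈ U) :
    ContDiffAt ℝ 3 r s ∧ deriv r s ≠ 0 := by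
  have hPr : ∀ s ∈ U, profile γ (r s) = s := fun s hs => (hr s hs).profile_eq hγ
  have hpos : 0 < s * r s := (hr s hs).1
  have hr0 : r s ≠ 0 := right_ne_zero_of_mul hpos.ne'
  have hs0 : s ≠ 0 := left_ne_zero_of_mul hpos.ne'
  obtain ⟨hc, hne, -⟩ := (hγ.hasProfileAt hr0).profile
  have hstrict : HasStrictDerivAt (profile γ) (deriv (profile γ) (r s)) (r s) :=
    hc.hasStrictDerivAt (by norm_num)
  -- `r` is the local inverse of the profile at `r s`: both `r (profile γ t)` and `t` lie on the
  -- side of the origin determined by `s`, where the profile is injective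
  have hleft : ∀ᶠ t in 𝓝 (r s), r (profile γ t) = t := by
    have h1 : ∀ᶠ t in 𝓝 (r s), profile γ t ∈ U :=
      hc.continuousAt.eventually_mem (by rw [hPr s hs]; exact hU.mem_nhds hs)
    have h2 : ∀ᶠ t in 𝓝 (r s), 0 < t * s :=
      (continuousAt_id.mul continuousAt_const).eventually_const_lt
        (by simpa [mul_comm] using hpos)
    have h3 : ∀ᶠ t in 𝓝 (r s), 0 < profile γ t * s :=
      (hc.continuousAt.mul continuousAt_const).eventually_const_lt
        (by simpa only [Pi.mul_apply, hPr s hs] using mul_self_pos.2 hs0)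
    filter_upwards [h1, h2, h3] with t h1 h2 h3
    refine profile_injOn hγ ?_ (hPr _ h1)
    have h4 := (hr _ h1).1
    have h5 : 0 < (r (profile γ t) * t) * ((profile γ t * s) ^ 2) := by
      have := mul_pos (mul_pos h4 h2) h3
      nlinarith [this]
    exact (mul_pos_iff_of_pos_right (pow_pos h3 2)).1 h5
  have hfd := (hc.differentiableAt (by norm_num)).hasFDerivAt
  have hfe : HasFDerivAt (profile γ)
      ((ContinuousLinearEquiv.unitsEquivAut ℝ (Units.mk0 _ hne) : ℝ ≃L[ℝ] ℝ) : ℝ →L[ℝ] ℝ) (r s) :=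
    (hstrict.hasStrictFDerivAt_equiv hne).hasFDerivAt
  have hinv := hc.to_localInverse hfe (by norm_num)
  have heq := (hc.hasStrictFDerivAt' hfe (by norm_num)).localInverse_unique hleft
  rw [hPr s hs] at hinv heq
  refine ⟨hinv.congr_of_eventuallyEq heq, ?_⟩
  have hd := hstrict.to_local_left_inverse hne hleft
  rw [hPr s hs] at hd
  rw [hd.hasDerivAt.deriv]
  exact inv_ne_zero hne

/-! ### Integration by parts in oscillatory integrals -/

lemma integrable_of_continuousOn_of_zero_off {E : Type*} [NormedAddCommGroup E] {K : Set ℝ}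
    (hK : IsCompact K) {f : ℝ → E} (hf : ContinuousOn f K) (h0 : ∀ x ∉ K, f x = 0) :
    Integrable f :=
  (integrableOn_iff_integrable_of_support_subset
    (fun x hx => by_contra fun h => hx (h0 x h))).1 (hf.integrableOn_compact hK)

lemma norm_cexp_neg_I_mul (x : ℝ) : ‖Complex.exp (-Complex.I * (x : ℂ))‖ = 1 := by
  rw [Complex.norm_exp]; simp

/-- Integration by parts against an oscillating factor `e^{-iΨ}` with `Ψ' = D θ`. -/
lemma integral_oscillating_by_parts {U K : Set ℝ} (hK : IsCompact K) (hKU : K ⊆ U)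
    {Ψ θ θ' : ℝ → ℝ} {A A' : ℝ → ℂ} {D : ℝ}
    (hΨ : ∀ x ∈ U, HasDerivAt Ψ (D * θ x) x) (hθ : ∀ x ∈ U, HasDerivAt θ (θ' x) x)
    (hθ' : ContinuousOn θ' U) (hθ0 : ∀ x ∈ U, θ x ≠ 0)
    (hA : ∀ x ∈ U, HasDerivAt A (A' x) x) (hA' : ContinuousOn A' U)
    (hA0 : ∀ x ∉ K, A x = 0) (hA0' : ∀ x ∉ K, A' x = 0) :
    ∫ x, Complex.exp (-Complex.I * (Ψ x : ℂ)) * (A' x / θ x - A x * θ' x / (θ x : ℂ) ^ 2)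
      = Complex.I * D * ∫ x, Complex.exp (-Complex.I * (Ψ x : ℂ)) * A x := by
  have hΨc : ContinuousOn Ψ K := fun x hx => (hΨ x (hKU hx)).continuousAt.continuousWithinAt
  have hθc : ContinuousOn θ K := fun x hx => (hθ x (hKU hx)).continuousAt.continuousWithinAt
  have hAc : ContinuousOn A K := fun x hx => (hA x (hKU hx)).continuousAt.continuousWithinAt
  have hθne : ∀ x ∈ K, (θ x : ℂ) ≠ 0 := fun x hx => by exact_mod_cast hθ0 x (hKU hx)
  have hE : ContinuousOn (fun x => Complex.exp (-Complex.I * (Ψ x : ℂ))) K := by fun_prop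
  have hθC : ContinuousOn (fun x => (θ x : ℂ)) K := by fun_prop
  have hθC' : ContinuousOn (fun x => (θ' x : ℂ)) K := by
    have := hθ'.mono hKU; fun_prop
  have i1 : Integrable (fun x => Complex.exp (-Complex.I * (Ψ x : ℂ)) *
      (A' x / θ x - A x * θ' x / (θ x : ℂ) ^ 2)) := by
    refine integrable_of_continuousOn_of_zero_off hK (hE.mul
      (((hA'.mono hKU).div hθC hθne).sub ((hAc.mul hθC').div (hθC.pow 2) fun x hx =>
        pow_ne_zero 2 (hθne x hx)))) fun x hx => ?_
    simp [hA0 x hx, hA0' x hx]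
  have i2 : Integrable (fun x => Complex.exp (-Complex.I * (Ψ x : ℂ)) * A x) := by
    refine integrable_of_continuousOn_of_zero_off hK (hE.mul hAc) fun x hx => ?_
    simp [hA0 x hx]
  have i3 : Integrable (fun x => Complex.exp (-Complex.I * (Ψ x : ℂ)) * (A x / θ x)) := by
    refine integrable_of_continuousOn_of_zero_off hK (hE.mul (hAc.div hθC hθne)) fun x hx => ?_
    simp [hA0 x hx]
  have key := integral_eq_zero_of_hasDerivAt_of_integrable
    (f := fun x => Complex.exp (-Complex.I * (Ψ x : ℂ)) * (A x / θ x))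
    (f' := fun x => Complex.exp (-Complex.I * (Ψ x : ℂ)) *
      (A' x / θ x - A x * θ' x / (θ x : ℂ) ^ 2) -
      Complex.I * D * (Complex.exp (-Complex.I * (Ψ x : ℂ)) * A x)) ?_
    (i1.sub (i2.const_mul _)) i3
  · rw [integral_sub i1 (i2.const_mul _), integral_const_mul] at key
    exact sub_eq_zero.1 key
  · intro x
    by_cases hx : x ∈ K
    · have hxU := hKU hx
      have h1 := (((hΨ x hxU).ofReal_comp).const_mul (-Complex.I)).cexp
      have h2 := (hA x hxU).div (hθ x hxU).ofReal_comp (hθne x hx)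
      refine (h1.mul h2).congr_deriv ?_
      have := hθne x hx
      simp only [Pi.div_apply]
      push_cast
      field_simp
      ring
    · have hz : (fun x => Complex.exp (-Complex.I * (Ψ x : ℂ)) * (A x / θ x)) =ᶠ[𝓝 x]
          fun _ => 0 := by
        filter_upwards [hK.isClosed.isOpen_compl.mem_nhds hx] with y hy
        simp [hA0 y hy]
      have h1 := (hasDerivAt_const x (0 : ℂ)).congr_of_eventuallyEq hz
      convert h1 using 1
      simp [hA0 x hx, hA0' x hx]

/-- Nonstationary phase of order two, with an explicit constant: `∫ e^{-iΨ} A = O(D⁻²)` if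
`Ψ' = D θ` with `|θ| ≥ c`. -/
lemma norm_integral_oscillating_le {U K : Set ℝ} (hK : IsCompact K) (hKU : K ⊆ U)
    {Ψ θ θ' θ'' : ℝ → ℝ} {A A' A'' : ℝ → ℂ} {D c L M : ℝ} (hc : 0 < c)
    (hD : D ≠ 0) (hΨ : ∀ x ∈ U, HasDerivAt Ψ (D * θ x) x)
    (hθ : ∀ x ∈ U, HasDerivAt θ (θ' x) x) (hθ' : ∀ x ∈ U, HasDerivAt θ' (θ'' x) x)
    (hθ'' : ContinuousOn θ'' U) (hθ0 : ∀ x ∈ U, θ x ≠ 0)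
    (hA : ∀ x ∈ U, HasDerivAt A (A' x) x) (hA' : ∀ x ∈ U, HasDerivAt A' (A'' x) x)
    (hA'' : ContinuousOn A'' U)
    (hA0 : ∀ x ∉ K, A x = 0) (hA0' : ∀ x ∉ K, A' x = 0) (hA0'' : ∀ x ∉ K, A'' x = 0)
    (bθ : ∀ x ∈ K, c ≤ |θ x|) (bθ' : ∀ x ∈ K, |θ' x| ≤ L) (bθ'' : ∀ x ∈ K, |θ'' x| ≤ L)
    (bA : ∀ x ∈ K, ‖A x‖ ≤ M) (bA' : ∀ x ∈ K, ‖A' x‖ ≤ M) (bA'' : ∀ x ∈ K, ‖A'' x‖ ≤ M) :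
    ‖∫ x, Complex.exp (-Complex.I * (Ψ x : ℂ)) * A x‖ ≤
      M * (1 / c ^ 2 + 4 * L / c ^ 3 + 3 * L ^ 2 / c ^ 4) * volume.real K / D ^ 2 := by
  have hθc' : ContinuousOn θ' U := fun x hx => (hθ' x hx).continuousAt.continuousWithinAt
  have hθc : ContinuousOn θ U := fun x hx => (hθ x hx).continuousAt.continuousWithinAt
  have hAc' : ContinuousOn A' U := fun x hx => (hA' x hx).continuousAt.continuousWithinAt
  have hAc : ContinuousOn A U := fun x hx => (hA x hx).continuousAt.continuousWithinAt
  have hθne : ∀ x ∈ U, (θ x : ℂ) ≠ 0 := fun x hx => by exact_mod_cast hθ0 x hx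
  have hθC : ContinuousOn (fun x => (θ x : ℂ)) U := by fun_prop
  have hθC' : ContinuousOn (fun x => (θ' x : ℂ)) U := by fun_prop
  have hθC'' : ContinuousOn (fun x => (θ'' x : ℂ)) U := by fun_prop
  set G : ℝ → ℂ := fun x => A' x / θ x - A x * θ' x / (θ x : ℂ) ^ 2 with hG
  set G' : ℝ → ℂ := fun x => A'' x / θ x - 2 * A' x * θ' x / (θ x : ℂ) ^ 2
    - A x * θ'' x / (θ x : ℂ) ^ 2 + 2 * A x * (θ' x : ℂ) ^ 2 / (θ x : ℂ) ^ 3 with hG'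
  have hGd : ∀ x ∈ U, HasDerivAt G (G' x) x := by
    intro x hx
    have hne := hθne x hx
    have h1 := (hA' x hx).div (hθ x hx).ofReal_comp hne
    have h2 := ((hA x hx).mul (hθ' x hx).ofReal_comp).div ((hθ x hx).ofReal_comp.pow 2)
      (pow_ne_zero 2 hne)
    refine (h1.sub h2).congr_deriv ?_
    simp only [hG', Pi.mul_apply, Pi.pow_apply]
    field_simp
    push_cast
    ring
  have hGc' : ContinuousOn G' U := by
    refine ((((hA''.div hθC hθne).sub ?_).sub ?_).add ?_)
    · exact ((continuousOn_const.mul hAc').mul hθC').div (hθC.pow 2) fun x hx =>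
        pow_ne_zero 2 (hθne x hx)
    · exact (hAc.mul hθC'').div (hθC.pow 2) fun x hx => pow_ne_zero 2 (hθne x hx)
    · exact ((continuousOn_const.mul hAc).mul (hθC'.pow 2)).div (hθC.pow 3) fun x hx =>
        pow_ne_zero 3 (hθne x hx)
  have hG0 : ∀ x ∉ K, G x = 0 := fun x hx => by simp [hG, hA0 x hx, hA0' x hx]
  have hG0' : ∀ x ∉ K, G' x = 0 := fun x hx => by simp [hG', hA0 x hx, hA0' x hx, hA0'' x hx]
  have e1 := integral_oscillating_by_parts hK hKU hΨ hθ hθc' hθ0 hA hAc' hA0 hA0'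
  have e2 := integral_oscillating_by_parts hK hKU hΨ hθ hθc' hθ0 hGd hGc' hG0 hG0'
  set B := M * (1 / c ^ 2 + 4 * L / c ^ 3 + 3 * L ^ 2 / c ^ 4)
  have hbound : ∀ x ∈ K, ‖Complex.exp (-Complex.I * (Ψ x : ℂ)) *
      (G' x / θ x - G x * θ' x / (θ x : ℂ) ^ 2)‖ ≤ B := by
    intro x hx
    have hne := hθne x (hKU hx)
    have hM : 0 ≤ M := (norm_nonneg _).trans (bA x hx)
    have hL : 0 ≤ L := (abs_nonneg _).trans (bθ' x hx)
    have e : G' x / θ x - G x * θ' x / (θ x : ℂ) ^ 2 = A'' x / (θ x : ℂ) ^ 2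
        - 3 * (A' x * θ' x / (θ x : ℂ) ^ 3) - A x * θ'' x / (θ x : ℂ) ^ 3
        + 3 * (A x * (θ' x : ℂ) ^ 2 / (θ x : ℂ) ^ 4) := by
      simp only [hG, hG']
      field_simp
      ring
    rw [norm_mul, norm_cexp_neg_I_mul, one_mul, e]
    have b1 : ‖A'' x / (θ x : ℂ) ^ 2‖ ≤ M / c ^ 2 := by
      rw [norm_div, norm_pow, Complex.norm_real, Real.norm_eq_abs]
      have := bθ x hx; have := bA'' x hx
      gcongr
    have b2 : ‖A' x * θ' x / (θ x : ℂ) ^ 3‖ ≤ M * L / c ^ 3 := by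
      rw [norm_div, norm_mul, norm_pow, Complex.norm_real, Complex.norm_real, Real.norm_eq_abs,
        Real.norm_eq_abs]
      have := bθ x hx; have := bA' x hx; have := bθ' x hx
      gcongr
    have b3 : ‖A x * θ'' x / (θ x : ℂ) ^ 3‖ ≤ M * L / c ^ 3 := by
      rw [norm_div, norm_mul, norm_pow, Complex.norm_real, Complex.norm_real, Real.norm_eq_abs,
        Real.norm_eq_abs]
      have := bθ x hx; have := bA x hx; have := bθ'' x hx
      gcongr
    have b4 : ‖A x * (θ' x : ℂ) ^ 2 / (θ x : ℂ) ^ 4‖ ≤ M * L ^ 2 / c ^ 4 := by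
      rw [norm_div, norm_mul, norm_pow, norm_pow, Complex.norm_real, Complex.norm_real,
        Real.norm_eq_abs, Real.norm_eq_abs]
      have := bθ x hx; have := bA x hx; have := bθ' x hx
      gcongr
    have t1 := norm_add_le (A'' x / (θ x : ℂ) ^ 2 - 3 * (A' x * θ' x / (θ x : ℂ) ^ 3)
      - A x * θ'' x / (θ x : ℂ) ^ 3) (3 * (A x * (θ' x : ℂ) ^ 2 / (θ x : ℂ) ^ 4))
    have t2 := norm_sub_le (A'' x / (θ x : ℂ) ^ 2 - 3 * (A' x * θ' x / (θ x : ℂ) ^ 3))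
      (A x * θ'' x / (θ x : ℂ) ^ 3)
    have t3 := norm_sub_le (A'' x / (θ x : ℂ) ^ 2) (3 * (A' x * θ' x / (θ x : ℂ) ^ 3))
    have n3 : ∀ z : ℂ, ‖3 * z‖ = 3 * ‖z‖ := fun z => by rw [norm_mul]; norm_num
    rw [n3] at t1 t3
    have : B = M / c ^ 2 + 3 * (M * L / c ^ 3) + M * L / c ^ 3 + 3 * (M * L ^ 2 / c ^ 4) := by
      simp only [B]; ring
    linarith
  have hI : ‖∫ x, Complex.exp (-Complex.I * (Ψ x : ℂ)) *
      (G' x / θ x - G x * θ' x / (θ x : ℂ) ^ 2)‖ ≤ B * volume.real K := by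
    rw [← setIntegral_eq_integral_of_forall_compl_eq_zero (s := K) fun x hx => by
      simp [hG0 x hx, hG0' x hx]]
    exact norm_setIntegral_le_of_norm_le_const hK.measure_lt_top hbound
  rw [e2, show (∫ x, Complex.exp (-Complex.I * (Ψ x : ℂ)) * G x) = _ from e1, norm_mul, norm_mul,
    norm_mul, norm_mul, Complex.norm_I, Complex.norm_real, Real.norm_eq_abs] at hI
  rw [le_div_iff₀ (by positivity), ← sq_abs D]
  linarith

/-! ### Almost orthogonality of dilated oscillations -/

/-- The mean value theorem for difference quotients, without an order on the two points. -/
lemma exists_slope_eq {g g' : ℝ → ℝ} {S : Set ℝ} (hS : S.OrdConnected)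
    (hg : ∀ t ∈ S, HasDerivAt g (g' t) t)
    {s t : ℝ} (hs : s ∈ S) (ht : t ∈ S) (hst : s ≠ t) :
    ∃ ξ ∈ S, (g s - g t) / (s - t) = g' ξ := by
  have key : ∀ a b, a ∈ S → b ∈ S → a < b → ∃ ξ ∈ S, (g b - g a) / (b - a) = g' ξ := by
    intro a b ha hb hab
    have hsub : Icc a b ⊆ S := hS.out ha hb
    obtain ⟨ξ, hξ, h⟩ := exists_hasDerivAt_eq_slope g g' hab
      (fun x hx => (hg x (hsub hx)).continuousAt.continuousWithinAt)
      (fun x hx => hg x (hsub (Ioo_subset_Icc_self hx)))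
    exact ⟨ξ, hsub (Ioo_subset_Icc_self hξ), h.symm⟩
  rcases lt_or_gt_of_ne hst with h | h
  · obtain ⟨ξ, hξ, e⟩ := key s t hs ht h
    exact ⟨ξ, hξ, by rw [← e, ← neg_sub (g t), ← neg_sub t, neg_div_neg_eq]⟩
  · exact key t s ht hs h

/-- Almost orthogonality of the functions `e^{-iλτR(x/τ)} u(x/τ) a(x)` for parameters
`τ ∈ [1, 2]`. The difference of the phases of two of them has derivative
`λ (r(x/τ) - r(x/σ)) = λ (τ - σ) θ(x)` with `θ` bounded below, because `r' ≠ 0`. -/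
lemma exists_inner_bound {U K : Set ℝ} (hU0 : (0 : ℝ) ∉ U)
    (hcone : ∀ x ∈ U, ∀ t : ℝ, 0 < t → t * x ∈ U) (hK : IsCompact K) (hKU : K ⊆ U)
    {R r r1 r2 r3 : ℝ → ℝ} (hR : ∀ x ∈ U, HasDerivAt R (r x) x)
    (hr : ∀ x ∈ U, HasDerivAt r (r1 x) x) (hr1 : ∀ x ∈ U, HasDerivAt r1 (r2 x) x)
    (hr2 : ∀ x ∈ U, HasDerivAt r2 (r3 x) x) (hr3 : ContinuousOn r3 U) (hne : ∀ x ∈ U, r1 x ≠ 0)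
    {u u1 u2 : ℝ → ℝ} (hu : ∀ x ∈ U, HasDerivAt u (u1 x) x)
    (hu1 : ∀ x ∈ U, HasDerivAt u1 (u2 x) x) (hu2 : ContinuousOn u2 U)
    {a a1 a2 : ℝ → ℂ} (ha : ∀ x, HasDerivAt a (a1 x) x) (ha1 : ∀ x, HasDerivAt a1 (a2 x) x)
    (ha2 : Continuous a2) (ha0 : ∀ x ∉ K, a x = 0) (ha10 : ∀ x ∉ K, a1 x = 0)
    (ha20 : ∀ x ∉ K, a2 x = 0) :
    ∃ C : ℝ, 0 ≤ C ∧ ∀ lam τ σ : ℝ, τ ∈ Icc (1 : ℝ) 2 → σ ∈ Icc (1 : ℝ) 2 →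
      ‖∫ x, Complex.exp (-Complex.I * ((lam * τ * R (x / τ) - lam * σ * R (x / σ) : ℝ) : ℂ)) *
        (((u (x / τ) : ℂ) * a x) * (starRingEnd ℂ) ((u (x / σ) : ℂ) * a x))‖
        ≤ C / (1 + (lam * (τ - σ)) ^ 2) := by
  set S : Set (ℝ × ℝ) := Icc (1 : ℝ) 2 ×ˢ K with hS
  have hSc : IsCompact S := isCompact_Icc.prod hK
  have hdiv : ∀ x ∈ U, ∀ t ∈ Icc (1 : ℝ) 2, x / t ∈ U := fun x hx t ht => by
    rw [div_eq_inv_mul]; exact hcone x hx _ (inv_pos.2 (by linarith [ht.1]))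
  have hne0 : ∀ t ∈ Icc (1 : ℝ) 2, t ≠ 0 := fun t ht => by linarith [ht.1]
  have hcomp : ∀ f : ℝ → ℝ, ContinuousOn f U → ContinuousOn (fun q : ℝ × ℝ => f (q.2 / q.1)) S := by
    intro f hf
    refine hf.comp (continuousOn_snd.div continuousOn_fst fun q hq => hne0 _ hq.1) ?_
    exact fun q hq => hdiv _ (hKU hq.2) _ hq.1
  have hinv : ContinuousOn (fun q : ℝ × ℝ => q.1⁻¹) S :=
    continuousOn_fst.inv₀ fun q hq => hne0 _ hq.1
  have cont : ∀ {f f' : ℝ → ℝ}, (∀ x ∈ U, HasDerivAt f (f' x) x) → ContinuousOn f U :=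
    fun h x hx => (h x hx).continuousAt.continuousWithinAt
  have dx : ∀ {f f' : ℝ → ℝ}, (∀ x ∈ U, HasDerivAt f (f' x) x) → ∀ t ∈ Icc (1 : ℝ) 2, ∀ x ∈ U,
      HasDerivAt (fun x => f (x / t)) (f' (x / t) * t⁻¹) x := by
    intro f f' h t ht x hx
    have := (h _ (hdiv x hx t ht)).comp x ((hasDerivAt_id x).div_const t)
    simpa [Function.comp_def] using this
  have dt : ∀ {f f' : ℝ → ℝ}, (∀ x ∈ U, HasDerivAt f (f' x) x) → ∀ t ∈ Icc (1 : ℝ) 2, ∀ x ∈ U,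
      HasDerivAt (fun t => f (x / t)) (f' (x / t) * (-x * t⁻¹ ^ 2)) t := by
    intro f f' h t ht x hx
    have h1 : HasDerivAt (fun t : ℝ => x / t) (-x * t⁻¹ ^ 2) t := by
      have := (hasDerivAt_inv (hne0 t ht)).const_mul x
      refine this.congr_deriv ?_
      field_simp
    exact (h _ (hdiv x hx t ht)).comp t h1
  have dinv : ∀ t ∈ Icc (1 : ℝ) 2, HasDerivAt (fun t : ℝ => t⁻¹) (-t⁻¹ ^ 2) t := fun t ht =>
    (hasDerivAt_inv (hne0 t ht)).congr_deriv (by rw [inv_pow])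
  have cr1 := hcomp r1 (cont hr1)
  have cr2 := hcomp r2 (cont hr2)
  have cr3 := hcomp r3 hr3
  have cu := hcomp u (cont hu)
  have cu1 := hcomp u1 (cont hu1)
  have cu2 := hcomp u2 hu2
  have cx : ContinuousOn (fun q : ℝ × ℝ => q.2) S := continuousOn_snd
  have co : ∀ {X : Type} [TopologicalSpace X] {T : Set X} {f : X → ℝ}, ContinuousOn f T →
      ContinuousOn (fun q => (f q : ℂ)) T := fun h => Complex.continuous_ofReal.comp_continuousOn h
  have ca : ContinuousOn (fun q : ℝ × ℝ => a q.2) S :=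
    (continuous_iff_continuousAt.2 fun x => (ha x).continuousAt).comp_continuousOn continuousOn_snd
  have ca1 : ContinuousOn (fun q : ℝ × ℝ => a1 q.2) S :=
    (continuous_iff_continuousAt.2 fun x => (ha1 x).continuousAt).comp_continuousOn continuousOn_snd
  have ca2 : ContinuousOn (fun q : ℝ × ℝ => a2 q.2) S := ha2.comp_continuousOn continuousOn_snd
  -- upper bounds for the `τ`-derivatives of `r (x / τ)` and of its first two `x`-derivatives
  obtain ⟨L1, hL1⟩ := hSc.exists_bound_of_continuousOn
    (f := fun q : ℝ × ℝ => r2 (q.2 / q.1) * (-q.2 * q.1⁻¹ ^ 2) * q.1⁻¹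
      + r1 (q.2 / q.1) * (-q.1⁻¹ ^ 2))
    (((cr2.mul (cx.neg.mul (hinv.pow 2))).mul hinv).add (cr1.mul (hinv.pow 2).neg))
  obtain ⟨L2, hL2⟩ := hSc.exists_bound_of_continuousOn
    (f := fun q : ℝ × ℝ => r3 (q.2 / q.1) * (-q.2 * q.1⁻¹ ^ 2) * q.1⁻¹ ^ 2
      + r2 (q.2 / q.1) * (2 * q.1⁻¹ * (-q.1⁻¹ ^ 2)))
    (((cr3.mul (cx.neg.mul (hinv.pow 2))).mul (hinv.pow 2)).add
      (cr2.mul ((continuousOn_const.mul hinv).mul (hinv.pow 2).neg)))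
  -- the lower bound for the `τ`-derivative of `r (x / τ)`, by compactness
  obtain ⟨c, hc, hcb⟩ : ∃ c : ℝ, 0 < c ∧ ∀ q ∈ S, c ≤ |r1 (q.2 / q.1) * (-q.2 * q.1⁻¹ ^ 2)| := by
    rcases S.eq_empty_or_nonempty with h | h
    · exact ⟨1, one_pos, by simp [h]⟩
    · obtain ⟨q, hq, hmin⟩ := hSc.exists_isMinOn h
        (f := fun q : ℝ × ℝ => |r1 (q.2 / q.1) * (-q.2 * q.1⁻¹ ^ 2)|)
        (cr1.mul (cx.neg.mul (hinv.pow 2))).abs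
      refine ⟨_, ?_, fun q' hq' => hmin hq'⟩
      have h1 := hne _ (hdiv _ (hKU hq.2) _ hq.1)
      have h2 : q.2 ≠ 0 := fun h => hU0 (h ▸ hKU hq.2)
      exact abs_pos.2 (mul_ne_zero h1 (mul_ne_zero (neg_ne_zero.2 h2)
        (pow_ne_zero 2 (inv_ne_zero (hne0 _ hq.1)))))
  -- bounds for the amplitude
  set V : ℝ → ℝ → ℂ := fun t x => (u (x / t) : ℂ) * a x with hV
  set V1 : ℝ → ℝ → ℂ := fun t x => ((u1 (x / t) * t⁻¹ : ℝ) : ℂ) * a x + (u (x / t) : ℂ) * a1 x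
    with hV1
  set V2 : ℝ → ℝ → ℂ := fun t x => ((u2 (x / t) * t⁻¹ * t⁻¹ : ℝ) : ℂ) * a x
    + 2 * ((u1 (x / t) * t⁻¹ : ℝ) : ℂ) * a1 x + (u (x / t) : ℂ) * a2 x with hV2
  have cV : ContinuousOn (fun q : ℝ × ℝ => V q.1 q.2) S := (co cu).mul ca
  have cV1 : ContinuousOn (fun q : ℝ × ℝ => V1 q.1 q.2) S :=
    ((co (cu1.mul hinv)).mul ca).add ((co cu).mul ca1)
  have cV2 : ContinuousOn (fun q : ℝ × ℝ => V2 q.1 q.2) S :=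
    (((co ((cu2.mul hinv).mul hinv)).mul ca).add
      ((continuousOn_const.mul (co (cu1.mul hinv))).mul ca1)).add ((co cu).mul ca2)
  obtain ⟨M0, hM0⟩ := hSc.exists_bound_of_continuousOn cV
  obtain ⟨M1, hM1⟩ := hSc.exists_bound_of_continuousOn cV1
  obtain ⟨M2, hM2⟩ := hSc.exists_bound_of_continuousOn cV2
  set M := max (max M0 M1) (max M2 0)
  have hM : 0 ≤ M := le_max_of_le_right (le_max_right _ _)
  have bV : ∀ t ∈ Icc (1 : ℝ) 2, ∀ x ∈ K, ‖V t x‖ ≤ M := fun t ht x hx =>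
    (hM0 (t, x) ⟨ht, hx⟩).trans (le_max_of_le_left (le_max_left _ _))
  have bV1 : ∀ t ∈ Icc (1 : ℝ) 2, ∀ x ∈ K, ‖V1 t x‖ ≤ M := fun t ht x hx =>
    (hM1 (t, x) ⟨ht, hx⟩).trans (le_max_of_le_left (le_max_right _ _))
  have bV2 : ∀ t ∈ Icc (1 : ℝ) 2, ∀ x ∈ K, ‖V2 t x‖ ≤ M := fun t ht x hx =>
    (hM2 (t, x) ⟨ht, hx⟩).trans (le_max_of_le_right (le_max_left _ _))
  have dV : ∀ t ∈ Icc (1 : ℝ) 2, ∀ x ∈ U, HasDerivAt (V t) (V1 t x) x := fun t ht x hx =>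
    (dx hu t ht x hx).ofReal_comp.mul (ha x)
  have dV1 : ∀ t ∈ Icc (1 : ℝ) 2, ∀ x ∈ U, HasDerivAt (V1 t) (V2 t x) x := by
    intro t ht x hx
    refine ((((dx hu1 t ht x hx).mul_const t⁻¹).ofReal_comp.mul (ha x)).add
      ((dx hu t ht x hx).ofReal_comp.mul (ha1 x))).congr_deriv ?_
    simp only [hV2]
    ring
  have zV : ∀ t, ∀ x ∉ K, V t x = 0 := fun t x hx => by simp [hV, ha0 x hx]
  have zV1 : ∀ t, ∀ x ∉ K, V1 t x = 0 := fun t x hx => by simp [hV1, ha0 x hx, ha10 x hx]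
  have zV2 : ∀ t, ∀ x ∉ K, V2 t x = 0 := fun t x hx => by
    simp [hV2, ha0 x hx, ha10 x hx, ha20 x hx]
  have xdiv : ∀ f : ℝ → ℝ, ContinuousOn f U → ∀ t ∈ Icc (1 : ℝ) 2,
      ContinuousOn (fun x => f (x / t)) U := fun f hf t ht =>
    hf.comp (continuousOn_id.div_const t) fun x hx => hdiv x hx t ht
  have caU : Continuous a := continuous_iff_continuousAt.2 fun x => (ha x).continuousAt
  have ca1U : Continuous a1 := continuous_iff_continuousAt.2 fun x => (ha1 x).continuousAt
  have cV2x : ∀ t ∈ Icc (1 : ℝ) 2, ContinuousOn (V2 t) U := by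
    intro t ht
    have h0 := xdiv u (cont hu) t ht
    have h1 := xdiv u1 (cont hu1) t ht
    have h2 := xdiv u2 hu2 t ht
    exact (((co ((h2.mul continuousOn_const).mul continuousOn_const)).mul caU.continuousOn).add
      ((continuousOn_const.mul (co (h1.mul continuousOn_const))).mul ca1U.continuousOn)).add
      ((co h0).mul ha2.continuousOn)
  set L := max L1 L2
  set B := 4 * M ^ 2 * (1 / c ^ 2 + 4 * L / c ^ 3 + 3 * L ^ 2 / c ^ 4) * volume.real K
  set C0 := M ^ 2 * volume.real K
  have hC0 : 0 ≤ C0 := by positivity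
  refine ⟨2 * max C0 B, by positivity, fun lam τ σ hτ hσ => ?_⟩
  set D := lam * (τ - σ) with hD
  -- the trivial bound, which covers `|D| ≤ 1`
  have triv : ‖∫ x, Complex.exp (-Complex.I *
      ((lam * τ * R (x / τ) - lam * σ * R (x / σ) : ℝ) : ℂ)) *
        (V τ x * (starRingEnd ℂ) (V σ x))‖ ≤ C0 := by
    rw [← setIntegral_eq_integral_of_forall_compl_eq_zero (s := K) fun x hx => by simp [zV _ x hx]]
    refine norm_setIntegral_le_of_norm_le_const hK.measure_lt_top fun x hx => ?_
    rw [norm_mul, norm_cexp_neg_I_mul, one_mul, norm_mul, RCLike.norm_conj, sq]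
    exact mul_le_mul (bV τ hτ x hx) (bV σ hσ x hx) (norm_nonneg _) hM
  rcases eq_or_ne D 0 with hD0 | hD0
  · rw [hD0]
    refine triv.trans ?_
    have := le_max_left C0 B
    norm_num
    linarith
  have hτσ : τ ≠ σ := fun h => hD0 (by simp [hD, h])
  have hτσ' : τ - σ ≠ 0 := sub_ne_zero.2 hτσ
  have osc : ‖∫ x, Complex.exp (-Complex.I *
      ((lam * τ * R (x / τ) - lam * σ * R (x / σ) : ℝ) : ℂ)) *
        (V τ x * (starRingEnd ℂ) (V σ x))‖ ≤ B / D ^ 2 := by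
    -- by the mean value theorem in `τ`, the bounds for the `τ`-derivatives pass to the difference
    -- quotient `θ` of the phase and to its `x`-derivatives
    have s0 : ∀ x ∈ U, ∃ t ∈ Icc (1 : ℝ) 2, (r (x / τ) - r (x / σ)) / (τ - σ) =
        r1 (x / t) * (-x * t⁻¹ ^ 2) := fun x hx =>
      exists_slope_eq (g := fun t => r (x / t)) ordConnected_Icc (fun t ht => dt hr t ht x hx)
        hτ hσ hτσ
    have s1 : ∀ x ∈ U, ∃ t ∈ Icc (1 : ℝ) 2,
        (r1 (x / τ) * τ⁻¹ - r1 (x / σ) * σ⁻¹) / (τ - σ) =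
        r2 (x / t) * (-x * t⁻¹ ^ 2) * t⁻¹ + r1 (x / t) * (-t⁻¹ ^ 2) := fun x hx =>
      exists_slope_eq (g := fun t => r1 (x / t) * t⁻¹) ordConnected_Icc
        (fun t ht => (dt hr1 t ht x hx).mul (dinv t ht)) hτ hσ hτσ
    have s2 : ∀ x ∈ U, ∃ t ∈ Icc (1 : ℝ) 2,
        (r2 (x / τ) * τ⁻¹ ^ 2 - r2 (x / σ) * σ⁻¹ ^ 2) / (τ - σ) =
        r3 (x / t) * (-x * t⁻¹ ^ 2) * t⁻¹ ^ 2 + r2 (x / t) * (2 * t⁻¹ * (-t⁻¹ ^ 2)) := fun x hx =>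
      exists_slope_eq (g := fun t => r2 (x / t) * t⁻¹ ^ 2) ordConnected_Icc
        (fun t ht => (dt hr2 t ht x hx).mul (((dinv t ht).pow 2).congr_deriv (by simp)))
        hτ hσ hτσ
    refine norm_integral_oscillating_le (U := U) (K := K) hK hKU
      (Ψ := fun x => lam * τ * R (x / τ) - lam * σ * R (x / σ))
      (θ := fun x => (r (x / τ) - r (x / σ)) / (τ - σ))
      (θ' := fun x => (r1 (x / τ) * τ⁻¹ - r1 (x / σ) * σ⁻¹) / (τ - σ))
      (θ'' := fun x => (r2 (x / τ) * τ⁻¹ ^ 2 - r2 (x / σ) * σ⁻¹ ^ 2) / (τ - σ))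
      (A := fun x => V τ x * (starRingEnd ℂ) (V σ x))
      (A' := fun x => V1 τ x * (starRingEnd ℂ) (V σ x) + V τ x * (starRingEnd ℂ) (V1 σ x))
      (A'' := fun x => V2 τ x * (starRingEnd ℂ) (V σ x) + V1 τ x * (starRingEnd ℂ) (V1 σ x)
        + (V1 τ x * (starRingEnd ℂ) (V1 σ x) + V τ x * (starRingEnd ℂ) (V2 σ x)))
      (L := L) hc hD0 ?_ ?_ ?_ ?_ ?_ ?_ ?_ ?_ ?_ ?_ ?_ ?_ ?_ ?_ ?_ ?_ ?_
    · intro x hx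
      have hτ0 := hne0 τ hτ
      have hσ0 := hne0 σ hσ
      refine (((dx hR τ hτ x hx).const_mul (lam * τ)).sub
        ((dx hR σ hσ x hx).const_mul (lam * σ))).congr_deriv ?_
      simp only [hD]
      field_simp
    · intro x hx
      exact ((dx hr τ hτ x hx).sub (dx hr σ hσ x hx)).div_const _
    · intro x hx
      refine ((((dx hr1 τ hτ x hx).mul_const τ⁻¹).sub
        ((dx hr1 σ hσ x hx).mul_const σ⁻¹)).div_const _).congr_deriv ?_
      ring
    · exact ((((xdiv r2 (cont hr2) τ hτ).mul continuousOn_const).sub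
        ((xdiv r2 (cont hr2) σ hσ).mul continuousOn_const)).div_const _)
    · intro x hx
      obtain ⟨t, ht, e⟩ := s0 x hx
      rw [e]
      have h1 := hne _ (hdiv x hx t ht)
      have h2 : x ≠ 0 := fun h => hU0 (h ▸ hx)
      exact mul_ne_zero h1 (mul_ne_zero (neg_ne_zero.2 h2)
        (pow_ne_zero 2 (inv_ne_zero (hne0 t ht))))
    · intro x hx
      exact (dV τ hτ x hx).mul (dV σ hσ x hx).star
    · intro x hx
      exact ((dV1 τ hτ x hx).mul (dV σ hσ x hx).star).add
        ((dV τ hτ x hx).mul (dV1 σ hσ x hx).star)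
    · have c0 : ∀ t ∈ Icc (1 : ℝ) 2, ContinuousOn (V t) U := fun t ht x hx =>
        (dV t ht x hx).continuousAt.continuousWithinAt
      have c1 : ∀ t ∈ Icc (1 : ℝ) 2, ContinuousOn (V1 t) U := fun t ht x hx =>
        (dV1 t ht x hx).continuousAt.continuousWithinAt
      have cj : ∀ {f : ℝ → ℂ}, ContinuousOn f U → ContinuousOn (fun x => (starRingEnd ℂ) (f x)) U :=
        fun h => Complex.continuous_conj.comp_continuousOn h
      exact (((cV2x τ hτ).mul (cj (c0 σ hσ))).add ((c1 τ hτ).mul (cj (c1 σ hσ)))).add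
        (((c1 τ hτ).mul (cj (c1 σ hσ))).add ((c0 τ hτ).mul (cj (cV2x σ hσ))))
    · intro x hx; simp [zV _ x hx]
    · intro x hx; simp [zV _ x hx]
    · intro x hx; simp [zV _ x hx, zV1 _ x hx]
    · intro x hx
      obtain ⟨t, ht, e⟩ := s0 x (hKU hx)
      rw [e]
      exact hcb (t, x) ⟨ht, hx⟩
    · intro x hx
      obtain ⟨t, ht, e⟩ := s1 x (hKU hx)
      rw [e]
      exact (hL1 (t, x) ⟨ht, hx⟩).trans (le_max_left _ _)
    · intro x hx
      obtain ⟨t, ht, e⟩ := s2 x (hKU hx)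
      rw [e]
      exact (hL2 (t, x) ⟨ht, hx⟩).trans (le_max_right _ _)
    all_goals
      intro x hx
      have v0 := bV τ hτ x hx
      have v0' := bV σ hσ x hx
      have v1 := bV1 τ hτ x hx
      have v1' := bV1 σ hσ x hx
      have v2 := bV2 τ hτ x hx
      have v2' := bV2 σ hσ x hx
      have pr : ∀ z w : ℂ, ‖z‖ ≤ M → ‖w‖ ≤ M → ‖z * (starRingEnd ℂ) w‖ ≤ M ^ 2 := by
        intro z w hz hw
        rw [norm_mul, RCLike.norm_conj, sq]
        exact mul_le_mul hz hw (norm_nonneg _) hM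
    · linarith [pr _ _ v0 v0', sq_nonneg M]
    · refine (norm_add_le _ _).trans ?_
      linarith [pr _ _ v1 v0', pr _ _ v0 v1', sq_nonneg M]
    · refine (norm_add_le _ _).trans ((add_le_add (norm_add_le _ _) (norm_add_le _ _)).trans ?_)
      linarith [pr _ _ v2 v0', pr _ _ v1 v1', pr _ _ v0 v2']
  have hD2 : 0 < D ^ 2 := by positivity
  rw [le_div_iff₀ (by positivity)]
  rw [le_div_iff₀ hD2] at osc
  have h1 := le_max_left C0 B
  have h2 := le_max_right C0 B
  have : ∀ X : ℝ, X ≤ C0 → X * D ^ 2 ≤ B → X * (1 + D ^ 2) ≤ 2 * max C0 B := by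
    intro X hX hX'
    linarith
  exact this _ triv osc

/-! ### Schur's test and phases on cones -/

lemma exists_sum_inv_one_add_sq_le :
    ∃ S : ℝ, 0 ≤ S ∧ ∀ (s : Finset ℕ) (p : ℕ), ∑ q ∈ s, 1 / (1 + ((p : ℝ) - q) ^ 2) ≤ S := by
  have hsum : Summable fun k : ℤ => 1 / (1 + (k : ℝ) ^ 2) := by
    refine Summable.of_nonneg_of_le (fun k => by positivity) (fun k => ?_)
      ((Real.summable_one_div_int_pow.2 (one_lt_two)).add
        (summable_of_ne_finset_zero (s := {0}) (f := fun k : ℤ => if k = 0 then (1 : ℝ) else 0)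
          fun k hk => by simpa using hk))
    by_cases hk : k = 0
    · simp [hk]
    · have : (0 : ℝ) < (k : ℝ) ^ 2 := by positivity
      simp only [hk, if_false, add_zero]
      exact one_div_le_one_div_of_le this (by linarith)
  refine ⟨∑' k : ℤ, 1 / (1 + (k : ℝ) ^ 2), tsum_nonneg fun k => by positivity, fun s p => ?_⟩
  have hinj : Set.InjOn (fun q : ℕ => (p : ℤ) - q) s := fun a _ b _ h => by
    simp only at h; omega
  have e : ∑ q ∈ s, 1 / (1 + ((p : ℝ) - q) ^ 2) =
      ∑ k ∈ s.image (fun q : ℕ => (p : ℤ) - q), 1 / (1 + (k : ℝ) ^ 2) := by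
    rw [Finset.sum_image hinj]
    simp
  rw [e]
  exact hsum.sum_le_tsum _ fun k _ => by positivity

/-- Schur's test for a family of almost orthogonal functions. -/
lemma exists_integral_norm_sum_sq_le :
    ∃ S : ℝ, 0 ≤ S ∧ ∀ (s : Finset ℕ) (E : ℕ → ℝ → ℂ) (C : ℝ), 0 ≤ C →
      (∀ p ∈ s, ∀ q ∈ s, Integrable fun x => E p x * (starRingEnd ℂ) (E q x)) →
      (∀ p ∈ s, ∀ q ∈ s, ‖∫ x, E p x * (starRingEnd ℂ) (E q x)‖ ≤ C / (1 + ((p : ℝ) - q) ^ 2)) →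
      ∀ c : ℕ → ℂ, ∫ x, ‖∑ p ∈ s, c p * E p x‖ ^ 2 ≤ C * S * ∑ p ∈ s, ‖c p‖ ^ 2 := by
  obtain ⟨S, hS0, hS⟩ := exists_sum_inv_one_add_sq_le
  refine ⟨S, hS0, fun s E C hC hint hbd c => ?_⟩
  have e : ((∫ x, ‖∑ p ∈ s, c p * E p x‖ ^ 2 : ℝ) : ℂ) =
      ∑ p ∈ s, ∑ q ∈ s, c p * (starRingEnd ℂ) (c q) * ∫ x, E p x * (starRingEnd ℂ) (E q x) := by
    rw [← integral_complex_ofReal]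
    have : ∀ x, ((‖∑ p ∈ s, c p * E p x‖ ^ 2 : ℝ) : ℂ) =
        ∑ p ∈ s, ∑ q ∈ s, c p * (starRingEnd ℂ) (c q) * (E p x * (starRingEnd ℂ) (E q x)) := by
      intro x
      push_cast
      rw [← Complex.mul_conj', map_sum, Finset.sum_mul_sum]
      refine Finset.sum_congr rfl fun p _ => Finset.sum_congr rfl fun q _ => ?_
      rw [map_mul]; ring
    simp_rw [this]
    rw [integral_finsetSum _ fun p hp => integrable_finsetSum _ fun q hq =>
      (hint p hp q hq).const_mul _]
    refine Finset.sum_congr rfl fun p hp => ?_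
    rw [integral_finsetSum _ fun q hq => (hint p hp q hq).const_mul _]
    exact Finset.sum_congr rfl fun q hq => integral_const_mul _ _
  have h0 : 0 ≤ ∫ x, ‖∑ p ∈ s, c p * E p x‖ ^ 2 := integral_nonneg fun x => by positivity
  have h1 : ∫ x, ‖∑ p ∈ s, c p * E p x‖ ^ 2 ≤
      ∑ p ∈ s, ∑ q ∈ s, ‖c p‖ * ‖c q‖ * (C / (1 + ((p : ℝ) - q) ^ 2)) := by
    rw [← abs_of_nonneg h0, ← Real.norm_eq_abs, ← Complex.norm_real, e]
    refine (norm_sum_le _ _).trans (Finset.sum_le_sum fun p hp =>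
      (norm_sum_le _ _).trans (Finset.sum_le_sum fun q hq => ?_))
    rw [norm_mul, norm_mul, RCLike.norm_conj]
    gcongr
    exact hbd p hp q hq
  -- `2 |c_p c_q| ≤ |c_p|² + |c_q|²` splits the double sum into two with symmetric kernels
  have h2 : ∑ p ∈ s, ∑ q ∈ s, ‖c p‖ * ‖c q‖ * (C / (1 + ((p : ℝ) - q) ^ 2)) ≤
      ∑ p ∈ s, ∑ q ∈ s, (C / 2 * (‖c p‖ ^ 2 * (1 / (1 + ((p : ℝ) - q) ^ 2)))
        + C / 2 * (‖c q‖ ^ 2 * (1 / (1 + ((q : ℝ) - p) ^ 2)))) := by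
    refine Finset.sum_le_sum fun p _ => Finset.sum_le_sum fun q _ => ?_
    have : ((q : ℝ) - p) ^ 2 = ((p : ℝ) - q) ^ 2 := by ring
    rw [this]
    have hw : 0 ≤ C * (1 / (1 + ((p : ℝ) - q) ^ 2)) := by positivity
    have := mul_nonneg hw (sq_nonneg (‖c p‖ - ‖c q‖))
    rw [div_eq_mul_one_div C]
    nlinarith [this]
  have h3 : ∑ p ∈ s, ∑ q ∈ s, C / 2 * (‖c p‖ ^ 2 * (1 / (1 + ((p : ℝ) - q) ^ 2))) ≤
      C / 2 * S * ∑ p ∈ s, ‖c p‖ ^ 2 := by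
    rw [Finset.mul_sum]
    refine Finset.sum_le_sum fun p _ => ?_
    rw [← Finset.mul_sum, ← Finset.mul_sum]
    have := mul_le_mul_of_nonneg_left (hS s p) (by positivity : 0 ≤ C / 2 * ‖c p‖ ^ 2)
    linarith
  have h4 : ∑ p ∈ s, ∑ q ∈ s, C / 2 * (‖c q‖ ^ 2 * (1 / (1 + ((q : ℝ) - p) ^ 2))) ≤
      C / 2 * S * ∑ p ∈ s, ‖c p‖ ^ 2 := by
    rw [Finset.sum_comm]
    exact h3
  simp_rw [Finset.sum_add_distrib] at h2
  linarith

/-- `R` is a phase on the open cone `U` (a set closed under positive dilations and avoiding the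
origin): its derivative `r` is `C³` with `r' ≠ 0`. -/
structure IsPhaseOn (U : Set ℝ) (R r : ℝ → ℝ) : Prop where
  isOpen : IsOpen U
  zero_notMem : (0 : ℝ) ∉ U
  cone : ∀ x ∈ U, ∀ t : ℝ, 0 < t → t * x ∈ U
  hasDerivAt : ∀ x ∈ U, HasDerivAt R (r x) x
  contDiffAt : ∀ x ∈ U, ContDiffAt ℝ 3 r x
  deriv_ne_zero : ∀ x ∈ U, deriv r x ≠ 0

/-- The oscillating function `e^{-i p R(x/τ)} u(x/τ) a(x)`. -/
noncomputable def wave (R u : ℝ → ℝ) (a : ℝ → ℂ) (p τ x : ℝ) : ℂ :=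
  Complex.exp (-Complex.I * ((p * R (x / τ) : ℝ) : ℂ)) * ((u (x / τ) : ℂ) * a x)

lemma wave_eq_zero {R u : ℝ → ℝ} {a : ℝ → ℂ} {x : ℝ} (hx : x ∉ tsupport a) (p τ : ℝ) :
    wave R u a p τ x = 0 := by
  simp [wave, image_eq_zero_of_notMem_tsupport hx]

lemma IsPhaseOn.div_mem {U : Set ℝ} {R r : ℝ → ℝ} (h : IsPhaseOn U R r) {x τ : ℝ} (hx : x ∈ U)
    (hτ : 0 < τ) : x / τ ∈ U := by
  rw [div_eq_inv_mul]
  exact h.cone x hx _ (inv_pos.2 hτ)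

lemma IsPhaseOn.continuous_wave {U : Set ℝ} {R r : ℝ → ℝ} (h : IsPhaseOn U R r)
    {u : ℝ → ℝ} (hu : ContinuousOn u U) {a : ℝ → ℂ} (ha : Continuous a)
    (haU : tsupport a ⊆ U) (p : ℝ) {τ : ℝ} (hτ : 0 < τ) : Continuous (wave R u a p τ) := by
  refine continuous_iff_continuousAt.2 fun x => ?_
  by_cases hx : x ∈ tsupport a
  · have hxU := h.div_mem (haU hx) hτ
    have hdiv : ContinuousAt (fun x : ℝ => x / τ) x := by fun_prop
    have c1 : ContinuousAt (fun x : ℝ => R (x / τ)) x :=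
      ContinuousAt.comp (f := fun x : ℝ => x / τ) (h.hasDerivAt _ hxU).continuousAt hdiv
    have c2 : ContinuousAt (fun x : ℝ => u (x / τ)) x :=
      ContinuousAt.comp (f := fun x : ℝ => x / τ) (hu.continuousAt (h.isOpen.mem_nhds hxU)) hdiv
    have c1' := Complex.continuous_ofReal.continuousAt.comp ((continuousAt_const (y := p)).mul c1)
    have c2' := Complex.continuous_ofReal.continuousAt.comp c2
    exact (continuousAt_const.mul c1').cexp.mul (c2'.mul ha.continuousAt)
  · refine (continuousAt_const (y := (0 : ℂ))).congr ?_
    filter_upwards [(isClosed_tsupport a).isOpen_compl.mem_nhds hx] with y hy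
    exact (wave_eq_zero hy p τ).symm

lemma hasCompactSupport_sum_wave (R u : ℝ → ℝ) {a : ℝ → ℂ} (ha : HasCompactSupport a)
    (s : Finset ℕ) (c : ℕ → ℂ) (τ : ℕ → ℝ) :
    HasCompactSupport fun x => ∑ p ∈ s, c p * wave R u a p (τ p) x :=
  HasCompactSupport.intro ha fun x hx => Finset.sum_eq_zero fun p _ => by
    rw [wave_eq_zero hx, mul_zero]

lemma HasCompactSupport.lintegral_enorm_sq_eq {f : ℝ → ℂ} (hf : HasCompactSupport f)
    (hc : Continuous f) : ∫⁻ x, ‖f x‖ₑ ^ 2 = ENNReal.ofReal (∫ x, ‖f x‖ ^ 2) := by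
  rw [ofReal_integral_eq_lintegral_ofReal]
  · simp_rw [ENNReal.ofReal_pow (norm_nonneg _), ofReal_norm]
  · refine (by fun_prop : Continuous fun x => ‖f x‖ ^ 2).integrable_of_hasCompactSupport ?_
    exact hf.norm.comp_left (g := fun t : ℝ => t ^ 2) (by simp)
  · exact Eventually.of_forall fun x => by positivity

/-- The waves of integer frequencies `2^m ≤ p ≤ 2^{m+1}`, at dilations `p / 2^m ∈ [1, 2]`, are almost
orthogonal, uniformly in `m`. -/
lemma IsPhaseOn.exists_integral_le {U : Set ℝ} {R r : ℝ → ℝ} (h : IsPhaseOn U R r)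
    {u : ℝ → ℝ} (hu : ∀ x ∈ U, ContDiffAt ℝ 2 u x) {a : ℝ → ℂ} (ha : ContDiff ℝ 2 a)
    (hac : HasCompactSupport a) (haU : tsupport a ⊆ U) :
    ∃ C : ℝ, 0 ≤ C ∧ ∀ (m : ℕ) (c : ℕ → ℂ),
      ∫⁻ x : ℝ, ‖∑ p ∈ Finset.Icc ((2 : ℕ) ^ m) (2 ^ (m + 1)), c p *
        wave R u a p (p / 2 ^ m) x‖ₑ ^ 2
      ≤ ENNReal.ofReal (C * ∑ p ∈ Finset.Icc ((2 : ℕ) ^ m) (2 ^ (m + 1)), ‖c p‖ ^ 2) := by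
  have hd : ∀ {f : ℝ → ℝ} {n : ℕ}, (∀ x ∈ U, ContDiffAt ℝ (n + 1 : ℕ) f x) →
      (∀ x ∈ U, HasDerivAt f (deriv f x) x) ∧ ∀ x ∈ U, ContDiffAt ℝ (n : ℕ) (deriv f) x :=
    fun hf => ⟨fun x hx => ((hf x hx).differentiableAt (by simp)).hasDerivAt,
      fun x hx => (hf x hx).derivWithin (by simp)⟩
  obtain ⟨d1, e1⟩ := hd (n := 2) h.contDiffAt
  obtain ⟨d2, e2⟩ := hd (n := 1) e1
  obtain ⟨d3, e3⟩ := hd (n := 0) e2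
  obtain ⟨k1, l1⟩ := hd (n := 1) hu
  obtain ⟨k2, l2⟩ := hd (n := 0) l1
  have ha1 : ContDiff ℝ 1 (deriv a) := ha.deriv'
  have ha2 : Continuous (deriv (deriv a)) := ha1.continuous_deriv le_rfl
  have z0 : ∀ x ∉ tsupport a, a x = 0 := fun x hx => image_eq_zero_of_notMem_tsupport hx
  have z1 : ∀ x ∉ tsupport a, deriv a x = 0 := fun x hx =>
    image_eq_zero_of_notMem_tsupport fun h' => hx (tsupport_deriv_subset h')
  have z2 : ∀ x ∉ tsupport a, deriv (deriv a) x = 0 := fun x hx =>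
    image_eq_zero_of_notMem_tsupport fun h' =>
      hx (tsupport_deriv_subset (tsupport_deriv_subset h'))
  obtain ⟨C, hC, hb⟩ := exists_inner_bound (K := tsupport a) h.zero_notMem h.cone hac haU
    h.hasDerivAt d1 d2 d3 (fun x hx => (e3 x hx).continuousAt.continuousWithinAt) h.deriv_ne_zero
    k1 k2 (fun x hx => (l2 x hx).continuousAt.continuousWithinAt)
    (fun x => (ha.differentiable (by norm_num) x).hasDerivAt)
    (fun x => (ha1.differentiable (by norm_num) x).hasDerivAt) ha2 z0 z1 z2
  obtain ⟨S, hS, hb'⟩ := exists_integral_norm_sum_sq_le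
  refine ⟨C * S, by positivity, fun m c => ?_⟩
  have hτ : ∀ p ∈ Finset.Icc ((2 : ℕ) ^ m) (2 ^ (m + 1)), ((p : ℝ) / 2 ^ m) ∈ Icc (1 : ℝ) 2 := by
    intro p hp
    rw [Finset.mem_Icc] at hp
    have h1 : (2 : ℝ) ^ m ≤ p := by exact_mod_cast hp.1
    have h2 : (p : ℝ) ≤ 2 ^ (m + 1) := by exact_mod_cast hp.2
    constructor
    · rw [le_div_iff₀ (by positivity)]; linarith
    · rw [div_le_iff₀ (by positivity)]; rw [pow_succ] at h2; linarith
  have hcont : ∀ p ∈ Finset.Icc ((2 : ℕ) ^ m) (2 ^ (m + 1)),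
      Continuous (wave R u a p (p / 2 ^ m)) := fun p hp =>
    h.continuous_wave (fun x hx => (hu x hx).continuousAt.continuousWithinAt) ha.continuous haU _
      (by linarith [(hτ p hp).1])
  have hprod : ∀ p q : ℕ, ∀ x : ℝ,
      wave R u a p (p / 2 ^ m) x * (starRingEnd ℂ) (wave R u a q (q / 2 ^ m) x) =
      Complex.exp (-Complex.I * (((2 ^ m) * (p / 2 ^ m) * R (x / (p / 2 ^ m)) -
        (2 ^ m) * (q / 2 ^ m) * R (x / (q / 2 ^ m)) : ℝ) : ℂ)) *
        (((u (x / (p / 2 ^ m)) : ℂ) * a x) *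
          (starRingEnd ℂ) ((u (x / (q / 2 ^ m)) : ℂ) * a x)) := by
    intro p q x
    have hp : (2 : ℝ) ^ m * ((p : ℝ) / 2 ^ m) = p := by field_simp
    have hq : (2 : ℝ) ^ m * ((q : ℝ) / 2 ^ m) = q := by field_simp
    rw [hp, hq, wave, wave, map_mul, ← Complex.exp_conj, Complex.ofReal_sub, mul_sub,
      Complex.exp_sub, map_mul, map_neg, Complex.conj_I, Complex.conj_ofReal, neg_neg, neg_mul,
      neg_mul, Complex.exp_neg (Complex.I * ((q * R (x / (q / 2 ^ m)) : ℝ) : ℂ)), div_inv_eq_mul]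
    ring
  rw [(hasCompactSupport_sum_wave R u hac _ c _).lintegral_enorm_sq_eq
    (continuous_finsetSum _ fun p hp => continuous_const.mul (hcont p hp))]
  refine ENNReal.ofReal_le_ofReal
    (hb' _ (fun p => wave R u a p (p / 2 ^ m)) C hC ?_ ?_ c)
  · intro p hp q hq
    have c2 := Complex.continuous_conj.comp (hcont q hq)
    refine ((hcont p hp).mul c2).integrable_of_hasCompactSupport
      (HasCompactSupport.intro hac fun x hx => ?_)
    rw [Pi.mul_apply, wave_eq_zero hx, zero_mul]
  · intro p hp q hq
    simp_rw [hprod]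
    have := hb (2 ^ m) _ _ (hτ p hp) (hτ q hq)
    -- with the frequency parameter `2^m`, the separation of the two waves is `p - q`
    have e : (2 : ℝ) ^ m * ((p : ℝ) / 2 ^ m - q / 2 ^ m) = p - q := by field_simp
    rwa [e] at this

/-! ### Plancherel's theorem and the inverse Fourier transform -/

lemma lintegral_comp_mul_left_real (f : ℝ → ℝ≥0∞) {a : ℝ} (ha : a ≠ 0) :
    ∫⁻ x, f (a * x) = ENNReal.ofReal |a⁻¹| * ∫⁻ x, f x := by
  have : Measure.map (Homeomorph.mulLeft₀ a ha) volume = ENNReal.ofReal |a⁻¹| • volume := by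
    rw [Homeomorph.coe_mulLeft₀]; exact Real.map_volume_mul_left ha
  rw [← smul_eq_mul, ← lintegral_smul_measure, ← this,
    (Homeomorph.mulLeft₀ a ha).measurableEmbedding.lintegral_map]
  rfl

open FourierTransform in
/-- Plancherel's theorem for functions in `L¹ ∩ L²`, for the Fourier integral. -/
lemma lintegral_enorm_fourier_sq {f : ℝ → ℂ} (h1 : Integrable f) (h2 : MemLp f 2) :
    ∫⁻ x, ‖𝓕 f x‖ₑ ^ 2 = ∫⁻ x, ‖f x‖ₑ ^ 2 := by
  set g : Lp ℂ 2 (volume : Measure ℝ) := 𝓕 (h2.toLp f) with hg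
  have hcont : Continuous (𝓕 f) :=
    VectorFourier.fourierIntegral_continuous Real.continuous_fourierChar
      (by exact continuous_inner) h1
  -- the Fourier transform on `L²` agrees with the Fourier integral, by duality with test functions
  have hae : ∀ᵐ x, g x = 𝓕 f x := by
    refine ae_eq_of_integral_contDiff_smul_eq ((Lp.memLp g).locallyIntegrable (by norm_num))
      hcont.locallyIntegrable fun φ hφ hφc => ?_
    have hg₁ : HasCompactSupport (Complex.ofRealCLM ∘ φ) := hφc.comp_left rfl
    have hg₂ : ContDiff ℝ ∞ (Complex.ofRealCLM ∘ φ) := by fun_prop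
    set Φ : SchwartzMap ℝ ℂ := hg₁.toSchwartzMap hg₂
    have hΦ : ∀ x, Φ x = (φ x : ℂ) := fun x => rfl
    have e1 : Lp.toTemperedDistribution g Φ = ∫ x, φ x • g x := by
      rw [Lp.toTemperedDistribution_apply]
      simp [hΦ]
    have e2 : Lp.toTemperedDistribution g Φ = ∫ x, (𝓕 Φ : SchwartzMap ℝ ℂ) x • f x := by
      rw [hg, ← Lp.fourier_toTemperedDistribution_eq, TemperedDistribution.fourier_apply,
        Lp.toTemperedDistribution_apply]
      refine integral_congr_ae ?_
      filter_upwards [h2.coeFn_toLp] with x hx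
      rw [hx]
    have e3 : ∫ x, (𝓕 Φ : SchwartzMap ℝ ℂ) x • f x = ∫ x, Φ x • 𝓕 f x := by
      have := VectorFourier.integral_fourierIntegral_smul_eq_flip (L := innerₗ ℝ)
        Real.continuous_fourierChar continuous_inner (Φ.integrable (μ := volume)) h1
      simp only [flip_innerₗ] at this
      simp only [SchwartzMap.fourier_coe]
      exact this
    rw [← e1, e2, e3]
    simp [hΦ]
  have hnorm : eLpNorm g 2 volume = eLpNorm f 2 volume := by
    rw [← Lp.enorm_def, ← eLpNorm_congr_ae h2.coeFn_toLp, ← Lp.enorm_def, hg, enorm_eq_nnnorm,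
      enorm_eq_nnnorm]
    congr 1
    exact NNReal.eq (Lp.norm_fourier_eq _)
  have e := eLpNorm_nnreal_pow_eq_lintegral (f := f) (μ := (volume : Measure ℝ)) (p := 2)
    (by norm_num)
  have e' := eLpNorm_nnreal_pow_eq_lintegral (f := g) (μ := (volume : Measure ℝ)) (p := 2)
    (by norm_num)
  simp only [ENNReal.coe_ofNat, NNReal.coe_ofNat, ENNReal.rpow_ofNat] at e e'
  rw [← e, ← hnorm, e']
  exact lintegral_congr_ae (hae.mono fun x hx => by simp only [hx])

lemma invFT_eq_fourier (F : ℝ → ℂ) (x : ℝ) :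
    invFT F x = (2 * (Real.pi : ℂ))⁻¹ * FourierTransform.fourier F (-(2 * Real.pi)⁻¹ * x) := by
  rw [invFT, Real.fourier_eq']
  congr 1
  refine integral_congr_ae (Eventually.of_forall fun ξ => ?_)
  simp only [smul_eq_mul]
  rw [mul_comm]
  congr 2
  have : (Real.pi : ℂ) ≠ 0 := by exact_mod_cast Real.pi_ne_zero
  simp
  field_simp

lemma continuous_invFT {F : ℝ → ℂ} (h : Integrable F) : Continuous (invFT F) := by
  have hc : Continuous (FourierTransform.fourier F) :=
    VectorFourier.fourierIntegral_continuous Real.continuous_fourierChar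
      (by exact continuous_inner) h
  rw [funext (invFT_eq_fourier F)]
  exact (hc.comp (continuous_const_mul _)).const_mul _

/-- The sharp constant is `(2π)⁻¹`. -/
lemma lintegral_enorm_invFT_sq_le {F : ℝ → ℂ} (h1 : Integrable F) (h2 : MemLp F 2) :
    ∫⁻ x, ‖invFT F x‖ₑ ^ 2 ≤ ∫⁻ x, ‖F x‖ₑ ^ 2 := by
  have hpi := Real.pi_gt_three
  have e : ∀ x, ‖invFT F x‖ₑ ^ 2 = ENNReal.ofReal ((2 * Real.pi)⁻¹ ^ 2) *
      ‖FourierTransform.fourier F (-(2 * Real.pi)⁻¹ * x)‖ₑ ^ 2 := by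
    intro x
    rw [invFT_eq_fourier, enorm_mul, mul_pow, ENNReal.ofReal_pow (by positivity)]
    congr 2
    rw [← ofReal_norm, norm_inv, norm_mul, Complex.norm_real]
    simp [abs_of_pos Real.pi_pos]
  simp_rw [e]
  rw [lintegral_const_mul' _ _ ENNReal.ofReal_ne_top,
    lintegral_comp_mul_left_real (fun y => ‖FourierTransform.fourier F y‖ₑ ^ 2)
      (by simp [Real.pi_ne_zero]), lintegral_enorm_fourier_sq h1 h2,
    ← mul_assoc, ← ENNReal.ofReal_mul (by positivity)]
  refine mul_le_of_le_one_left zero_le (ENNReal.ofReal_le_one.2 ?_)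
  rw [inv_neg, inv_inv, abs_neg, abs_of_pos (by positivity)]
  have : (2 * Real.pi)⁻¹ ^ 2 * (2 * Real.pi) = (2 * Real.pi)⁻¹ := by
    field_simp
  rw [this]
  exact inv_le_one_of_one_le₀ (by linarith)

lemma integrable_mul_cexp {F : ℝ → ℂ} (h : Integrable F) (y : ℝ) :
    Integrable fun ξ : ℝ => F ξ * Complex.exp (Complex.I * (ξ : ℂ) * (y : ℂ)) := by
  refine h.mul_bdd (c := 1) (by fun_prop) (Eventually.of_forall fun ξ => ?_)
  rw [Complex.norm_exp]
  simp

lemma mul_invFT_eq {F F' : ℝ → ℂ} (hd : ∀ x, HasDerivAt F (F' x) x) (h1 : Integrable F)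
    (h1' : Integrable F') (y : ℝ) : (y : ℂ) * invFT F y = Complex.I * invFT F' y := by
  have hI : ∀ ξ : ℝ, HasDerivAt (fun ξ : ℝ => Complex.exp (Complex.I * (ξ : ℂ) * (y : ℂ)))
      (Complex.exp (Complex.I * (ξ : ℂ) * (y : ℂ)) * (Complex.I * y)) ξ := by
    intro ξ
    have : HasDerivAt (fun ξ : ℝ => Complex.I * (ξ : ℂ) * (y : ℂ)) (Complex.I * y) ξ := by
      simpa using (((hasDerivAt_id ξ).ofReal_comp).const_mul Complex.I).mul_const (y : ℂ)
    exact this.cexp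
  have i1 := integrable_mul_cexp h1 y
  have i2 := integrable_mul_cexp h1' y
  have i3 : Integrable fun ξ : ℝ => F ξ *
      (Complex.exp (Complex.I * (ξ : ℂ) * (y : ℂ)) * (Complex.I * y)) := by
    simpa [mul_assoc] using i1.mul_const (Complex.I * y)
  have key := integral_eq_zero_of_hasDerivAt_of_integrable
    (fun ξ => (hd ξ).mul (hI ξ)) (i2.add i3) i1
  rw [integral_add i2 i3] at key
  have e : ∫ ξ : ℝ, F ξ * (Complex.exp (Complex.I * (ξ : ℂ) * (y : ℂ)) * (Complex.I * y)) =
      Complex.I * y * ∫ ξ : ℝ, F ξ * Complex.exp (Complex.I * (ξ : ℂ) * (y : ℂ)) := by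
    rw [← integral_const_mul]
    congr 1; ext ξ; ring
  rw [e] at key
  simp only [invFT]
  linear_combination Complex.I * (2 * (Real.pi : ℂ))⁻¹ * (-1) * key +
    (y : ℂ) * (2 * (Real.pi : ℂ))⁻¹ * (∫ ξ : ℝ, F ξ * Complex.exp (Complex.I * (ξ : ℂ) * (y : ℂ)))
      * Complex.I_sq

/-- Plancherel's theorem with the weight `1 + y²`, which costs one derivative. -/
lemma lintegral_enorm_invFT_sq_weight_le {F F' : ℝ → ℂ} (hd : ∀ x, HasDerivAt F (F' x) x)
    (h1 : Integrable F) (h2 : MemLp F 2) (h1' : Integrable F') (h2' : MemLp F' 2) :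
    ∫⁻ y, ‖invFT F y‖ₑ ^ 2 * ENNReal.ofReal (1 + y ^ 2) ≤
      (∫⁻ x, ‖F x‖ₑ ^ 2) + ∫⁻ x, ‖F' x‖ₑ ^ 2 := by
  have e : ∀ y, ‖invFT F y‖ₑ ^ 2 * ENNReal.ofReal (1 + y ^ 2) =
      ‖invFT F y‖ₑ ^ 2 + ‖invFT F' y‖ₑ ^ 2 := by
    intro y
    have h := congrArg (fun z : ℂ => ‖z‖ₑ) (mul_invFT_eq hd h1 h1' y)
    simp only [enorm_mul] at h
    have hI : ‖Complex.I‖ₑ = 1 := by rw [← ofReal_norm]; simp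
    rw [hI, one_mul] at h
    have hy : ENNReal.ofReal (y ^ 2) = ‖(y : ℂ)‖ₑ ^ 2 := by
      rw [← ofReal_norm, ← ENNReal.ofReal_pow (norm_nonneg _)]; simp
    rw [ENNReal.ofReal_add zero_le_one (sq_nonneg y), hy, mul_add, ← mul_pow, mul_comm ‖invFT F y‖ₑ,
      h]
    simp
  simp_rw [e]
  have hm : Measurable fun y => ‖invFT F y‖ₑ ^ 2 := by
    have : Continuous (invFT F) := by
      have hc : Continuous (FourierTransform.fourier F) :=
        VectorFourier.fourierIntegral_continuous Real.continuous_fourierChar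
          (by exact continuous_inner) h1
      have : invFT F = fun x => _ := funext (invFT_eq_fourier F)
      rw [this]
      fun_prop
    exact (this.measurable.enorm).pow_const 2
  rw [lintegral_add_left hm]
  exact add_le_add (lintegral_enorm_invFT_sq_le h1 h2) (lintegral_enorm_invFT_sq_le h1' h2')

/-! ### The symbols of the square function as oscillating waves -/

lemma hasDerivAt_phaseR_of_pos {r : ℝ → ℝ} (hr : ContinuousOn r (Ioi 0)) {s : ℝ} (hs : 0 < s) :
    HasDerivAt (phaseR r) (r s) s := by
  have hsub : uIcc 1 s ⊆ Ioi 0 := fun x hx => lt_of_lt_of_le (lt_min one_pos hs) hx.1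
  exact intervalIntegral.integral_hasDerivAt_right (hr.mono hsub).intervalIntegrable
    (hr.stronglyMeasurableAtFilter isOpen_Ioi s hs) (hr.continuousAt (isOpen_Ioi.mem_nhds hs))

lemma hasDerivAt_phaseR_of_neg {r : ℝ → ℝ} (hr : ContinuousOn r (Iio 0))
    (hi : IntervalIntegrable r volume (-1) 1) {s : ℝ} (hs : s < 0) :
    HasDerivAt (phaseR r) (r s) s := by
  have hsub : uIcc (-1) s ⊆ Iio 0 := fun x hx =>
    lt_of_le_of_lt hx.2 (max_lt (by norm_num) hs)
  exact intervalIntegral.integral_hasDerivAt_right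
    (hi.symm.trans (hr.mono hsub).intervalIntegrable)
    (hr.stronglyMeasurableAtFilter isOpen_Iio s hs) (hr.continuousAt (isOpen_Iio.mem_nhds hs))

/-- The phase `R` is admissible on an open cone containing the support of `φ`. -/
lemma exists_isPhaseOn {γ : ℝ → ℝ} (hγ : NonFlatNearZero γ) {φ : ℝ → ℂ}
    (hφsupp : tsupport φ ⊆ {x : ℝ | 1 / 10 < |x| ∧ |x| < 10}) {r : ℝ → ℝ}
    (hr : ∀ s : ℝ, 0 < s → IsInverseLimitAt γ s (r s))
    (hneg : tsupport φ ⊆ Ioi 0 ∨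
      ((∀ s : ℝ, s < 0 → IsInverseLimitAt γ s (r s)) ∧ IntervalIntegrable r volume (-1) 1)) :
    ∃ U : Set ℝ, IsPhaseOn U (phaseR r) r ∧ tsupport φ ⊆ U := by
  have hpos : ∀ s ∈ Ioi (0 : ℝ), ContDiffAt ℝ 3 r s ∧ deriv r s ≠ 0 := fun s hs =>
    inverseLimit_contDiffAt hγ isOpen_Ioi hr hs
  have hposc : ContinuousOn r (Ioi 0) := fun s hs => (hpos s hs).1.continuousAt.continuousWithinAt
  rcases hneg with h | ⟨h1, h2⟩
  · exact ⟨Ioi 0, ⟨isOpen_Ioi, by simp, fun x hx t ht => mul_pos ht hx,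
      fun x hx => hasDerivAt_phaseR_of_pos hposc hx, fun x hx => (hpos x hx).1,
      fun x hx => (hpos x hx).2⟩, h⟩
  · have hn : ∀ s ∈ Iio (0 : ℝ), ContDiffAt ℝ 3 r s ∧ deriv r s ≠ 0 := fun s hs =>
      inverseLimit_contDiffAt hγ isOpen_Iio h1 hs
    have hnc : ContinuousOn r (Iio 0) := fun s hs => (hn s hs).1.continuousAt.continuousWithinAt
    have hall : ∀ s : ℝ, s ≠ 0 → ContDiffAt ℝ 3 r s ∧ deriv r s ≠ 0 := fun s hs =>
      (lt_or_gt_of_ne hs).elim (hn s) (hpos s)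
    refine ⟨{0}ᶜ, ⟨isOpen_compl_singleton, by simp, fun x hx t ht => mul_ne_zero ht.ne' hx,
      fun x hx => ?_, fun x hx => (hall x hx).1, fun x hx => (hall x hx).2⟩, fun x hx h0 => ?_⟩
    · exact (lt_or_gt_of_ne hx).elim (hasDerivAt_phaseR_of_neg hnc h2)
        (hasDerivAt_phaseR_of_pos hposc)
    · have := (hφsupp hx).1
      rw [h0, abs_zero] at this
      norm_num at this

lemma psiSymbol_eq_wave (φ : ℝ → ℂ) (r : ℝ → ℝ) (m p : ℕ) (ξ : ℝ) :
    psiSymbol φ r m p 0 ξ = (((2 : ℝ) ^ (-(m : ℝ) / 2) : ℝ) : ℂ) *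
      wave (phaseR r) (fun _ => 1) φ p (p / 2 ^ m) (ξ / 2 ^ m) := by
  have : ξ / 2 ^ m / ((p : ℝ) / 2 ^ m) = ξ / p := by field_simp
  simp only [psiSymbol, wave, this, pow_zero, one_mul, add_zero, mul_assoc]
  push_cast
  simp only [one_mul]

/-- The derivative of `ψ_{m,p,0}`. -/
noncomputable def psiDeriv (φ : ℝ → ℂ) (r : ℝ → ℝ) (m p : ℕ) (ξ : ℝ) : ℂ :=
  (((2 : ℝ) ^ (-(m : ℝ) / 2) : ℝ) : ℂ) *
    (-Complex.I * wave (phaseR r) r φ p (p / 2 ^ m) (ξ / 2 ^ m) +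
      ((2 : ℂ) ^ m)⁻¹ * wave (phaseR r) (fun _ => 1) (deriv φ) p (p / 2 ^ m) (ξ / 2 ^ m))

lemma IsPhaseOn.hasDerivAt_wave {U : Set ℝ} {R r : ℝ → ℝ} (h : IsPhaseOn U R r) {a : ℝ → ℂ}
    (ha : ContDiff ℝ 1 a) (haU : tsupport a ⊆ U) (p : ℝ) {τ : ℝ} (hτ : 0 < τ) (x : ℝ) :
    HasDerivAt (wave R (fun _ => 1) a p τ)
      (-Complex.I * ((p / τ : ℝ) : ℂ) * wave R r a p τ x +
        wave R (fun _ => 1) (deriv a) p τ x) x := by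
  by_cases hx : x ∈ tsupport a
  · have h1 : HasDerivAt (fun x : ℝ => R (x / τ)) (r (x / τ) * τ⁻¹) x := by
      simpa [Function.comp_def] using
        (h.hasDerivAt _ (h.div_mem (haU hx) hτ)).comp x ((hasDerivAt_id x).div_const τ)
    have h2 := ((h1.const_mul p).ofReal_comp.const_mul (-Complex.I)).cexp
    have h3 := ((ha.differentiable (by norm_num) x).hasDerivAt).const_mul (((1 : ℝ) : ℂ))
    refine (h2.mul h3).congr_deriv ?_
    simp only [wave]
    push_cast
    field_simp
  · have hz : wave R (fun _ => 1) a p τ =ᶠ[𝓝 x] fun _ => 0 := by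
      filter_upwards [(isClosed_tsupport a).isOpen_compl.mem_nhds hx] with y hy
      exact wave_eq_zero hy p τ
    refine ((hasDerivAt_const x (0 : ℂ)).congr_of_eventuallyEq hz).congr_deriv ?_
    rw [wave_eq_zero hx, wave_eq_zero fun h' => hx (tsupport_deriv_subset h')]
    simp

lemma enorm_add_sq_le (x y : ℂ) : ‖x + y‖ₑ ^ 2 ≤ 2 * ‖x‖ₑ ^ 2 + 2 * ‖y‖ₑ ^ 2 := by
  have h : ‖x + y‖ ^ 2 ≤ 2 * ‖x‖ ^ 2 + 2 * ‖y‖ ^ 2 := by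
    have h1 := norm_add_le x y
    nlinarith [sq_nonneg (‖x‖ - ‖y‖), norm_nonneg (x + y), norm_nonneg x, norm_nonneg y]
  simp only [← ofReal_norm]
  rw [← ENNReal.ofReal_pow (norm_nonneg _), ← ENNReal.ofReal_pow (norm_nonneg _),
    ← ENNReal.ofReal_pow (norm_nonneg _), ← ENNReal.ofReal_ofNat 2, ← ENNReal.ofReal_mul (by simp),
    ← ENNReal.ofReal_mul (by simp), ← ENNReal.ofReal_add (by positivity) (by positivity)]
  exact ENNReal.ofReal_le_ofReal h

/-- The scaling `ξ ↦ ξ / 2^m` with the normalization `2^{-m/2}` preserves the `L²` norm. -/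
lemma lintegral_enorm_sq_rescale (m : ℕ) (W : ℝ → ℂ) :
    ∫⁻ ξ : ℝ, ‖(((2 : ℝ) ^ (-(m : ℝ) / 2) : ℝ) : ℂ) * W (ξ / 2 ^ m)‖ₑ ^ 2 = ∫⁻ x, ‖W x‖ₑ ^ 2 := by
  have e : ‖(((2 : ℝ) ^ (-(m : ℝ) / 2) : ℝ) : ℂ)‖ₑ ^ 2 = ENNReal.ofReal ((2 ^ m)⁻¹) := by
    rw [← ofReal_norm, Complex.norm_real, ← ENNReal.ofReal_pow (norm_nonneg _), Real.norm_eq_abs,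
      sq_abs, ← Real.rpow_natCast, ← Real.rpow_mul (by norm_num)]
    congr 1
    push_cast
    rw [div_mul_cancel₀ _ (by norm_num : (2 : ℝ) ≠ 0), Real.rpow_neg (by norm_num),
      Real.rpow_natCast]
  simp_rw [enorm_mul, mul_pow, e, div_eq_inv_mul]
  rw [lintegral_const_mul' _ _ ENNReal.ofReal_ne_top,
    lintegral_comp_mul_left_real (fun x => ‖W x‖ₑ ^ 2) (by positivity), ← mul_assoc,
    ← ENNReal.ofReal_mul (by positivity), inv_inv, abs_of_pos (by positivity),
    inv_mul_cancel₀ (by positivity), ENNReal.ofReal_one, one_mul]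

lemma invFT_sum {ι : Type*} (s : Finset ι) (c : ι → ℂ) (F : ι → ℝ → ℂ)
    (hF : ∀ i ∈ s, Integrable (F i)) (y : ℝ) :
    invFT (fun ξ => ∑ i ∈ s, c i * F i ξ) y = ∑ i ∈ s, c i * invFT (F i) y := by
  simp only [invFT, Finset.sum_mul]
  rw [integral_finsetSum _ fun i hi => by
    simpa [mul_assoc] using (integrable_mul_cexp (hF i hi) y).const_mul (c i), Finset.mul_sum]
  refine Finset.sum_congr rfl fun i _ => ?_
  simp only [mul_assoc]
  rw [integral_const_mul]
  ring

/-- The weighted almost orthogonality of the kernels `ψ̌_{m,p,0}`, `2^m ≤ p ≤ 2^{m+1}`, uniformly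
in `m`. -/
lemma IsPhaseOn.exists_lintegral_sum_invFT_le {U : Set ℝ} {r : ℝ → ℝ}
    (h : IsPhaseOn U (phaseR r) r) {φ : ℝ → ℂ} (hφ : ContDiff ℝ ∞ φ) (hφc : HasCompactSupport φ)
    (hφU : tsupport φ ⊆ U) :
    ∃ C : ℝ, 0 ≤ C ∧ ∀ (m : ℕ) (c : ℕ → ℂ),
      (∀ p ∈ Finset.Icc ((2 : ℕ) ^ m) (2 ^ (m + 1)), Integrable (psiSymbol φ r m p 0)) ∧
      ∫⁻ y : ℝ, ‖∑ p ∈ Finset.Icc ((2 : ℕ) ^ m) (2 ^ (m + 1)),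
        c p * invFT (psiSymbol φ r m p 0) y‖ₑ ^ 2 * ENNReal.ofReal (1 + y ^ 2)
      ≤ ENNReal.ofReal (C * ∑ p ∈ Finset.Icc ((2 : ℕ) ^ m) (2 ^ (m + 1)), ‖c p‖ ^ 2) := by
  have hφ' : ContDiff ℝ 2 (deriv φ) := by
    have : ContDiff ℝ 3 φ := by exact_mod_cast contDiff_infty.1 hφ 3
    exact this.deriv'
  have hφ2 : ContDiff ℝ 2 φ := by exact_mod_cast contDiff_infty.1 hφ 2
  have hφU' : tsupport (deriv φ) ⊆ U := (tsupport_deriv_subset).trans hφU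
  have hr2 : ∀ x ∈ U, ContDiffAt ℝ 2 r x := fun x hx => (h.contDiffAt x hx).of_le (by norm_num)
  have hrc : ContinuousOn r U := fun x hx => (h.contDiffAt x hx).continuousAt.continuousWithinAt
  obtain ⟨C1, hC1, b1⟩ := h.exists_integral_le (u := fun _ => 1) (fun x _ => contDiffAt_const)
    hφ2 hφc hφU
  obtain ⟨C2, hC2, b2⟩ := h.exists_integral_le hr2 hφ2 hφc hφU
  obtain ⟨C3, hC3, b3⟩ := h.exists_integral_le (u := fun _ => 1) (fun x _ => contDiffAt_const)
    hφ' hφc.deriv hφU'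
  refine ⟨C1 + (2 * C2 + 2 * C3), by positivity, fun m c => ?_⟩
  set s := Finset.Icc ((2 : ℕ) ^ m) (2 ^ (m + 1)) with hs
  have hp0 : ∀ p ∈ s, (0 : ℝ) < p := fun p hp => by
    have := (Finset.mem_Icc.1 hp).1
    exact_mod_cast lt_of_lt_of_le (by positivity) this
  have hτ : ∀ p ∈ s, (0 : ℝ) < p / 2 ^ m := fun p hp => div_pos (hp0 p hp) (by positivity)
  have k1 : ∀ p ∈ s, Continuous (wave (phaseR r) (fun _ => 1) φ p (p / 2 ^ m)) := fun p hp =>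
    h.continuous_wave continuousOn_const hφ.continuous hφU _ (hτ p hp)
  have k2 : ∀ p ∈ s, Continuous (wave (phaseR r) r φ p (p / 2 ^ m)) := fun p hp =>
    h.continuous_wave hrc hφ.continuous hφU _ (hτ p hp)
  have k3 : ∀ p ∈ s, Continuous (wave (phaseR r) (fun _ => 1) (deriv φ) p (p / 2 ^ m)) :=
    fun p hp => h.continuous_wave continuousOn_const hφ'.continuous hφU' _ (hτ p hp)
  have hdivc : Continuous fun ξ : ℝ => ξ / 2 ^ m := by fun_prop
  have hcs : ∀ G : ℝ → ℂ, (∀ x ∉ tsupport φ, G x = 0) →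
      HasCompactSupport fun ξ : ℝ => G (ξ / 2 ^ m) := by
    intro G hG
    have : IsCompact ((fun x : ℝ => 2 ^ m * x) '' tsupport φ) := hφc.image (by fun_prop)
    refine HasCompactSupport.intro this fun ξ hξ => hG _ fun h' => hξ ⟨_, h', ?_⟩
    simp only
    field_simp
  have hψ : ∀ p, psiSymbol φ r m p 0 = fun ξ => _ := fun p => funext (psiSymbol_eq_wave φ r m p)
  have hψc : ∀ p ∈ s, Continuous (psiSymbol φ r m p 0) := fun p hp => by
    rw [hψ]; exact continuous_const.mul ((k1 p hp).comp hdivc)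
  have hψs : ∀ p, HasCompactSupport (psiSymbol φ r m p 0) := fun p => by
    rw [hψ]; exact (hcs _ fun x hx => wave_eq_zero hx _ _).mul_left
  have hψ'c : ∀ p ∈ s, Continuous (psiDeriv φ r m p) := fun p hp => by
    unfold psiDeriv
    exact continuous_const.mul ((continuous_const.mul ((k2 p hp).comp hdivc)).add
      (continuous_const.mul ((k3 p hp).comp hdivc)))
  have hψ's : ∀ p, HasCompactSupport (psiDeriv φ r m p) := fun p => by
    unfold psiDeriv
    refine HasCompactSupport.mul_left (HasCompactSupport.add ?_ ?_)
    · exact (hcs _ fun x hx => wave_eq_zero hx _ _).mul_left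
    · exact (hcs _ fun x hx => wave_eq_zero (fun h' => hx (tsupport_deriv_subset h')) _ _).mul_left
  have hder : ∀ p ∈ s, ∀ ξ, HasDerivAt (psiSymbol φ r m p 0) (psiDeriv φ r m p ξ) ξ := by
    intro p hp ξ
    rw [hψ]
    have h1 := h.hasDerivAt_wave (hφ2.of_le (by norm_num)) hφU p (hτ p hp) (ξ / 2 ^ m)
    have h2 : HasDerivAt (fun ξ : ℝ => ξ / 2 ^ m) (1 / 2 ^ m) ξ := (hasDerivAt_id ξ).div_const _
    refine ((h1.scomp ξ h2).const_mul _).congr_deriv ?_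
    have e : (p : ℝ) / (p / 2 ^ m) = 2 ^ m := by
      have := (hp0 p hp).ne'
      field_simp
    rw [e, psiDeriv, Complex.real_smul]
    push_cast
    field_simp
  have hint : ∀ p ∈ s, Integrable (psiSymbol φ r m p 0) := fun p hp =>
    (hψc p hp).integrable_of_hasCompactSupport (hψs p)
  refine ⟨hint, ?_⟩
  set F : ℝ → ℂ := fun ξ => ∑ p ∈ s, c p * psiSymbol φ r m p 0 ξ with hF
  set F' : ℝ → ℂ := fun ξ => ∑ p ∈ s, c p * psiDeriv φ r m p ξ with hF'
  have hFd : ∀ ξ, HasDerivAt F (F' ξ) ξ := fun ξ =>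
    HasDerivAt.fun_sum fun p hp => (hder p hp ξ).const_mul _
  have hFc : Continuous F := continuous_finsetSum _ fun p hp => continuous_const.mul (hψc p hp)
  have hFc' : Continuous F' := continuous_finsetSum _ fun p hp => continuous_const.mul (hψ'c p hp)
  have hsum : ∀ G : ℕ → ℝ → ℂ, (∀ p, HasCompactSupport (G p)) →
      HasCompactSupport fun ξ => ∑ p ∈ s, c p * G p ξ := by
    intro G hG
    have hK : IsCompact (⋃ p ∈ s, tsupport (G p)) := s.isCompact_biUnion fun p _ => hG p
    refine HasCompactSupport.intro hK fun x hx => Finset.sum_eq_zero fun p hp => ?_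
    rw [image_eq_zero_of_notMem_tsupport fun h' => hx (mem_biUnion hp h'), mul_zero]
  have hFs : HasCompactSupport F := hsum _ hψs
  have hFs' : HasCompactSupport F' := hsum _ hψ's
  have key := lintegral_enorm_invFT_sq_weight_le hFd (hFc.integrable_of_hasCompactSupport hFs)
    (hFc.memLp_of_hasCompactSupport hFs) (hFc'.integrable_of_hasCompactSupport hFs')
    (hFc'.memLp_of_hasCompactSupport hFs')
  simp_rw [hF, invFT_sum s c _ hint] at key
  refine key.trans ?_
  set W1 : ℝ → ℂ := fun x => ∑ p ∈ s, c p * wave (phaseR r) (fun _ => 1) φ p (p / 2 ^ m) x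
  set W2 : ℝ → ℂ := fun x => ∑ p ∈ s, c p * wave (phaseR r) r φ p (p / 2 ^ m) x with hW2
  set W3 : ℝ → ℂ := fun x =>
    ∑ p ∈ s, c p * wave (phaseR r) (fun _ => 1) (deriv φ) p (p / 2 ^ m) x with hW3
  have e1 : ∀ ξ, ∑ p ∈ s, c p * psiSymbol φ r m p 0 ξ =
      (((2 : ℝ) ^ (-(m : ℝ) / 2) : ℝ) : ℂ) * W1 (ξ / 2 ^ m) := by
    intro ξ
    simp only [W1, Finset.mul_sum, psiSymbol_eq_wave]
    exact Finset.sum_congr rfl fun p _ => by ring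
  have e2 : ∀ ξ, F' ξ = (((2 : ℝ) ^ (-(m : ℝ) / 2) : ℝ) : ℂ) *
      (fun x => -Complex.I * W2 x + ((2 : ℂ) ^ m)⁻¹ * W3 x) (ξ / 2 ^ m) := by
    intro ξ
    simp only [hF', hW2, hW3, psiDeriv, Finset.mul_sum, ← Finset.sum_add_distrib]
    exact Finset.sum_congr rfl fun p _ => by ring
  simp_rw [e1, e2]
  rw [lintegral_enorm_sq_rescale, lintegral_enorm_sq_rescale m
    (fun x => -Complex.I * W2 x + ((2 : ℂ) ^ m)⁻¹ * W3 x)]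
  have e3 : ∀ x, ‖-Complex.I * W2 x + ((2 : ℂ) ^ m)⁻¹ * W3 x‖ₑ ^ 2 ≤
      2 * ‖W2 x‖ₑ ^ 2 + 2 * ‖W3 x‖ₑ ^ 2 := by
    intro x
    refine (enorm_add_sq_le _ _).trans ?_
    have n1 : ‖-Complex.I * W2 x‖ₑ = ‖W2 x‖ₑ := by
      rw [← ofReal_norm, ← ofReal_norm]; simp
    have n2 : ‖((2 : ℂ) ^ m)⁻¹ * W3 x‖ₑ ≤ ‖W3 x‖ₑ := by
      rw [← ofReal_norm, ← ofReal_norm]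
      refine ENNReal.ofReal_le_ofReal ?_
      rw [norm_mul, norm_inv, norm_pow, RCLike.norm_ofNat]
      exact mul_le_of_le_one_left (norm_nonneg _)
        (inv_le_one_of_one_le₀ (one_le_pow₀ one_le_two))
    rw [n1]
    gcongr
  have hW2c : Continuous W2 := continuous_finsetSum _ fun p hp => continuous_const.mul (k2 p hp)
  have hm2 : Measurable fun x => 2 * ‖W2 x‖ₑ ^ 2 :=
    (hW2c.measurable.enorm.pow_const 2).const_mul 2
  have hT : 0 ≤ ∑ p ∈ s, ‖c p‖ ^ 2 := by positivity
  calc (∫⁻ x, ‖W1 x‖ₑ ^ 2) + ∫⁻ x, ‖-Complex.I * W2 x + ((2 : ℂ) ^ m)⁻¹ * W3 x‖ₑ ^ 2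
      ≤ (∫⁻ x, ‖W1 x‖ₑ ^ 2) + ((2 * ∫⁻ x, ‖W2 x‖ₑ ^ 2) + 2 * ∫⁻ x, ‖W3 x‖ₑ ^ 2) := by
        refine add_le_add le_rfl ((lintegral_mono e3).trans ?_)
        rw [lintegral_add_left hm2, lintegral_const_mul' _ _ (by simp),
          lintegral_const_mul' _ _ (by simp)]
    _ ≤ ENNReal.ofReal (C1 * ∑ p ∈ s, ‖c p‖ ^ 2) + (2 * ENNReal.ofReal (C2 * ∑ p ∈ s, ‖c p‖ ^ 2)
        + 2 * ENNReal.ofReal (C3 * ∑ p ∈ s, ‖c p‖ ^ 2)) := by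
        gcongr
        · exact b1 m c
        · exact b2 m c
        · exact b3 m c
    _ = _ := by
        rw [← ENNReal.ofReal_ofNat 2, ← ENNReal.ofReal_mul (by simp), ← ENNReal.ofReal_mul (by simp),
          ← ENNReal.ofReal_add (by positivity) (by positivity),
          ← ENNReal.ofReal_add (by positivity) (by positivity)]
        congr 1
        ring

/-! ### Bessel's inequality and Cauchy weights -/

/-- The Cauchy–Schwarz inequality for lower Lebesgue integrals. -/
lemma lintegral_mul_sq_le {α : Type*} [MeasurableSpace α] {μ : Measure α} {f g : α → ℝ≥0∞}
    (hf : AEMeasurable f μ) (hg : AEMeasurable g μ) :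
    (∫⁻ x, f x * g x ∂μ) ^ 2 ≤ (∫⁻ x, f x ^ 2 ∂μ) * ∫⁻ x, g x ^ 2 ∂μ := by
  have h := ENNReal.lintegral_mul_le_Lp_mul_Lq μ Real.HolderConjugate.two_two hf hg
  have h2 := pow_le_pow_left' h 2
  rw [mul_pow, ← ENNReal.rpow_natCast, ← ENNReal.rpow_natCast, ← ENNReal.rpow_natCast,
    ← ENNReal.rpow_mul, ← ENNReal.rpow_mul] at h2
  simpa using h2

/-- The Cauchy–Schwarz inequality with a weight `w` and its inverse `v`. -/
lemma lintegral_mul_sq_le_weight {α : Type*} [MeasurableSpace α] {μ : Measure α}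
    {f g w v : α → ℝ≥0∞} (hf : AEMeasurable f μ) (hg : AEMeasurable g μ) (hw : AEMeasurable w μ)
    (hv : AEMeasurable v μ) (hwv : ∀ x, w x * v x = 1) :
    (∫⁻ x, f x * g x ∂μ) ^ 2 ≤ (∫⁻ x, f x ^ 2 * w x ∂μ) * ∫⁻ x, g x ^ 2 * v x ∂μ := by
  have h := lintegral_mul_sq_le (hf.mul (hw.pow_const (1 / 2 : ℝ))) (hg.mul (hv.pow_const (1 / 2 : ℝ)))
  have e : ∀ x : ℝ≥0∞, (x ^ (1 / 2 : ℝ)) ^ 2 = x := fun x => by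
    rw [← ENNReal.rpow_natCast, ← ENNReal.rpow_mul]; simp
  have e1 : ∀ x, f x * w x ^ (1 / 2 : ℝ) * (g x * v x ^ (1 / 2 : ℝ)) = f x * g x := fun x => by
    rw [mul_mul_mul_comm, ← ENNReal.mul_rpow_of_nonneg _ _ (by norm_num), hwv]; simp
  simp only [Pi.mul_apply, mul_pow, e, e1] at h
  exact h

/-- The Cauchy weight `b / (1 + (b x)²)` of scale `1/b`. -/
noncomputable def cauchyWeight (b x : ℝ) : ℝ≥0∞ := ENNReal.ofReal (b * (1 + (b * x) ^ 2)⁻¹)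

lemma measurable_cauchyWeight (b : ℝ) : Measurable (cauchyWeight b) := by
  unfold cauchyWeight; fun_prop

lemma cauchyWeight_neg (b x : ℝ) : cauchyWeight b (-x) = cauchyWeight b x := by
  simp [cauchyWeight]

/-- Bessel's inequality for the kernels `ψ̌_{m,p,0}`, with respect to the weight `(1 + u²)⁻¹`. -/
lemma IsPhaseOn.exists_bessel {U : Set ℝ} {r : ℝ → ℝ}
    (h : IsPhaseOn U (phaseR r) r) {φ : ℝ → ℂ} (hφ : ContDiff ℝ ∞ φ) (hφc : HasCompactSupport φ)
    (hφU : tsupport φ ⊆ U) :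
    ∃ C : ℝ, 0 < C ∧ ∀ (m : ℕ) (G : ℝ → ℂ), Measurable G →
      ∑ p ∈ Finset.Icc ((2 : ℕ) ^ m) (2 ^ (m + 1)),
        ‖∫ u, G u * invFT (psiSymbol φ r m p 0) u‖ₑ ^ 2
      ≤ ENNReal.ofReal C * ∫⁻ u, ‖G u‖ₑ ^ 2 * cauchyWeight 1 u := by
  obtain ⟨C, hC, hb⟩ := h.exists_lintegral_sum_invFT_le hφ hφc hφU
  refine ⟨C + 1, by positivity, fun m G hG => ?_⟩
  set s := Finset.Icc ((2 : ℕ) ^ m) (2 ^ (m + 1)) with hs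
  set K : ℕ → ℝ → ℂ := fun p => invFT (psiSymbol φ r m p 0) with hK
  set X := ∫⁻ u, ‖G u‖ₑ ^ 2 * cauchyWeight 1 u with hX
  rcases eq_or_ne X ⊤ with hXt | hXt
  · rw [hXt, ENNReal.mul_top (by simp; positivity)]
    exact le_top
  have hKm : ∀ p ∈ s, Measurable (K p) := fun p hp =>
    (continuous_invFT ((hb m 0).1 p hp)).measurable
  have hv : Measurable fun y : ℝ => ENNReal.ofReal (1 + y ^ 2) := by fun_prop
  have hwv : ∀ y : ℝ, cauchyWeight 1 y * ENNReal.ofReal (1 + y ^ 2) = 1 := fun y => by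
    rw [cauchyWeight, ← ENNReal.ofReal_mul (by positivity), one_mul, one_mul,
      inv_mul_cancel₀ (by positivity), ENNReal.ofReal_one]
  -- the dual inequality: the weights `1 + y²` and `(1 + y²)⁻¹` are inverse to each other
  have hCS : ∀ c : ℕ → ℂ, (∫⁻ u, ‖G u‖ₑ * ‖∑ p ∈ s, c p * K p u‖ₑ) ^ 2 ≤
      X * ENNReal.ofReal (C * ∑ p ∈ s, ‖c p‖ ^ 2) := by
    intro c
    have hm : Measurable fun u => ∑ p ∈ s, c p * K p u :=
      Finset.measurable_fun_sum _ fun p hp => (hKm p hp).const_mul _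
    refine (lintegral_mul_sq_le_weight hG.enorm.aemeasurable hm.enorm.aemeasurable
      (measurable_cauchyWeight 1).aemeasurable hv.aemeasurable hwv).trans ?_
    gcongr
    exact (hb m c).2
  have hint : ∀ p ∈ s, Integrable fun u => G u * K p u := by
    intro p hp
    refine ⟨(hG.mul (hKm p hp)).aestronglyMeasurable, ?_⟩
    have h1 := hCS (Pi.single p 1)
    have e : ∀ u, ∑ q ∈ s, (Pi.single p 1 : ℕ → ℂ) q * K q u = K p u := fun u => by
      rw [Finset.sum_eq_single p] <;> simp +contextual [hp]
    simp only [e] at h1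
    have h2 : (∫⁻ u, ‖G u‖ₑ * ‖K p u‖ₑ) ^ 2 < ⊤ :=
      h1.trans_lt (ENNReal.mul_lt_top hXt.lt_top ENNReal.ofReal_lt_top)
    simp only [HasFiniteIntegral, enorm_mul]
    exact (ENNReal.pow_lt_top_iff.1 h2).resolve_right (by norm_num)
  set b : ℕ → ℂ := fun p => ∫ u, G u * K p u with hb'
  set T : ℝ := ∑ p ∈ s, ‖b p‖ ^ 2 with hT
  have hT0 : 0 ≤ T := by positivity
  -- test the dual inequality with the conjugates of the coefficients themselves
  have e1 : (T : ℂ) = ∫ u, G u * ∑ p ∈ s, (starRingEnd ℂ) (b p) * K p u := by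
    have : ∀ u, G u * ∑ p ∈ s, (starRingEnd ℂ) (b p) * K p u =
        ∑ p ∈ s, (starRingEnd ℂ) (b p) * (G u * K p u) := fun u => by
      rw [Finset.mul_sum]
      exact Finset.sum_congr rfl fun p _ => by ring
    simp_rw [this]
    rw [integral_finsetSum _ fun p hp => (hint p hp).const_mul _, hT]
    push_cast
    refine Finset.sum_congr rfl fun p _ => ?_
    rw [integral_const_mul, ← Complex.conj_mul']
  have e2 : ENNReal.ofReal T ≤ ∫⁻ u, ‖G u‖ₑ * ‖∑ p ∈ s, (starRingEnd ℂ) (b p) * K p u‖ₑ := by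
    calc ENNReal.ofReal T = ‖(T : ℂ)‖ₑ := by
          rw [← ofReal_norm, Complex.norm_real, Real.norm_eq_abs, abs_of_nonneg hT0]
      _ ≤ _ := by
          rw [e1]
          refine (enorm_integral_le_lintegral_enorm _).trans_eq ?_
          simp_rw [enorm_mul]
  have e3 := (pow_le_pow_left' e2 2).trans (hCS fun p => (starRingEnd ℂ) (b p))
  simp only [RCLike.norm_conj] at e3
  have e4 : ∑ p ∈ s, ‖b p‖ₑ ^ 2 = ENNReal.ofReal T := by
    rw [hT, ENNReal.ofReal_sum_of_nonneg fun p _ => by positivity]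
    refine Finset.sum_congr rfl fun p _ => ?_
    rw [ENNReal.ofReal_pow (norm_nonneg _), ofReal_norm]
  rw [e4]
  -- from `T² ≤ X · C T` to `T ≤ C X`
  obtain ⟨x, hx⟩ : ∃ x : NNReal, (x : ℝ≥0∞) = X := ⟨X.toNNReal, ENNReal.coe_toNNReal hXt⟩
  rw [← hT, ← hx, ← ENNReal.ofReal_pow hT0, ← ENNReal.ofReal_coe_nnreal,
    ← ENNReal.ofReal_mul (by positivity), ENNReal.ofReal_le_ofReal_iff (by positivity)] at e3
  rw [← hx, ← ENNReal.ofReal_coe_nnreal, ← ENNReal.ofReal_mul (by positivity)]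
  refine ENNReal.ofReal_le_ofReal ?_
  have hx0 : (0 : ℝ) ≤ x := x.2
  rcases hT0.eq_or_lt with h0 | h0
  · rw [← h0]; positivity
  · have : T ≤ x * C := by
      refine le_of_mul_le_mul_right ?_ h0
      linarith
    linarith

lemma invFT_dilation {F : ℝ → ℂ} {b : ℝ} (hb : 0 < b) (x : ℝ) :
    invFT (fun ξ => F (ξ / b)) x = b * invFT F (b * x) := by
  have h := Measure.integral_comp_div
    (fun ξ : ℝ => F ξ * Complex.exp (Complex.I * (ξ : ℂ) * ((b * x : ℝ) : ℂ))) b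
  have e : ∀ ξ : ℝ, F (ξ / b) * Complex.exp (Complex.I * ((ξ / b : ℝ) : ℂ) * ((b * x : ℝ) : ℂ)) =
      F (ξ / b) * Complex.exp (Complex.I * (ξ : ℂ) * (x : ℂ)) := by
    intro ξ
    have : (b : ℂ) ≠ 0 := by exact_mod_cast hb.ne'
    congr 2
    push_cast
    field_simp
  simp_rw [e] at h
  rw [invFT, h, invFT, abs_of_pos hb, Complex.real_smul]
  push_cast
  ring

lemma invFT_psiSymbol (φ : ℝ → ℂ) (r : ℝ → ℝ) (m p j : ℕ) (x : ℝ) :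
    invFT (psiSymbol φ r m p j) x = ((2 : ℝ) ^ j : ℝ) * invFT (psiSymbol φ r m p 0) (2 ^ j * x) := by
  rw [← invFT_dilation (by positivity)]
  congr 1
  ext ξ
  have e1 : ξ / 2 ^ j / (2 ^ 0 * (p : ℝ)) = ξ / (2 ^ j * (p : ℝ)) := by
    rw [pow_zero, one_mul, div_div]
  have e2 : ξ / 2 ^ j / 2 ^ (m + 0) = ξ / 2 ^ (m + j) := by
    rw [add_zero, div_div, ← pow_add, add_comm]
  simp only [psiSymbol, e1, e2]

/-- A change of variables carrying a convolution with a dilated kernel to an integral against the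
kernel. -/
lemma integral_mul_dilation_eq (g K : ℝ → ℂ) {b : ℝ} (hb : 0 < b) (x : ℝ) :
    ∫ t, g t * (b * K (b * (x - t))) = ∫ u, g (x - u / b) * K u := by
  have h1 := integral_sub_left_eq_self (fun t => g t * (b * K (b * (x - t)))) (volume : Measure ℝ) x
  rw [← h1]
  have h2 := Measure.integral_comp_mul_left (fun u => g (x - u / b) * K u) b
  simp only [sub_sub_cancel]
  have e : ∀ t : ℝ, g (x - b * t / b) * K (b * t) = g (x - t) * K (b * t) := fun t => by
    rw [mul_div_cancel_left₀ _ hb.ne']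
  simp_rw [e] at h2
  have e' : ∀ t : ℝ, g (x - t) * (b * K (b * t)) = (b : ℂ) * (g (x - t) * K (b * t)) :=
    fun t => by ring
  simp_rw [e']
  rw [integral_const_mul, h2, abs_of_pos (inv_pos.2 hb), Complex.real_smul, ← mul_assoc,
    ← Complex.ofReal_mul, mul_inv_cancel₀ hb.ne', Complex.ofReal_one, one_mul]

lemma lintegral_cauchyWeight_dilation (f : ℝ → ℝ≥0∞) {b : ℝ} (hb : 0 < b) (x : ℝ) :
    ∫⁻ u, f (x - u / b) * cauchyWeight 1 u = ∫⁻ t, f t * cauchyWeight b (x - t) := by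
  have h2 := lintegral_comp_mul_left_real (fun u => f (x - u / b) * cauchyWeight 1 u) hb.ne'
  have h3 : ∫⁻ u, f (x - u / b) * cauchyWeight 1 u =
      ENNReal.ofReal b * ∫⁻ t, f (x - b * t / b) * cauchyWeight 1 (b * t) := by
    rw [h2, ← mul_assoc, ← ENNReal.ofReal_mul hb.le, abs_of_pos (inv_pos.2 hb),
      mul_inv_cancel₀ hb.ne', ENNReal.ofReal_one, one_mul]
  rw [h3, ← lintegral_sub_left_eq_self _ x, ← lintegral_const_mul' _ _ ENNReal.ofReal_ne_top]
  refine lintegral_congr fun t => ?_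
  rw [mul_div_cancel_left₀ _ hb.ne', sub_sub_cancel, mul_left_comm]
  congr 1
  rw [cauchyWeight, cauchyWeight, ← ENNReal.ofReal_mul hb.le, one_mul, one_mul]

/-- Pointwise control of the pieces of one frequency scale by a weighted mean square of
`f * φ̌_{m+j}` at the spatial scale `2^{-j}`, uniformly in `m`. -/
lemma IsPhaseOn.exists_sum_piece_le {U : Set ℝ} {r : ℝ → ℝ}
    (h : IsPhaseOn U (phaseR r) r) {φ : ℝ → ℂ} (hφ : ContDiff ℝ ∞ φ) (hφc : HasCompactSupport φ)
    (hφU : tsupport φ ⊆ U) :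
    ∃ C : ℝ, 0 < C ∧ ∀ (m j : ℕ) (f : ℝ → ℂ) (x : ℝ),
      Measurable (f ⋆[ContinuousLinearMap.mul ℂ ℂ, volume] invFT (phiDil φ (m + j))) →
      ∑ p ∈ Finset.Icc ((2 : ℕ) ^ m) (2 ^ (m + 1)), ‖piece φ r f m p j x‖ₑ ^ 2
      ≤ ENNReal.ofReal C *
        ∫⁻ t, ‖(f ⋆[ContinuousLinearMap.mul ℂ ℂ, volume] invFT (phiDil φ (m + j))) t‖ₑ ^ 2 *
          cauchyWeight (2 ^ j) (x - t) := by
  obtain ⟨C, hC, hb⟩ := h.exists_bessel hφ hφc hφU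
  refine ⟨C, hC, fun m j f x hm => ?_⟩
  set g := f ⋆[ContinuousLinearMap.mul ℂ ℂ, volume] invFT (phiDil φ (m + j)) with hg
  have h2 : (0 : ℝ) < 2 ^ j := by positivity
  have e : ∀ p, piece φ r f m p j x =
      ∫ u, g (x - u / 2 ^ j) * invFT (psiSymbol φ r m p 0) u := by
    intro p
    rw [← integral_mul_dilation_eq _ _ h2]
    simp only [piece, ← hg, convolution_def, ContinuousLinearMap.mul_apply']
    exact integral_congr_ae (Eventually.of_forall fun t => by
      simp only [invFT_psiSymbol φ r m p j])
  simp_rw [e]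
  refine (hb m (fun u => g (x - u / 2 ^ j)) (hm.comp (by fun_prop))).trans_eq ?_
  rw [lintegral_cauchyWeight_dilation (fun t => ‖g t‖ₑ ^ 2) h2]

/-! ### The maximal function over dyadic radii -/

/-- The centred Hardy–Littlewood maximal function over the radii `2^i`, `i ∈ ℤ`. The means are
normalized by the radius, half the length of the interval. -/
noncomputable def dyadicMax (v : ℝ → ℝ≥0∞) (x : ℝ) : ℝ≥0∞ :=
  ⨆ i : ℤ, ENNReal.ofReal (((2 : ℝ) ^ i)⁻¹) * ∫⁻ y in Metric.closedBall x ((2 : ℝ) ^ i), v y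

lemma measurable_dyadicMax {v : ℝ → ℝ≥0∞} (hv : Measurable v) : Measurable (dyadicMax v) := by
  refine Measurable.iSup fun i => Measurable.const_mul ?_ _
  have e : ∀ x, ∫⁻ y in Metric.closedBall x ((2 : ℝ) ^ i), v y =
      ∫⁻ y, {q : ℝ × ℝ | dist q.2 q.1 ≤ (2 : ℝ) ^ i}.indicator (fun q => v q.2) (x, y) := fun x => by
    rw [← lintegral_indicator Metric.isClosed_closedBall.measurableSet]
    rfl
  simp_rw [e]
  refine Measurable.lintegral_prod_right' (f := fun q : ℝ × ℝ =>
    {q : ℝ × ℝ | dist q.2 q.1 ≤ (2 : ℝ) ^ i}.indicator (fun q => v q.2) q) ?_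
  exact (hv.comp measurable_snd).indicator
    (isClosed_le (by fun_prop) continuous_const).measurableSet

/-- The weak type `(1,1)` inequality, by Vitali's covering lemma. -/
lemma volume_dyadicMax_gt_le (v : ℝ → ℝ≥0∞) {t : ℝ} (ht : 0 < t) :
    ENNReal.ofReal t * volume {x | ENNReal.ofReal t < dyadicMax v x} ≤ 10 * ∫⁻ y, v y := by
  rcases eq_or_ne (∫⁻ y, v y) ⊤ with hv | hv
  · simp [hv]
  set T : Set (ℝ × ℤ) := {q | ENNReal.ofReal t <
    ENNReal.ofReal (((2 : ℝ) ^ q.2)⁻¹) * ∫⁻ y in Metric.closedBall q.1 ((2 : ℝ) ^ q.2), v y}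
  have hT : ∀ q ∈ T, ENNReal.ofReal (t * 2 ^ q.2) ≤
      ∫⁻ y in Metric.closedBall q.1 ((2 : ℝ) ^ q.2), v y := by
    intro q hq
    have h2 : (0 : ℝ) < 2 ^ q.2 := by positivity
    have := mul_le_mul_left (le_of_lt hq) (ENNReal.ofReal (2 ^ q.2))
    rw [mul_right_comm, ← ENNReal.ofReal_mul (by positivity), ← ENNReal.ofReal_mul (by positivity),
      inv_mul_cancel₀ h2.ne', ENNReal.ofReal_one, one_mul] at this
    exact this
  have hR : ∀ q ∈ T, (2 : ℝ) ^ q.2 ≤ (∫⁻ y, v y).toReal / t := by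
    intro q hq
    have := (hT q hq).trans (setLIntegral_le_lintegral _ _)
    rw [le_div_iff₀ ht, mul_comm]
    exact (ENNReal.ofReal_le_iff_le_toReal hv).1 this
  obtain ⟨u, huT, hdisj, hcov⟩ := Vitali.exists_disjoint_subfamily_covering_enlargement_closedBall
    T (fun q => q.1) (fun q => (2 : ℝ) ^ q.2) _ hR 5 (by norm_num)
  have hcount : u.Countable := hdisj.countable_of_nonempty_interior fun q _ => by
    rw [interior_closedBall _ (by positivity)]
    exact Metric.nonempty_ball.2 (by positivity)
  have hsub : {x | ENNReal.ofReal t < dyadicMax v x} ⊆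
      ⋃ q ∈ u, Metric.closedBall q.1 (5 * (2 : ℝ) ^ q.2) := by
    intro x hx
    obtain ⟨i, hi⟩ := lt_iSup_iff.1 (show ENNReal.ofReal t < dyadicMax v x from hx)
    obtain ⟨b, hb, hsub⟩ := hcov (x, i) hi
    exact mem_biUnion hb (hsub (Metric.mem_closedBall_self (by positivity)))
  have := hcount.to_subtype
  calc ENNReal.ofReal t * volume {x | ENNReal.ofReal t < dyadicMax v x}
      ≤ ENNReal.ofReal t * ∑' q : u, volume (Metric.closedBall q.1.1 (5 * (2 : ℝ) ^ q.1.2)) := by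
        gcongr
        exact (measure_mono hsub).trans (measure_biUnion_le _ hcount _)
    _ = ∑' q : u, 10 * ENNReal.ofReal (t * 2 ^ q.1.2) := by
        rw [← ENNReal.tsum_mul_left]
        refine tsum_congr fun q => ?_
        rw [Real.volume_closedBall, ← ENNReal.ofReal_mul ht.le, ← ENNReal.ofReal_ofNat 10,
          ← ENNReal.ofReal_mul (by norm_num)]
        congr 1
        ring
    _ ≤ ∑' q : u, 10 * ∫⁻ y in Metric.closedBall q.1.1 ((2 : ℝ) ^ q.1.2), v y := by
        gcongr with q
        exact hT q.1 (huT q.2)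
    _ = 10 * ∫⁻ y in ⋃ q ∈ u, Metric.closedBall q.1 ((2 : ℝ) ^ q.2), v y := by
        rw [ENNReal.tsum_mul_left, lintegral_biUnion hcount
          (fun q _ => Metric.isClosed_closedBall.measurableSet) hdisj]
    _ ≤ 10 * ∫⁻ y, v y := by
        gcongr
        exact Measure.restrict_le_self

lemma dyadicMax_le_of_le {v : ℝ → ℝ≥0∞} {a : ℝ≥0∞} (h : ∀ y, v y ≤ a) (x : ℝ) :
    dyadicMax v x ≤ 2 * a := by
  refine iSup_le fun i => ?_
  have h2 : (0 : ℝ) < 2 ^ i := by positivity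
  calc ENNReal.ofReal (((2 : ℝ) ^ i)⁻¹) * ∫⁻ y in Metric.closedBall x ((2 : ℝ) ^ i), v y
      ≤ ENNReal.ofReal (((2 : ℝ) ^ i)⁻¹) * ∫⁻ _ in Metric.closedBall x ((2 : ℝ) ^ i), a := by
        gcongr; exact h _
    _ = 2 * a := by
        rw [setLIntegral_const, Real.volume_closedBall, mul_left_comm,
          ← ENNReal.ofReal_mul (by positivity), mul_comm a]
        congr 1
        rw [mul_left_comm, inv_mul_cancel₀ h2.ne']
        simp

lemma dyadicMax_add_le {v w : ℝ → ℝ≥0∞} (hv : Measurable v) (x : ℝ) :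
    dyadicMax (fun y => v y + w y) x ≤ dyadicMax v x + dyadicMax w x := by
  refine iSup_le fun i => ?_
  rw [lintegral_add_left hv, mul_add]
  exact add_le_add (le_iSup (fun i : ℤ => ENNReal.ofReal (((2 : ℝ) ^ i)⁻¹) *
      ∫⁻ y in Metric.closedBall x ((2 : ℝ) ^ i), v y) i)
    (le_iSup (fun i : ℤ => ENNReal.ofReal (((2 : ℝ) ^ i)⁻¹) *
      ∫⁻ y in Metric.closedBall x ((2 : ℝ) ^ i), w y) i)

/-- The layer cake formula for a power of a single extended nonnegative number. -/
lemma lintegral_rpow_indicator_lt {s : ℝ} (hs : 0 < s) (F : ℝ≥0∞) :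
    ∫⁻ t in Ioi (0 : ℝ), ENNReal.ofReal (t ^ (s - 1)) *
      (if ENNReal.ofReal t < F then 1 else 0) = ENNReal.ofReal s⁻¹ * F ^ s := by
  have hfin : ∀ a : ℝ, 0 ≤ a → ∫⁻ t in Ioo (0 : ℝ) a, ENNReal.ofReal (t ^ (s - 1)) =
      ENNReal.ofReal s⁻¹ * ENNReal.ofReal a ^ s := by
    intro a ha
    have hi : IntervalIntegrable (fun t : ℝ => t ^ (s - 1)) volume 0 a :=
      intervalIntegral.intervalIntegrable_rpow' (by linarith)
    rw [Measure.restrict_congr_set Ioo_ae_eq_Ioc, ← ofReal_integral_eq_lintegral_ofReal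
      ((intervalIntegrable_iff_integrableOn_Ioc_of_le ha).1 hi)
      ((ae_restrict_iff' measurableSet_Ioc).2 (Eventually.of_forall fun t ht =>
        Real.rpow_nonneg ht.1.le _)), ← intervalIntegral.integral_of_le ha,
      integral_rpow (Or.inl (by linarith)), ENNReal.ofReal_rpow_of_nonneg ha hs.le,
      ← ENNReal.ofReal_mul (by positivity)]
    congr 1
    rw [sub_add_cancel, Real.zero_rpow hs.ne']
    ring
  have hsub : ∀ a : ℝ, 0 ≤ a → ∫⁻ t in Ioi (0 : ℝ), ENNReal.ofReal (t ^ (s - 1)) *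
      (if ENNReal.ofReal t < ENNReal.ofReal a then 1 else 0) =
      ∫⁻ t in Ioo (0 : ℝ) a, ENNReal.ofReal (t ^ (s - 1)) := by
    intro a ha
    rw [← lintegral_indicator measurableSet_Ioi, ← lintegral_indicator measurableSet_Ioo]
    refine lintegral_congr fun t => ?_
    by_cases h0 : 0 < t
    · by_cases h1 : t < a
      · have : ENNReal.ofReal t < ENNReal.ofReal a := (ENNReal.ofReal_lt_ofReal_iff (h0.trans h1)).2 h1
        simp [h0, h1, this]
      · have : ¬ ENNReal.ofReal t < ENNReal.ofReal a :=
          not_lt.2 (ENNReal.ofReal_le_ofReal (not_lt.1 h1))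
        simp [h0, h1, this]
    · simp [h0]
  rcases eq_or_ne F ⊤ with rfl | hF
  · have hge : ∀ n : ℕ, ENNReal.ofReal s⁻¹ * (n : ℝ≥0∞) ^ s ≤
        ∫⁻ t in Ioi (0 : ℝ), ENNReal.ofReal (t ^ (s - 1)) *
          (if ENNReal.ofReal t < ⊤ then 1 else 0) := by
      intro n
      have := hfin n (Nat.cast_nonneg n)
      rw [ENNReal.ofReal_natCast] at this
      rw [← this, ← hsub n (Nat.cast_nonneg n)]
      refine lintegral_mono fun t => ?_
      gcongr
      split_ifs with h1 h2
      · exact le_rfl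
      · simp at h2
      · exact zero_le
      · exact le_rfl
    have h0 : ENNReal.ofReal s⁻¹ ≠ 0 := by simpa using hs
    rw [ENNReal.top_rpow_of_pos hs, ENNReal.mul_top h0]
    refine top_unique ?_
    have hlim : Tendsto (fun n : ℕ => ENNReal.ofReal s⁻¹ * (n : ℝ≥0∞) ^ s) atTop (𝓝 ⊤) := by
      have h1 := (ENNReal.continuous_rpow_const (y := s)).tendsto ⊤
      have h2 := h1.comp ENNReal.tendsto_nat_nhds_top
      have h3 := ENNReal.Tendsto.const_mul (a := ENNReal.ofReal s⁻¹) h2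
        (Or.inl (by simp [hs]))
      rwa [ENNReal.top_rpow_of_pos hs, ENNReal.mul_top h0] at h3
    exact le_of_tendsto' hlim hge
  · have := hsub F.toReal ENNReal.toReal_nonneg
    rw [hfin _ ENNReal.toReal_nonneg, ENNReal.ofReal_toReal hF] at this
    exact this

/-- The strong type `(q,q)` inequality for the maximal function. -/
lemma exists_lintegral_dyadicMax_rpow_le {q : ℝ} (hq : 1 < q) :
    ∃ C : ℝ, 0 < C ∧ ∀ v : ℝ → ℝ≥0∞, Measurable v →
      ∫⁻ x, dyadicMax v x ^ q ≤ ENNReal.ofReal C * ∫⁻ x, v x ^ q := by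
  have hq0 : 0 < q := by linarith
  have hq1 : 0 < q - 1 := by linarith
  refine ⟨q * 20 * ((q - 1)⁻¹ * 4 ^ (q - 1)), by positivity, fun v hv => ?_⟩
  have hM := measurable_dyadicMax hv
  have hmeasK : ∀ (s : ℝ) (F : ℝ → ℝ≥0∞), Measurable F → Measurable fun z : ℝ × ℝ =>
      ENNReal.ofReal (z.2 ^ s) * (if ENNReal.ofReal z.2 < F z.1 then (1 : ℝ≥0∞) else 0) := by
    intro s F hF
    refine Measurable.mul (by fun_prop) (Measurable.ite (measurableSet_lt (by fun_prop)
      (hF.comp measurable_fst)) measurable_const measurable_const)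
  -- the part of `v` above height `t / 4` controls the level set at height `t`
  have hlevel : ∀ t : ℝ, 0 < t → ENNReal.ofReal t * volume {x | ENNReal.ofReal t < dyadicMax v x} ≤
      20 * ∫⁻ y, v y * (if ENNReal.ofReal t < 4 * v y then 1 else 0) := by
    intro t ht
    set hi : ℝ → ℝ≥0∞ := fun y => v y * (if ENNReal.ofReal t < 4 * v y then 1 else 0) with hhi
    set lo : ℝ → ℝ≥0∞ := fun y => v y * (if ENNReal.ofReal t < 4 * v y then 0 else 1)
    have hhim : Measurable hi := hv.mul (Measurable.ite (measurableSet_lt measurable_const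
      (hv.const_mul 4)) measurable_const measurable_const)
    have hsum : v = fun y => hi y + lo y := by
      ext y
      simp only [hi, lo]
      split_ifs <;> simp
    have hlo : ∀ y, lo y ≤ ENNReal.ofReal (t / 4) := by
      intro y
      simp only [lo]
      split_ifs with h
      · simp
      · rw [mul_one, ENNReal.ofReal_div_of_pos (by norm_num),
          ENNReal.le_div_iff_mul_le (by simp) (by simp)]
        rw [ENNReal.ofReal_ofNat, mul_comm]
        exact not_lt.1 h
    have hsub : {x | ENNReal.ofReal t < dyadicMax v x} ⊆
        {x | ENNReal.ofReal (t / 2) < dyadicMax hi x} := by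
      intro x hx
      by_contra hcon
      have h1 : dyadicMax v x ≤ dyadicMax hi x + dyadicMax lo x := by
        conv_lhs => rw [hsum]
        exact dyadicMax_add_le hhim x
      have h2 : dyadicMax lo x ≤ ENNReal.ofReal (t / 2) := by
        refine (dyadicMax_le_of_le hlo x).trans_eq ?_
        rw [← ENNReal.ofReal_ofNat 2, ← ENNReal.ofReal_mul (by norm_num)]
        congr 1
        ring
      have h3 := h1.trans (add_le_add (not_lt.1 hcon) h2)
      rw [← ENNReal.ofReal_add (by positivity) (by positivity), add_halves] at h3
      exact absurd hx (not_lt.2 h3)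
    have h4 := volume_dyadicMax_gt_le hi (half_pos ht)
    calc ENNReal.ofReal t * volume {x | ENNReal.ofReal t < dyadicMax v x}
        ≤ ENNReal.ofReal t * volume {x | ENNReal.ofReal (t / 2) < dyadicMax hi x} := by gcongr
      _ = 2 * (ENNReal.ofReal (t / 2) * volume {x | ENNReal.ofReal (t / 2) < dyadicMax hi x}) := by
          rw [← mul_assoc, ← ENNReal.ofReal_ofNat 2, ← ENNReal.ofReal_mul (by norm_num)]
          congr 2
          ring
      _ ≤ 2 * (10 * ∫⁻ y, hi y) := by gcongr
      _ = 20 * ∫⁻ y, hi y := by rw [← mul_assoc]; norm_num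
  have e1 : ∫⁻ x, dyadicMax v x ^ q = ENNReal.ofReal q * ∫⁻ t in Ioi (0 : ℝ),
      ENNReal.ofReal (t ^ (q - 1)) * volume {x | ENNReal.ofReal t < dyadicMax v x} := by
    have h1 : ∀ x, dyadicMax v x ^ q = ENNReal.ofReal q * ∫⁻ t in Ioi (0 : ℝ),
        ENNReal.ofReal (t ^ (q - 1)) * (if ENNReal.ofReal t < dyadicMax v x then 1 else 0) := by
      intro x
      rw [lintegral_rpow_indicator_lt hq0, ← mul_assoc, ← ENNReal.ofReal_mul hq0.le,
        mul_inv_cancel₀ hq0.ne', ENNReal.ofReal_one, one_mul]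
    simp_rw [h1]
    rw [lintegral_const_mul' _ _ ENNReal.ofReal_ne_top, lintegral_lintegral_swap
      (hmeasK (q - 1) _ hM).aemeasurable]
    congr 1
    refine lintegral_congr fun t => ?_
    rw [lintegral_const_mul' _ _ ENNReal.ofReal_ne_top]
    congr 1
    have : ∀ x, (if ENNReal.ofReal t < dyadicMax v x then (1 : ℝ≥0∞) else 0) =
        {x | ENNReal.ofReal t < dyadicMax v x}.indicator 1 x := fun x => by
      simp [indicator_apply]
    simp_rw [this]
    rw [lintegral_indicator_one (measurableSet_lt measurable_const hM)]
  have e2 : ∫⁻ t in Ioi (0 : ℝ), ENNReal.ofReal (t ^ (q - 1)) *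
      volume {x | ENNReal.ofReal t < dyadicMax v x} ≤
      ∫⁻ t in Ioi (0 : ℝ), ∫⁻ y, 20 * (v y *
        (ENNReal.ofReal (t ^ (q - 1 - 1)) * (if ENNReal.ofReal t < 4 * v y then 1 else 0))) := by
    refine setLIntegral_mono' measurableSet_Ioi fun t ht => ?_
    have ht0 : (0 : ℝ) < t := ht
    have : t ^ (q - 1) = t ^ (q - 1 - 1) * t := by
      rw [Real.rpow_sub_one ht0.ne' (q - 1)]; field_simp
    rw [this, ENNReal.ofReal_mul (by positivity), mul_assoc]
    refine (mul_le_mul_right (hlevel t ht0) _).trans_eq ?_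
    rw [← mul_assoc, ← lintegral_const_mul' _ _ (by finiteness)]
    refine lintegral_congr fun y => ?_
    ring
  have e3 : ∫⁻ t in Ioi (0 : ℝ), ∫⁻ y, 20 * (v y *
        (ENNReal.ofReal (t ^ (q - 1 - 1)) * (if ENNReal.ofReal t < 4 * v y then 1 else 0))) =
      20 * ENNReal.ofReal ((q - 1)⁻¹ * 4 ^ (q - 1)) * ∫⁻ y, v y ^ q := by
    rw [← lintegral_lintegral_swap]
    · rw [← lintegral_const_mul' _ _ (by finiteness)]
      refine lintegral_congr fun y => ?_
      rw [lintegral_const_mul' _ _ (by simp), mul_assoc]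
      congr 1
      have hmt : Measurable fun t : ℝ => ENNReal.ofReal (t ^ (q - 1 - 1)) *
          (if ENNReal.ofReal t < 4 * v y then (1 : ℝ≥0∞) else 0) :=
        Measurable.mul (by fun_prop) (Measurable.ite (measurableSet_lt (by fun_prop)
          measurable_const) measurable_const measurable_const)
      rw [lintegral_const_mul _ hmt, lintegral_rpow_indicator_lt hq1,
        ENNReal.mul_rpow_of_nonneg _ _ hq1.le, ENNReal.ofReal_mul (by positivity),
        ← ENNReal.ofReal_rpow_of_pos (by norm_num), ENNReal.ofReal_ofNat]
      have : v y ^ q = v y * v y ^ (q - 1) := by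
        have := ENNReal.rpow_add_of_nonneg (x := v y) 1 (q - 1) zero_le_one hq1.le
        rwa [ENNReal.rpow_one, add_sub_cancel] at this
      rw [this]
      ring
    · exact (((hv.comp measurable_fst).mul (hmeasK (q - 1 - 1) _ (hv.const_mul 4))).const_mul
        20).aemeasurable
  rw [e1]
  refine (mul_le_mul_right (e2.trans_eq e3) _).trans_eq ?_
  rw [← mul_assoc, ← mul_assoc, ← ENNReal.ofReal_ofNat 20, ← ENNReal.ofReal_mul hq0.le,
    ← ENNReal.ofReal_mul (by positivity)]

lemma le_dyadicMax (v : ℝ → ℝ≥0∞) (x : ℝ) (i : ℤ) :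
    ∫⁻ y in Metric.closedBall x ((2 : ℝ) ^ i), v y ≤ ENNReal.ofReal (2 ^ i) * dyadicMax v x := by
  have h2 : (0 : ℝ) < 2 ^ i := by positivity
  have h := mul_le_mul_right (le_iSup (fun i : ℤ => ENNReal.ofReal (((2 : ℝ) ^ i)⁻¹) *
    ∫⁻ y in Metric.closedBall x ((2 : ℝ) ^ i), v y) i) (ENNReal.ofReal (2 ^ i))
  rw [← mul_assoc, ← ENNReal.ofReal_mul h2.le, mul_inv_cancel₀ h2.ne', ENNReal.ofReal_one,
    one_mul] at h
  exact h

/-- Means with a Cauchy weight are controlled by the maximal function. -/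
lemma lintegral_mul_cauchyWeight_le {v : ℝ → ℝ≥0∞} (hv : Measurable v) (j : ℕ) (x : ℝ) :
    ∫⁻ y, v y * cauchyWeight (2 ^ j) (x - y) ≤ 8 * dyadicMax v x := by
  set B : ℕ → Set ℝ := fun l => Metric.closedBall x ((2 : ℝ) ^ ((l : ℤ) - j)) with hB
  -- dominate the weight by multiples of indicators of the intervals of radii `2^{l-j}`, `l ≥ 0`
  have hpt : ∀ y, cauchyWeight (2 ^ j) (x - y) ≤
      ∑' l : ℕ, ENNReal.ofReal (4 * 2 ^ j * ((4 : ℝ) ^ l)⁻¹) * (B l).indicator 1 y := by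
    intro y
    -- the first interval containing `y` suffices
    set z := |(2 : ℝ) ^ j * (x - y)| with hz
    have hex : ∃ l : ℕ, z ≤ 2 ^ l := (pow_unbounded_of_one_lt z one_lt_two).imp fun _ h => h.le
    set l := Nat.find hex with hl
    have hzl : z ≤ 2 ^ l := Nat.find_spec hex
    have hmem : y ∈ B l := by
      rw [hB, Metric.mem_closedBall, dist_comm, Real.dist_eq, zpow_sub₀ two_ne_zero,
        zpow_natCast, zpow_natCast, le_div_iff₀ (by positivity), mul_comm]
      rwa [hz, abs_mul, abs_of_pos (by positivity)] at hzl
    refine le_trans ?_ (ENNReal.le_tsum l)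
    rw [indicator_of_mem hmem, Pi.one_apply, mul_one, cauchyWeight]
    refine ENNReal.ofReal_le_ofReal ?_
    rw [mul_comm (4 : ℝ), mul_assoc]
    gcongr
    have hz2 : ((2 : ℝ) ^ j * (x - y)) ^ 2 = z ^ 2 := (sq_abs _).symm
    rw [hz2, ← div_eq_mul_inv, inv_le_comm₀ (by positivity) (by positivity), inv_div]
    rcases Nat.eq_zero_or_pos l with h0 | h0
    · rw [h0]; nlinarith [sq_nonneg z]
    · have hlt : (2 : ℝ) ^ (l - 1) < z := not_le.1 (Nat.find_min hex (Nat.sub_lt h0 one_pos))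
      have e4 : (4 : ℝ) ^ l = 4 * (2 ^ (l - 1)) ^ 2 := by
        obtain ⟨k, hk⟩ : ∃ k, l = k + 1 := ⟨l - 1, by omega⟩
        rw [hk, Nat.add_sub_cancel, pow_succ, ← pow_mul, mul_comm k, pow_mul]
        norm_num
        ring
      rw [e4, mul_div_cancel_left₀ _ (by norm_num)]
      nlinarith [pow_pos (two_pos (α := ℝ)) (l - 1)]
  calc ∫⁻ y, v y * cauchyWeight (2 ^ j) (x - y)
      ≤ ∫⁻ y, ∑' l : ℕ, ENNReal.ofReal (4 * 2 ^ j * ((4 : ℝ) ^ l)⁻¹) *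
          (B l).indicator v y := by
        refine lintegral_mono fun y => (mul_le_mul_right (hpt y) _).trans_eq ?_
        rw [← ENNReal.tsum_mul_left]
        refine tsum_congr fun l => ?_
        by_cases h : y ∈ B l
        · simp [h, mul_comm]
        · simp [h]
    _ = ∑' l : ℕ, ENNReal.ofReal (4 * 2 ^ j * ((4 : ℝ) ^ l)⁻¹) * ∫⁻ y in B l, v y := by
        rw [lintegral_tsum fun l => ((hv.indicator
          Metric.isClosed_closedBall.measurableSet).const_mul _).aemeasurable]
        refine tsum_congr fun l => ?_
        rw [lintegral_const_mul' _ _ ENNReal.ofReal_ne_top,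
          lintegral_indicator Metric.isClosed_closedBall.measurableSet]
    _ ≤ ∑' l : ℕ, 4 * (2⁻¹ : ℝ≥0∞) ^ l * dyadicMax v x := by
        refine ENNReal.tsum_le_tsum fun l => ?_
        refine (mul_le_mul_right (le_dyadicMax v x _) _).trans_eq ?_
        rw [← mul_assoc, ← ENNReal.ofReal_mul (by positivity)]
        congr 1
        have : 4 * 2 ^ j * ((4 : ℝ) ^ l)⁻¹ * 2 ^ ((l : ℤ) - j) = 4 * (2⁻¹) ^ l := by
          rw [zpow_sub₀ two_ne_zero, zpow_natCast, zpow_natCast,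
            show (4 : ℝ) ^ l = 2 ^ l * 2 ^ l by rw [← mul_pow]; norm_num]
          rw [inv_pow]
          field_simp
        rw [this, ENNReal.ofReal_mul (by norm_num), ENNReal.ofReal_pow (by norm_num),
          ENNReal.ofReal_inv_of_pos (by norm_num)]
        simp
    _ = 8 * dyadicMax v x := by
        rw [ENNReal.tsum_mul_right, ENNReal.tsum_mul_left, ENNReal.tsum_geometric,
          ENNReal.one_sub_inv_two, inv_inv]
        norm_num

/-- A Cauchy weight varies by a bounded factor over distances at most its scale. -/
lemma cauchyWeight_le_of_abs_le {b x y : ℝ} (hb : 0 < b) (h : |x - y| ≤ b⁻¹) (z : ℝ) :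
    cauchyWeight b (x - z) ≤ 3 * cauchyWeight b (y - z) := by
  rw [cauchyWeight, cauchyWeight, ← ENNReal.ofReal_ofNat 3, ← ENNReal.ofReal_mul (by norm_num)]
  refine ENNReal.ofReal_le_ofReal ?_
  rw [mul_left_comm]
  gcongr
  rw [← div_eq_mul_inv, inv_le_comm₀ (by positivity) (by positivity), inv_div,
    div_le_iff₀ (by norm_num)]
  have h1 : (b * (x - y)) ^ 2 ≤ 1 := by
    rw [← sq_abs, abs_mul, abs_of_pos hb]
    have : b * |x - y| ≤ 1 := by
      calc b * |x - y| ≤ b * b⁻¹ := by gcongr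
        _ = 1 := mul_inv_cancel₀ hb.ne'
    exact pow_le_one₀ (by positivity) this
  nlinarith [sq_nonneg (b * (x - z) + b * (x - y)), sq_nonneg (b * (x - z))]

/-- A mean with a Cauchy weight at `x` is controlled by the maximal function at every point `y`
within the scale of the weight. -/
lemma lintegral_mul_cauchyWeight_le_of_abs_le {v : ℝ → ℝ≥0∞} (hv : Measurable v) {j : ℕ} {x y : ℝ}
    (h : |x - y| ≤ (2 ^ j)⁻¹) :
    ∫⁻ z, v z * cauchyWeight (2 ^ j) (x - z) ≤ 24 * dyadicMax v y := by
  calc ∫⁻ z, v z * cauchyWeight (2 ^ j) (x - z)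
      ≤ ∫⁻ z, 3 * (v z * cauchyWeight (2 ^ j) (y - z)) := by
        refine lintegral_mono fun z => ?_
        rw [mul_left_comm]
        gcongr
        exact cauchyWeight_le_of_abs_le (by positivity) h z
    _ ≤ 3 * (8 * dyadicMax v y) := by
        rw [lintegral_const_mul' _ _ (by simp)]
        gcongr
        exact lintegral_mul_cauchyWeight_le hv j y
    _ = 24 * dyadicMax v y := by rw [← mul_assoc]; norm_num

/-! ### The Haar square function -/

/-- The Haar function of the interval `(-1/4, 1/4]`, with the value `1` on the right half. -/
noncomputable def haar (x : ℝ) : ℂ :=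
  (Ioc (0 : ℝ) (1 / 4)).indicator 1 x - (Ioc (-(1 / 4) : ℝ) 0).indicator 1 x

/-- The dilate `2^n haar(2^n x)`. -/
noncomputable def haarDil (n : ℕ) (x : ℝ) : ℂ := ((2 ^ n : ℝ) : ℂ) * haar (2 ^ n * x)

/-- The Fourier transform of `haar`, in the normalization `∫ haar(t) e^{-iξt} dt`. -/
noncomputable def haarFT (ξ : ℝ) : ℂ := ∫ t, haar t * Complex.exp (-(Complex.I * ξ * t))

lemma measurable_haar : Measurable haar :=
  (measurable_one.indicator measurableSet_Ioc).sub (measurable_one.indicator measurableSet_Ioc)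

lemma measurable_haarDil (n : ℕ) : Measurable (haarDil n) :=
  (measurable_haar.comp (measurable_const_mul _)).const_mul _

lemma norm_haar_le (x : ℝ) :
    ‖haar x‖ ≤ (Icc (-(1 / 4) : ℝ) (1 / 4)).indicator (fun _ => (1 : ℝ)) x := by
  by_cases h1 : x ∈ Ioc (0 : ℝ) (1 / 4)
  · have h2 : x ∉ Ioc (-(1 / 4) : ℝ) 0 := fun h => by linarith [h.2, h1.1]
    have h3 : x ∈ Icc (-(1 / 4) : ℝ) (1 / 4) := ⟨by linarith [h1.1], h1.2⟩
    simp only [haar, indicator_of_mem h1, indicator_of_notMem h2, indicator_of_mem h3]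
    simp
  · by_cases h2 : x ∈ Ioc (-(1 / 4) : ℝ) 0
    · have h3 : x ∈ Icc (-(1 / 4) : ℝ) (1 / 4) := ⟨h2.1.le, by linarith [h2.2]⟩
      simp only [haar, indicator_of_notMem h1, indicator_of_mem h2, indicator_of_mem h3]
      simp
    · simp only [haar, indicator_of_notMem h1, indicator_of_notMem h2]
      rw [sub_zero, norm_zero]
      exact indicator_nonneg (fun _ _ => zero_le_one) _

lemma norm_haar_le_one (x : ℝ) : ‖haar x‖ ≤ 1 :=
  (norm_haar_le x).trans (indicator_le_self' (fun _ _ => zero_le_one) _)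

lemma haar_eq_zero {x : ℝ} (h : 1 / 4 < |x|) : haar x = 0 := by
  have := norm_haar_le x
  rw [indicator_of_notMem fun hx : x ∈ Icc (-(1 / 4) : ℝ) (1 / 4) =>
    absurd (abs_le.2 hx) h.not_ge] at this
  exact norm_le_zero_iff.1 this

lemma integrable_haar : Integrable haar :=
  ((integrable_indicator_iff measurableSet_Icc).2
    (integrableOn_const (C := (1 : ℝ)) (by simp) (by simp))).mono'
    measurable_haar.aestronglyMeasurable (Eventually.of_forall norm_haar_le)

lemma integrable_haarDil (n : ℕ) : Integrable (haarDil n) :=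
  (integrable_haar.comp_mul_left' (by positivity)).const_mul _

lemma norm_haarDil_le (n : ℕ) (x : ℝ) : ‖haarDil n x‖ ≤ 2 ^ n := by
  rw [haarDil, norm_mul, Complex.norm_real, Real.norm_of_nonneg (by positivity)]
  exact mul_le_of_le_one_right (by positivity) (norm_haar_le_one _)

lemma haarDil_eq_zero {n : ℕ} {x : ℝ} (h : (2 ^ n : ℝ)⁻¹ < |x|) : haarDil n x = 0 := by
  rw [haarDil, haar_eq_zero, mul_zero]
  rw [abs_mul, abs_of_pos (by positivity : (0 : ℝ) < 2 ^ n)]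
  have := (inv_lt_iff_one_lt_mul₀' (by positivity : (0 : ℝ) < 2 ^ n)).1 h
  linarith

lemma haarFT_eq {ξ : ℝ} (hξ : ξ ≠ 0) :
    haarFT ξ = ((2 - 2 * Real.cos (ξ / 4) : ℝ) : ℂ) / (Complex.I * ξ) := by
  set c : ℂ := -(Complex.I * ξ) with hc
  have hc0 : c ≠ 0 := by simp [hc, hξ]
  have hcont : Continuous fun t : ℝ => Complex.exp (c * t) := by fun_prop
  have e : ∀ t : ℝ, haar t * Complex.exp (-(Complex.I * ξ * t)) =
      (Ioc (0 : ℝ) (1 / 4)).indicator (fun t : ℝ => Complex.exp (c * t)) t -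
      (Ioc (-(1 / 4) : ℝ) 0).indicator (fun t : ℝ => Complex.exp (c * t)) t := fun t => by
    rw [haar, sub_mul, hc]
    congr 1 <;>
    · simp only [indicator, neg_mul]
      split_ifs <;> simp
  have hi : ∀ a b : ℝ, Integrable ((Ioc a b).indicator fun t : ℝ => Complex.exp (c * t)) :=
    fun a b => (integrable_indicator_iff measurableSet_Ioc).2
      (hcont.integrableOn_Icc.mono_set Ioc_subset_Icc_self)
  rw [haarFT]
  simp_rw [e]
  rw [integral_sub (hi _ _) (hi _ _), integral_indicator measurableSet_Ioc,
    integral_indicator measurableSet_Ioc, ← intervalIntegral.integral_of_le (by norm_num),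
    ← intervalIntegral.integral_of_le (by norm_num), integral_exp_mul_complex hc0,
    integral_exp_mul_complex hc0, ← sub_div]
  have hI : Complex.I * ξ ≠ 0 := by simp [hξ]
  have hcos : ((2 * Real.cos (ξ / 4) : ℝ) : ℂ) =
      Complex.exp (c * ((1 / 4 : ℝ) : ℂ)) + Complex.exp (c * ((-(1 / 4) : ℝ) : ℂ)) := by
    push_cast
    rw [Complex.two_cos, add_comm]
    congr 2 <;> rw [hc] <;> ring
  rw [Complex.ofReal_sub, hcos, div_eq_div_iff hc0 hI, hc]
  simp
  ring

lemma norm_haarFT_le (ξ : ℝ) : ‖haarFT ξ‖ ≤ 5 * |ξ| / (1 + ξ ^ 2) := by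
  rcases eq_or_ne ξ 0 with rfl | hξ
  · have : haarFT 0 = 0 := by
      have h1 : ∀ a b : ℝ, Integrable ((Ioc a b).indicator (1 : ℝ → ℂ)) := fun a b =>
        (integrable_indicator_iff measurableSet_Ioc).2
          (integrableOn_const (C := (1 : ℂ)) (by simp) (by simp))
      simp only [haarFT, Complex.ofReal_zero, mul_zero, zero_mul, neg_zero, Complex.exp_zero,
        mul_one, haar]
      rw [integral_sub (h1 _ _) (h1 _ _), integral_indicator measurableSet_Ioc,
        integral_indicator measurableSet_Ioc]
      simp
    simp [this]
  rw [haarFT_eq hξ, norm_div, norm_mul, Complex.norm_I, one_mul, Complex.norm_real,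
    Complex.norm_real, Real.norm_eq_abs, Real.norm_eq_abs, div_le_div_iff₀ (abs_pos.2 hξ)
    (by positivity), mul_assoc, abs_mul_abs_self,
    abs_of_nonneg (by linarith [Real.cos_le_one (ξ / 4)])]
  have h1 := Real.one_sub_sq_div_two_le_cos (x := ξ / 4)
  have h2 := Real.neg_one_le_cos (ξ / 4)
  nlinarith [sq_nonneg ξ, mul_nonneg (sq_nonneg ξ) (by linarith : 0 ≤ 1 + Real.cos (ξ / 4))]

open FourierTransform in
lemma fourier_haarDil (n : ℕ) (ξ : ℝ) :
    𝓕 (haarDil n) ξ = haarFT ((2 * Real.pi * ξ) / 2 ^ n) := by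
  have hb : (0 : ℝ) < 2 ^ n := by positivity
  rw [Real.fourier_real_eq_integral_exp_smul, haarFT]
  have := Measure.integral_comp_mul_left (fun t : ℝ =>
    haar t * Complex.exp (-(Complex.I * ((2 * Real.pi * ξ) / 2 ^ n : ℝ) * t))) ((2 : ℝ) ^ n)
  rw [abs_of_pos (inv_pos.2 hb)] at this
  have h3 : (2 ^ n : ℝ) • ∫ x : ℝ, haar (2 ^ n * x) * Complex.exp
      (-(Complex.I * ((2 * Real.pi * ξ) / 2 ^ n : ℝ) * ((2 ^ n * x : ℝ) : ℂ))) =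
      ∫ t, haar t * Complex.exp (-(Complex.I * ((2 * Real.pi * ξ) / 2 ^ n : ℝ) * t)) := by
    rw [this, smul_smul, mul_inv_cancel₀ hb.ne', one_smul]
  rw [← h3, ← integral_smul]
  refine integral_congr_ae (Eventually.of_forall fun x => ?_)
  have e : Complex.exp (((-2 * Real.pi * x * ξ : ℝ) : ℂ) * Complex.I) = Complex.exp
      (-(Complex.I * ((2 * Real.pi * ξ) / 2 ^ n : ℝ) * ((2 ^ n * x : ℝ) : ℂ))) := by
    congr 1
    push_cast
    field_simp
  simp only [haarDil, smul_eq_mul, Complex.real_smul]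
  rw [e]
  ring

/-- The dilates of `haarFT` are square summable, uniformly in the frequency: with
`s = (ξ / 2^n)²`, the squared norm is at most `25 s / (1 + s)²`, which the increment of `(1 + s)⁻¹`
from `s` to `s / 4` dominates, and these increments telescope. -/
lemma sum_haarFT_sq_le (ξ : ℝ) (N : ℕ) :
    ∑ n ∈ Finset.range N, ‖haarFT (ξ / 2 ^ n)‖ ^ 2 ≤ 50 := by
  set h : ℕ → ℝ := fun n => (1 + (ξ / 2 ^ n) ^ 2)⁻¹ with hh
  have hstep : ∀ n, ‖haarFT (ξ / 2 ^ n)‖ ^ 2 ≤ 50 * (h (n + 1) - h n) := by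
    intro n
    set s := (ξ / 2 ^ n) ^ 2 with hs
    have hs0 : 0 ≤ s := sq_nonneg _
    have h1 : (ξ / 2 ^ (n + 1)) ^ 2 = s / 4 := by rw [hs, pow_succ]; ring
    have h2 : ‖haarFT (ξ / 2 ^ n)‖ ^ 2 ≤ 25 * s / (1 + s) ^ 2 := by
      refine (pow_le_pow_left₀ (norm_nonneg _) (norm_haarFT_le _) 2).trans_eq ?_
      rw [div_pow, mul_pow, sq_abs, ← hs]
      norm_num
    refine h2.trans ?_
    simp only [hh, h1, ← hs]
    have : (1 + s / 4)⁻¹ - (1 + s)⁻¹ = 3 / 4 * s / ((1 + s / 4) * (1 + s)) := by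
      field_simp; ring
    rw [this, mul_div_assoc', div_le_div_iff₀ (by positivity) (by positivity)]
    have : 0 ≤ s * (1 + s) := by positivity
    nlinarith [mul_nonneg this hs0]
  refine (Finset.sum_le_sum fun n _ => hstep n).trans ?_
  rw [← Finset.mul_sum, Finset.sum_range_sub]
  have h1 : h N ≤ 1 := inv_le_one_of_one_le₀ (by nlinarith [sq_nonneg (ξ / 2 ^ N)])
  have h2 : 0 ≤ h 0 := by positivity
  linarith

lemma measurable_convolution {f g : ℝ → ℂ} (hf : Measurable f) (hg : Measurable g) :
    Measurable (f ⋆[ContinuousLinearMap.mul ℂ ℂ, volume] g) := by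
  have : StronglyMeasurable (Function.uncurry fun x t : ℝ => f t * g (x - t)) :=
    ((hf.comp measurable_snd).mul (hg.comp (measurable_fst.sub measurable_snd))).stronglyMeasurable
  exact this.integral_prod_right.measurable

open FourierTransform in
/-- The Haar square function is bounded on `L²`, for functions that are also integrable, by
Plancherel's theorem. -/
lemma tsum_lintegral_convolution_haarDil_le_of_integrable {g : ℝ → ℂ}
    (hg1 : Integrable g) (hg2 : MemLp g 2) :
    ∑' n, ∫⁻ x, ‖(g ⋆[ContinuousLinearMap.mul ℂ ℂ, volume] haarDil n) x‖ₑ ^ 2 ≤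
      50 * ∫⁻ x, ‖g x‖ₑ ^ 2 := by
  have hI : ∀ n, Integrable (g ⋆[ContinuousLinearMap.mul ℂ ℂ, volume] haarDil n) := fun n =>
    hg1.integrable_convolution _ (integrable_haarDil n)
  have hB : ∀ n x, ‖(g ⋆[ContinuousLinearMap.mul ℂ ℂ, volume] haarDil n) x‖ ≤
      (∫ t, ‖g t‖) * 2 ^ n := by
    intro n x
    rw [convolution_def, ← integral_mul_const]
    refine norm_integral_le_of_norm_le (hg1.norm.mul_const _) (Eventually.of_forall fun t => ?_)
    rw [ContinuousLinearMap.mul_apply', norm_mul]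
    gcongr
    exact norm_haarDil_le n _
  have h2 : ∀ n, MemLp (g ⋆[ContinuousLinearMap.mul ℂ ℂ, volume] haarDil n) 2 := by
    intro n
    rw [memLp_two_iff_integrable_sq_norm (hI n).1]
    simp_rw [sq]
    exact (hI n).norm.bdd_mul (hI n).1.norm (Eventually.of_forall fun x => by
      rw [norm_norm]; exact hB n x)
  have hc : Continuous (𝓕 g) :=
    VectorFourier.fourierIntegral_continuous Real.continuous_fourierChar
      (by exact continuous_inner) hg1
  have e : ∀ n, ∫⁻ x, ‖(g ⋆[ContinuousLinearMap.mul ℂ ℂ, volume] haarDil n) x‖ₑ ^ 2 =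
      ∫⁻ ξ, ‖𝓕 g ξ‖ₑ ^ 2 * ‖haarFT ((2 * Real.pi * ξ) / 2 ^ n)‖ₑ ^ 2 := by
    intro n
    rw [← lintegral_enorm_fourier_sq (hI n) (h2 n)]
    refine lintegral_congr fun ξ => ?_
    rw [Real.fourier_mul_convolution_eq hg1 (integrable_haarDil n), fourier_haarDil, enorm_mul,
      mul_pow]
  have hm : ∀ n, Measurable fun ξ : ℝ => haarFT ((2 * Real.pi * ξ) / 2 ^ n) := by
    intro n
    have : Continuous (𝓕 (haarDil n)) :=
      VectorFourier.fourierIntegral_continuous Real.continuous_fourierChar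
        (by exact continuous_inner) (integrable_haarDil n)
    simpa only [funext (fourier_haarDil n)] using this.measurable
  simp_rw [e]
  rw [← lintegral_tsum fun n => (show Measurable fun ξ : ℝ => ‖𝓕 g ξ‖ₑ ^ 2 *
      ‖haarFT ((2 * Real.pi * ξ) / 2 ^ n)‖ₑ ^ 2 from (hc.measurable.enorm.pow_const 2).mul
    ((hm n).enorm.pow_const 2)).aemeasurable, ← lintegral_enorm_fourier_sq hg1 hg2,
    ← lintegral_const_mul' _ _ (by simp)]
  refine lintegral_mono fun ξ => ?_
  rw [ENNReal.tsum_mul_left, mul_comm]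
  gcongr
  rw [ENNReal.tsum_eq_iSup_nat]
  refine iSup_le fun N => ?_
  have := ENNReal.ofReal_le_ofReal (sum_haarFT_sq_le (2 * Real.pi * ξ) N)
  rw [ENNReal.ofReal_sum_of_nonneg fun _ _ => by positivity, ENNReal.ofReal_ofNat] at this
  refine le_trans (le_of_eq (Finset.sum_congr rfl fun n _ => ?_)) this
  rw [ENNReal.ofReal_pow (norm_nonneg _), ofReal_norm]

/-- `(g ⋆ haarDil n)(x)` depends only on the values of `g` at distance at most `2^{-n}` from
`x`. -/
lemma convolution_haarDil_congr {f g : ℝ → ℂ} {n : ℕ} {x : ℝ}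
    (h : ∀ t, |x - t| ≤ (2 ^ n : ℝ)⁻¹ → f t = g t) :
    (f ⋆[ContinuousLinearMap.mul ℂ ℂ, volume] haarDil n) x =
      (g ⋆[ContinuousLinearMap.mul ℂ ℂ, volume] haarDil n) x := by
  simp only [convolution_def]
  congr 1 with t
  by_cases ht : |x - t| ≤ (2 ^ n : ℝ)⁻¹
  · rw [h t ht]
  · rw [haarDil_eq_zero (not_le.1 ht)]
    simp

/-- The Haar square function is bounded on `L²`, without an integrability assumption. -/
lemma tsum_lintegral_convolution_haarDil_le {g : ℝ → ℂ} (hg : Measurable g) :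
    ∑' n, ∫⁻ x, ‖(g ⋆[ContinuousLinearMap.mul ℂ ℂ, volume] haarDil n) x‖ₑ ^ 2 ≤
      50 * ∫⁻ x, ‖g x‖ₑ ^ 2 := by
  rcases eq_or_ne (∫⁻ x, ‖g x‖ₑ ^ 2) ⊤ with hfin | hfin
  · simp [hfin]
  have hg2 : MemLp g 2 := ⟨hg.aestronglyMeasurable, by
    rw [eLpNorm_lt_top_iff_lintegral_rpow_enorm_lt_top (by simp) (by simp)]
    simpa using hfin.lt_top⟩
  have hm : ∀ n, Measurable fun x =>
      ‖(g ⋆[ContinuousLinearMap.mul ℂ ℂ, volume] haarDil n) x‖ₑ ^ 2 := fun n =>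
    (measurable_convolution hg (measurable_haarDil n)).enorm.pow_const 2
  rw [← lintegral_tsum fun n => (hm n).aemeasurable]
  have hU : (⋃ N : ℕ, Icc (-(N : ℝ)) N) = univ := by
    refine eq_univ_of_forall fun x => mem_iUnion.2 ?_
    obtain ⟨N, hN⟩ := exists_nat_ge |x|
    exact ⟨N, abs_le.1 hN⟩
  have hd : Directed (· ⊆ ·) fun N : ℕ => Icc (-(N : ℝ)) N :=
    Monotone.directed_le fun a b hab => by
      have : (a : ℝ) ≤ b := by exact_mod_cast hab
      exact Icc_subset_Icc (by linarith) this
  -- on a bounded interval only a truncation of `g` matters, and the truncation is integrable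
  rw [← setLIntegral_univ, ← hU, setLIntegral_iUnion_of_directed _ hd]
  refine iSup_le fun N => ?_
  set S := Icc (-((N : ℝ) + 1)) (N + 1) with hS
  set gN := S.indicator g with hgN
  have hgNm : Measurable gN := hg.indicator measurableSet_Icc
  have hgN2 : MemLp gN 2 := hg2.indicator measurableSet_Icc
  have hgN1 : Integrable gN := (integrable_indicator_iff measurableSet_Icc).2 <| by
    have : MemLp g 2 (volume.restrict S) := hg2.restrict S
    exact memLp_one_iff_integrable.1 (this.mono_exponent (by norm_num))
  calc ∫⁻ x in Icc (-(N : ℝ)) N,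
        ∑' n, ‖(g ⋆[ContinuousLinearMap.mul ℂ ℂ, volume] haarDil n) x‖ₑ ^ 2
      = ∫⁻ x in Icc (-(N : ℝ)) N,
        ∑' n, ‖(gN ⋆[ContinuousLinearMap.mul ℂ ℂ, volume] haarDil n) x‖ₑ ^ 2 := by
        refine setLIntegral_congr_fun measurableSet_Icc fun x hx => tsum_congr fun n => ?_
        rw [convolution_haarDil_congr (g := gN)]
        intro t ht
        have h1 : (2 ^ n : ℝ)⁻¹ ≤ 1 := inv_le_one_of_one_le₀ (one_le_pow₀ one_le_two)
        have := abs_le.1 (ht.trans h1)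
        rw [hgN, indicator_of_mem]
        exact ⟨by linarith [hx.1], by linarith [hx.2]⟩
    _ ≤ ∫⁻ x, ∑' n, ‖(gN ⋆[ContinuousLinearMap.mul ℂ ℂ, volume] haarDil n) x‖ₑ ^ 2 :=
        setLIntegral_le_lintegral _ _
    _ ≤ 50 * ∫⁻ x, ‖gN x‖ₑ ^ 2 := by
        rw [lintegral_tsum fun n => ((measurable_convolution hgNm
          (measurable_haarDil n)).enorm.pow_const 2).aemeasurable]
        exact tsum_lintegral_convolution_haarDil_le_of_integrable hgN1 hgN2
    _ ≤ 50 * ∫⁻ x, ‖g x‖ₑ ^ 2 := by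
        gcongr with x
        exact enorm_indicator_le_enorm_self g x

lemma measurable_lintegral_mul_cauchyWeight {v : ℝ → ℝ≥0∞} (hv : Measurable v) (b : ℝ) :
    Measurable fun x => ∫⁻ z, v z * cauchyWeight b (x - z) :=
  Measurable.lintegral_prod_right' (f := fun q : ℝ × ℝ => v q.2 * cauchyWeight b (q.1 - q.2))
    ((hv.comp measurable_snd).mul ((measurable_cauchyWeight b).comp
      (measurable_fst.sub measurable_snd)))

/-- A weighted `L²` inequality for the Haar square function, with the maximal function of the
weight. It follows from the unweighted inequality applied to the truncations of `f` to the
superlevel sets of the maximal function. -/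
lemma tsum_lintegral_convolution_haarDil_mul_le {f : ℝ → ℂ} (hf : Measurable f) {v : ℝ → ℝ≥0∞}
    (hv : Measurable v) (m : ℕ) :
    ∑' j : ℕ, ∫⁻ x, ‖(f ⋆[ContinuousLinearMap.mul ℂ ℂ, volume] haarDil (m + j)) x‖ₑ ^ 2 *
        ∫⁻ z, v z * cauchyWeight (2 ^ j) (x - z) ≤
      1200 * ∫⁻ x, ‖f x‖ₑ ^ 2 * dyadicMax v x := by
  have hM := (measurable_dyadicMax hv).const_mul 24
  set W : ℕ → ℝ → ℝ≥0∞ := fun j x => ∫⁻ z, v z * cauchyWeight (2 ^ j) (x - z) with hW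
  have hWm : ∀ j, Measurable (W j) := fun j => measurable_lintegral_mul_cauchyWeight hv _
  have layer : ∀ F : ℝ≥0∞, F = ∫⁻ t in Ioi (0 : ℝ), if ENNReal.ofReal t < F then 1 else 0 := by
    intro F
    have := lintegral_rpow_indicator_lt one_pos F
    simpa using this.symm
  have hlm : ∀ F : ℝ → ℝ≥0∞, Measurable F → Measurable fun z : ℝ × ℝ =>
      if ENNReal.ofReal z.2 < F z.1 then (1 : ℝ≥0∞) else 0 := fun F hF =>
    Measurable.ite (measurableSet_lt (by fun_prop) (hF.comp measurable_fst))
      measurable_const measurable_const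
  -- the layer cake formula, integrated against a second function
  have swap : ∀ (G F : ℝ → ℝ≥0∞), Measurable G → Measurable F →
      ∫⁻ x, G x * F x = ∫⁻ t in Ioi (0 : ℝ), ∫⁻ x, G x * if ENNReal.ofReal t < F x then 1 else 0 := by
    intro G F hG hF
    have : ∀ x, G x * F x =
        ∫⁻ t in Ioi (0 : ℝ), G x * if ENNReal.ofReal t < F x then 1 else 0 := fun x => by
      rw [lintegral_const_mul _ (show Measurable fun t : ℝ => if ENNReal.ofReal t < F x then
        (1 : ℝ≥0∞) else 0 from (hlm F hF).comp measurable_prodMk_left), ← layer]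
    simp_rw [this]
    exact lintegral_lintegral_swap ((hG.comp measurable_fst).mul (hlm F hF)).aemeasurable
  have hgm : ∀ j, Measurable fun x =>
      ‖(f ⋆[ContinuousLinearMap.mul ℂ ℂ, volume] haarDil (m + j)) x‖ₑ ^ 2 := fun j =>
    (measurable_convolution hf (measurable_haarDil _)).enorm.pow_const 2
  have hfm : Measurable fun x => ‖f x‖ₑ ^ 2 := hf.enorm.pow_const 2
  calc ∑' j : ℕ, ∫⁻ x, ‖(f ⋆[ContinuousLinearMap.mul ℂ ℂ, volume] haarDil (m + j)) x‖ₑ ^ 2 * W j x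
      = ∫⁻ t in Ioi (0 : ℝ), ∑' j : ℕ, ∫⁻ x,
        ‖(f ⋆[ContinuousLinearMap.mul ℂ ℂ, volume] haarDil (m + j)) x‖ₑ ^ 2 *
          if ENNReal.ofReal t < W j x then 1 else 0 := by
        rw [lintegral_tsum fun j => Measurable.aemeasurable ?_]
        · exact tsum_congr fun j => swap _ _ (hgm j) (hWm j)
        · exact Measurable.lintegral_prod_left' (f := fun q : ℝ × ℝ =>
            ‖(f ⋆[ContinuousLinearMap.mul ℂ ℂ, volume] haarDil (m + j)) q.1‖ₑ ^ 2 *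
              if ENNReal.ofReal q.2 < W j q.1 then 1 else 0)
            (((hgm j).comp measurable_fst).mul (hlm _ (hWm j)))
    _ ≤ ∫⁻ t in Ioi (0 : ℝ), 50 * ∫⁻ x, ‖f x‖ₑ ^ 2 *
          if ENNReal.ofReal t < 24 * dyadicMax v x then 1 else 0 := by
        refine lintegral_mono fun t => ?_
        set S := {x | ENNReal.ofReal t < 24 * dyadicMax v x} with hS
        have hSm : MeasurableSet S := measurableSet_lt measurable_const hM
        -- where the mean of `v` exceeds `t`, so does the maximal function at all points that
        -- enter into the convolution, hence `f` may be truncated to `S`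
        have hl : ∀ j x, ‖(f ⋆[ContinuousLinearMap.mul ℂ ℂ, volume] haarDil (m + j)) x‖ₑ ^ 2 *
            (if ENNReal.ofReal t < W j x then 1 else 0) ≤
            ‖(S.indicator f ⋆[ContinuousLinearMap.mul ℂ ℂ, volume] haarDil (m + j)) x‖ₑ ^ 2 := by
          intro j x
          split_ifs with h
          · rw [mul_one, convolution_haarDil_congr (g := S.indicator f)]
            intro y hy
            rw [indicator_of_mem]
            refine h.trans_le (lintegral_mul_cauchyWeight_le_of_abs_le hv (hy.trans ?_))
            gcongr
            · exact one_le_two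
            · omega
          · simp
        have hr : ∀ x, ‖S.indicator f x‖ₑ ^ 2 = ‖f x‖ₑ ^ 2 *
            if ENNReal.ofReal t < 24 * dyadicMax v x then 1 else 0 := by
          intro x
          by_cases hx : x ∈ S
          · rw [indicator_of_mem hx, if_pos (by exact hx), mul_one]
          · rw [indicator_of_notMem hx, if_neg (by exact hx), mul_zero]
            simp
        simp_rw [← hr]
        refine le_trans ?_ (tsum_lintegral_convolution_haarDil_le (hf.indicator hSm))
        refine (ENNReal.tsum_le_tsum fun j => lintegral_mono (hl j)).trans ?_
        exact ENNReal.tsum_comp_le_tsum_of_injective (add_right_injective m)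
          (fun n => ∫⁻ x, ‖(S.indicator f ⋆[ContinuousLinearMap.mul ℂ ℂ, volume]
            haarDil n) x‖ₑ ^ 2)
    _ = 1200 * ∫⁻ x, ‖f x‖ₑ ^ 2 * dyadicMax v x := by
        rw [lintegral_const_mul' _ _ (by simp), ← swap _ _ hfm hM]
        simp_rw [mul_left_comm _ (24 : ℝ≥0∞)]
        rw [lintegral_const_mul' _ _ (by simp), ← mul_assoc]
        norm_num

/-! ### Factorization of the frequency cutoffs through the Haar function -/

lemma norm_cexp_I_mul_mul (ξ y : ℝ) : ‖Complex.exp (Complex.I * (ξ : ℂ) * (y : ℂ))‖ = 1 := by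
  rw [Complex.norm_exp]
  simp

/-- The inverse Fourier transform of a test function decays faster than any power. -/
lemma exists_abs_pow_mul_norm_invFT_le (k : ℕ) {F : ℝ → ℂ} (hF : ContDiff ℝ ∞ F)
    (hFc : HasCompactSupport F) : ∃ B : ℝ, 0 ≤ B ∧ ∀ y, |y| ^ k * ‖invFT F y‖ ≤ B := by
  induction k generalizing F with
  | zero =>
    refine ⟨‖(2 * (Real.pi : ℂ))⁻¹‖ * ∫ ξ, ‖F ξ‖, by positivity, fun y => ?_⟩
    rw [pow_zero, one_mul, invFT, norm_mul]
    gcongr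
    refine (norm_integral_le_integral_norm _).trans_eq ?_
    simp_rw [norm_mul, norm_cexp_I_mul_mul, mul_one]
  | succ k ih =>
    have hF' : ContDiff ℝ ∞ (deriv F) := (contDiff_infty_iff_deriv.1 hF).2
    obtain ⟨B, hB, h⟩ := ih hF' hFc.deriv
    refine ⟨B, hB, fun y => ?_⟩
    have e := mul_invFT_eq (fun x => ((contDiff_infty_iff_deriv.1 hF).1 x).hasDerivAt)
      (hF.continuous.integrable_of_hasCompactSupport hFc)
      (hF'.continuous.integrable_of_hasCompactSupport hFc.deriv) y
    have e2 := congrArg norm e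
    rw [norm_mul, norm_mul, Complex.norm_I, one_mul, Complex.norm_real, Real.norm_eq_abs] at e2
    rw [pow_succ, mul_assoc, e2]
    exact h y

/-- Enough decay for `(1 + y²) ‖invFT F y‖` to be integrable. -/
lemma exists_norm_invFT_le {F : ℝ → ℂ} (hF : ContDiff ℝ ∞ F) (hFc : HasCompactSupport F) :
    ∃ B : ℝ, 0 < B ∧ ∀ y, ‖invFT F y‖ ≤ B * ((1 + y ^ 2) ^ 2)⁻¹ := by
  obtain ⟨B0, h0, hb0⟩ := exists_abs_pow_mul_norm_invFT_le 0 hF hFc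
  obtain ⟨B2, h2, hb2⟩ := exists_abs_pow_mul_norm_invFT_le 2 hF hFc
  obtain ⟨B4, h4, hb4⟩ := exists_abs_pow_mul_norm_invFT_le 4 hF hFc
  refine ⟨B0 + 2 * B2 + B4 + 1, by positivity, fun y => ?_⟩
  rw [← div_eq_mul_inv, le_div_iff₀ (by positivity)]
  have a0 := hb0 y
  have a2 := hb2 y
  have a4 := hb4 y
  have e : |y| ^ 4 = y ^ 4 := by rw [show 4 = 2 * 2 from rfl, pow_mul, sq_abs, ← pow_mul]
  rw [sq_abs] at a2
  rw [e] at a4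
  nlinarith

/-- The kernel `c (1 + (cu)²)⁻²`. -/
noncomputable def sqWeight (c u : ℝ) : ℝ≥0∞ := ENNReal.ofReal (c * ((1 + (c * u) ^ 2) ^ 2)⁻¹)

lemma measurable_sqWeight (c : ℝ) : Measurable (sqWeight c) := by
  unfold sqWeight; fun_prop

lemma sqWeight_le_cauchyWeight {c : ℝ} (hc : 0 < c) (u : ℝ) : sqWeight c u ≤ cauchyWeight c u := by
  refine ENNReal.ofReal_le_ofReal ?_
  gcongr
  nlinarith [sq_nonneg (c * u), sq_nonneg ((c * u) ^ 2)]

/-- Averaging the Cauchy weight of scale `1/b` at the finer scale `1/c` costs a bounded factor: the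
growth of the weight under a translation by `u` is at most `1 + (cu)²`, which the decay of
`sqWeight` absorbs. -/
lemma sqWeight_mul_cauchyWeight_le {b c : ℝ} (hb : 0 < b) (hbc : b ≤ c) (u y : ℝ) :
    sqWeight c u * cauchyWeight b (y - u) ≤ 2 * cauchyWeight b y * cauchyWeight c u := by
  have hc : 0 < c := hb.trans_le hbc
  simp only [sqWeight, cauchyWeight]
  rw [← ENNReal.ofReal_mul (by positivity), ← ENNReal.ofReal_ofNat 2,
    ← ENNReal.ofReal_mul (by positivity), ← ENNReal.ofReal_mul (by positivity)]
  refine ENNReal.ofReal_le_ofReal ?_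
  have h1 : (b * u) ^ 2 ≤ (c * u) ^ 2 := by
    rw [mul_pow, mul_pow]; gcongr
  have h2 : 1 + (b * y) ^ 2 ≤ 2 * ((1 + (c * u) ^ 2) * (1 + (b * (y - u)) ^ 2)) := by
    nlinarith [sq_nonneg (b * (y - u) - b * u), sq_nonneg (c * u),
      mul_nonneg (sq_nonneg (c * u)) (sq_nonneg (b * (y - u)))]
  have h3 : (1 + (c * u) ^ 2)⁻¹ * (1 + (b * (y - u)) ^ 2)⁻¹ ≤ 2 * (1 + (b * y) ^ 2)⁻¹ := by
    rw [← mul_inv, ← div_eq_mul_inv, inv_le_comm₀ (by positivity) (by positivity), inv_div,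
      div_le_iff₀ (by norm_num)]
    linarith
  calc c * ((1 + (c * u) ^ 2) ^ 2)⁻¹ * (b * (1 + (b * (y - u)) ^ 2)⁻¹)
      = b * (c * (1 + (c * u) ^ 2)⁻¹) * ((1 + (c * u) ^ 2)⁻¹ * (1 + (b * (y - u)) ^ 2)⁻¹) := by
        rw [sq (1 + (c * u) ^ 2), mul_inv]; ring
    _ ≤ b * (c * (1 + (c * u) ^ 2)⁻¹) * (2 * (1 + (b * y) ^ 2)⁻¹) := by gcongr
    _ = _ := by ring

lemma lintegral_cauchyWeight_le (n : ℕ) (x : ℝ) :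
    ∫⁻ y, cauchyWeight (2 ^ n) (x - y) ≤ 16 := by
  have h := lintegral_mul_cauchyWeight_le (v := fun _ => 1) measurable_const n x
  simp only [one_mul] at h
  refine h.trans ?_
  calc 8 * dyadicMax (fun _ => 1) x ≤ 8 * (2 * 1) := by
        gcongr; exact dyadicMax_le_of_le (fun _ => le_rfl) x
    _ = 16 := by norm_num

/-- The quotient of `φ` by the Fourier transform of `haar`, which has no zeros in
`1/10 < |ξ| < 10`. At `ξ = 0` the value is `0`. -/
noncomputable def haarQuotient (φ : ℝ → ℂ) (ξ : ℝ) : ℂ :=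
  φ ξ * ((Complex.I * ξ) / ((2 - 2 * Real.cos (ξ / 4) : ℝ) : ℂ))

lemma two_sub_two_mul_cos_ne_zero {ξ : ℝ} (h : 1 / 10 < |ξ| ∧ |ξ| < 10) :
    (2 - 2 * Real.cos (ξ / 4) : ℝ) ≠ 0 := by
  have h1 : |ξ / 4| < 2 * Real.pi := by
    rw [abs_div, abs_of_pos (by norm_num : (0 : ℝ) < 4)]
    linarith [Real.pi_gt_three]
  intro h0
  have h2 := (Real.cos_eq_one_iff_of_lt_of_lt (neg_lt_of_abs_lt h1) (lt_of_abs_lt h1)).1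
    (by linarith)
  have h3 : ξ = 0 := by linarith
  rw [h3, abs_zero] at h
  linarith [h.1]

lemma contDiff_haarQuotient {φ : ℝ → ℂ} (hφ : ContDiff ℝ ∞ φ)
    (hφsupp : tsupport φ ⊆ {x : ℝ | 1 / 10 < |x| ∧ |x| < 10}) :
    ContDiff ℝ ∞ (haarQuotient φ) := by
  refine contDiff_iff_contDiffAt.2 fun x => ?_
  by_cases hx : x ∈ tsupport φ
  · have e : haarQuotient φ = fun ξ : ℝ =>
        φ ξ * (Complex.I * ξ * ((2 - 2 * Real.cos (ξ / 4) : ℝ) : ℂ)⁻¹) :=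
      funext fun ξ => by rw [haarQuotient, div_eq_mul_inv]
    rw [e]
    refine hφ.contDiffAt.mul (ContDiffAt.mul ?_ (ContDiffAt.inv ?_ ?_))
    · exact contDiffAt_const.mul Complex.ofRealCLM.contDiff.contDiffAt
    · refine Complex.ofRealCLM.contDiff.contDiffAt.comp x (f := fun ξ : ℝ =>
        (2 - 2 * Real.cos (ξ / 4) : ℝ)) ?_
      exact contDiffAt_const.sub (contDiffAt_const.mul
        (Real.contDiff_cos.contDiffAt.comp x (contDiffAt_id.div_const 4)))
    · exact_mod_cast two_sub_two_mul_cos_ne_zero (hφsupp hx)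
  · refine (contDiffAt_const (c := (0 : ℂ))).congr_of_eventuallyEq ?_
    filter_upwards [notMem_tsupport_iff_eventuallyEq.1 hx] with y hy
    simp [haarQuotient, hy]

lemma haarQuotient_mul_haarFT {φ : ℝ → ℂ}
    (hφsupp : tsupport φ ⊆ {x : ℝ | 1 / 10 < |x| ∧ |x| < 10}) (ξ : ℝ) :
    haarQuotient φ ξ * haarFT ξ = φ ξ := by
  by_cases hξ : φ ξ = 0
  · simp [haarQuotient, hξ]
  · have hs := hφsupp (subset_tsupport φ hξ)
    have h0 : ξ ≠ 0 := by
      rintro rfl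
      have := hs.1
      norm_num at this
    have h1 : ((2 - 2 * Real.cos (ξ / 4) : ℝ) : ℂ) ≠ 0 := by
      exact_mod_cast two_sub_two_mul_cos_ne_zero hs
    have h2 : Complex.I * (ξ : ℂ) ≠ 0 := by simp [h0]
    rw [haarQuotient, haarFT_eq h0, mul_assoc, div_mul_div_cancel₀ h1, div_self h2, mul_one]

/-- Convolution with `haar` multiplies the symbol by `haarFT`. -/
lemma haar_convolution_invFT {F : ℝ → ℂ} (hF : Integrable F) (x : ℝ) :
    (haar ⋆[ContinuousLinearMap.mul ℂ ℂ, volume] invFT F) x =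
      invFT (fun ξ => F ξ * haarFT ξ) x := by
  simp only [convolution_def, ContinuousLinearMap.mul_apply', invFT, haarFT]
  simp_rw [mul_left_comm (haar _)]
  rw [integral_const_mul]
  congr 1
  simp_rw [← integral_const_mul, ← integral_mul_const]
  rw [integral_integral_swap]
  · refine integral_congr_ae (Eventually.of_forall fun ξ => integral_congr_ae
      (Eventually.of_forall fun t => ?_))
    have : Complex.exp (Complex.I * (ξ : ℂ) * ((x - t : ℝ) : ℂ)) =
        Complex.exp (-(Complex.I * ξ * t)) * Complex.exp (Complex.I * (ξ : ℂ) * (x : ℂ)) := by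
      rw [← Complex.exp_add]; congr 1; push_cast; ring
    simp only [this]
    ring
  · have h1 : Integrable (fun q : ℝ × ℝ => haar q.1 * F q.2) (volume.prod volume) :=
      integrable_haar.mul_prod hF
    have h2 := h1.mul_bdd (c := 1) (g := fun q : ℝ × ℝ =>
      Complex.exp (Complex.I * (q.2 : ℂ) * ((x - q.1 : ℝ) : ℂ))) (by fun_prop)
      (Eventually.of_forall fun q => (norm_cexp_I_mul_mul _ _).le)
    refine h2.congr (Eventually.of_forall fun q => ?_)
    simp [Function.uncurry, mul_assoc]

lemma haarDil_convolution_dilation (K : ℝ → ℂ) (n : ℕ) (x : ℝ) :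
    (haarDil n ⋆[ContinuousLinearMap.mul ℂ ℂ, volume]
      fun y => ((2 ^ n : ℝ) : ℂ) * K (2 ^ n * y)) x =
    ((2 ^ n : ℝ) : ℂ) * (haar ⋆[ContinuousLinearMap.mul ℂ ℂ, volume] K) (2 ^ n * x) := by
  have hb : (0 : ℝ) < 2 ^ n := by positivity
  simp only [convolution_def, ContinuousLinearMap.mul_apply']
  have h := Measure.integral_comp_mul_left
    (fun t : ℝ => haar t * K (2 ^ n * x - t)) ((2 : ℝ) ^ n)
  rw [abs_of_pos (inv_pos.2 hb)] at h
  have h2 : ∫ t, haar t * K (2 ^ n * x - t) =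
      (2 ^ n : ℝ) • ∫ t, haar (2 ^ n * t) * K (2 ^ n * x - 2 ^ n * t) := by
    rw [h, smul_smul, mul_inv_cancel₀ hb.ne', one_smul]
  rw [h2, Complex.real_smul, ← mul_assoc, ← integral_const_mul]
  refine integral_congr_ae (Eventually.of_forall fun t => ?_)
  simp only [haarDil, mul_sub]
  ring

/-- The factorization of `φ̌_n` as the convolution of a dilated Haar function with a rapidly
decreasing kernel. -/
lemma haarDil_convolution_invFT_haarQuotient {φ : ℝ → ℂ} (hφ : ContDiff ℝ ∞ φ)
    (hφc : HasCompactSupport φ)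
    (hφsupp : tsupport φ ⊆ {x : ℝ | 1 / 10 < |x| ∧ |x| < 10}) (n : ℕ) :
    (haarDil n ⋆[ContinuousLinearMap.mul ℂ ℂ, volume]
      fun y => ((2 ^ n : ℝ) : ℂ) * invFT (haarQuotient φ) (2 ^ n * y)) = invFT (phiDil φ n) := by
  have hi : Integrable (haarQuotient φ) :=
    (contDiff_haarQuotient hφ hφsupp).continuous.integrable_of_hasCompactSupport hφc.mul_right
  ext x
  rw [haarDil_convolution_dilation, haar_convolution_invFT hi]
  simp_rw [haarQuotient_mul_haarFT hφsupp]
  have := invFT_dilation (F := φ) (b := 2 ^ n) (by positivity) x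
  exact this.symm

/-- A function in `L^p` is integrable against a bounded integrable one: `|f| ≤ 1 + |f|^p`. -/
lemma MeasureTheory.MemLp.integrable_mul_of_bounded {f : ℝ → ℂ} {p : ℝ} (hp : 1 ≤ p)
    (hf : MemLp f (ENNReal.ofReal p)) {k : ℝ → ℝ} (hk : Integrable k) {B : ℝ}
    (hB : ∀ x, ‖k x‖ ≤ B) : Integrable fun x => ‖f x‖ * k x := by
  have h1 : Integrable fun x => ‖f x‖ ^ p := by
    have := hf.integrable_norm_rpow (by simp; linarith) (by simp)
    rwa [ENNReal.toReal_ofReal (by linarith)] at this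
  have h2 : Integrable fun x => ‖k x‖ + ‖f x‖ ^ p * ‖k x‖ :=
    hk.norm.add (h1.mul_bdd (c := B) hk.norm.aestronglyMeasurable
      (Eventually.of_forall fun x => by rw [norm_norm]; exact hB x))
  refine h2.mono' (hf.1.norm.mul hk.1) (Eventually.of_forall fun x => ?_)
  rw [norm_mul, norm_norm, ← one_add_mul]
  gcongr
  rcases le_total ‖f x‖ 1 with h | h
  · linarith [Real.rpow_nonneg (norm_nonneg (f x)) p]
  · linarith [Real.self_le_rpow_of_one_le h hp]

/-- The associativity `f ⋆ (g ⋆ k) = (f ⋆ g) ⋆ k` for `f` in `L^p` and bounded integrable kernels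
`g`, `k`. -/
lemma convolution_assoc_of_memLp {f g k : ℝ → ℂ} {p : ℝ} (hp : 1 ≤ p)
    (hf : MemLp f (ENNReal.ofReal p)) (hg : Integrable g) (hk : Integrable k) {A B : ℝ}
    (hA : ∀ x, ‖g x‖ ≤ A) (hB : ∀ x, ‖k x‖ ≤ B) (x : ℝ) :
    ((f ⋆[ContinuousLinearMap.mul ℂ ℂ, volume] g) ⋆[ContinuousLinearMap.mul ℂ ℂ, volume] k) x =
      (f ⋆[ContinuousLinearMap.mul ℂ ℂ, volume]
        (g ⋆[ContinuousLinearMap.mul ℂ ℂ, volume] k)) x := by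
  have hB' : ∀ t x, ‖(fun t => ‖k (x - t)‖) t‖ ≤ B := fun t x => by
    rw [norm_norm]; exact hB _
  have hgk : ∀ x, Integrable fun t => ‖g t‖ * ‖k (x - t)‖ := fun x =>
    hg.norm.mul_bdd (c := B) (hk.comp_sub_left x).norm.aestronglyMeasurable
      (Eventually.of_forall fun t => hB' t x)
  refine convolution_assoc _ _ _ _ (fun a b c => ?_) hf.1 hg.1 hk.1
    (Eventually.of_forall fun y => ?_) (Eventually.of_forall fun y => ?_) ?_
  · simp [mul_assoc]
  · have h1 := hf.integrable_mul_of_bounded hp (hg.comp_sub_left y).norm (B := A)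
      (fun t => by rw [norm_norm]; exact hA _)
    refine h1.mono (hf.1.mul (hg.comp_sub_left y).1) (Eventually.of_forall fun t => ?_)
    simp
  · exact hgk y
  · refine hf.integrable_mul_of_bounded hp (B := (∫ t, ‖g t‖) * B)
      ((hg.norm.integrable_convolution (ContinuousLinearMap.mul ℝ ℝ) hk.norm).comp_sub_left x)
      fun t => ?_
    rw [convolution_def, ← integral_mul_const]
    refine norm_integral_le_of_norm_le (hg.norm.mul_const _) (Eventually.of_forall fun s => ?_)
    rw [ContinuousLinearMap.mul_apply', norm_mul, norm_norm]
    gcongr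
    exact hB' s _

/-- Pointwise control of the pieces of one frequency scale by a weighted mean square of the Haar
coefficients of `f` at scale `2^{-m-j}`, with a weight at the coarser scale `2^{-j}`. -/
lemma IsPhaseOn.exists_sum_piece_le_haarDil {U : Set ℝ} {r : ℝ → ℝ}
    (h : IsPhaseOn U (phaseR r) r) {φ : ℝ → ℂ} (hφ : ContDiff ℝ ∞ φ) (hφc : HasCompactSupport φ)
    (hφU : tsupport φ ⊆ U) (hφsupp : tsupport φ ⊆ {x : ℝ | 1 / 10 < |x| ∧ |x| < 10}) :
    ∃ C : ℝ, 0 < C ∧ ∀ (m j : ℕ) (f : ℝ → ℂ) (p : ℝ), 1 ≤ p → Measurable f →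
      MemLp f (ENNReal.ofReal p) → ∀ x,
      ∑ p ∈ Finset.Icc ((2 : ℕ) ^ m) (2 ^ (m + 1)), ‖piece φ r f m p j x‖ₑ ^ 2
      ≤ ENNReal.ofReal C *
        ∫⁻ s, ‖(f ⋆[ContinuousLinearMap.mul ℂ ℂ, volume] haarDil (m + j)) s‖ₑ ^ 2 *
          cauchyWeight (2 ^ j) (x - s) := by
  obtain ⟨C, hC, hb⟩ := h.exists_sum_piece_le hφ hφc hφU
  have hχ := contDiff_haarQuotient hφ hφsupp
  have hχc : HasCompactSupport (haarQuotient φ) := hφc.mul_right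
  have hχi : Integrable (haarQuotient φ) := hχ.continuous.integrable_of_hasCompactSupport hχc
  obtain ⟨B, hB, hκ⟩ := exists_norm_invFT_le hχ hχc
  refine ⟨C * (512 * B ^ 2), by positivity, fun m j f p hp hf hfp x => ?_⟩
  set n := m + j with hn
  have h2n : (0 : ℝ) < 2 ^ n := by positivity
  set κ : ℝ → ℂ := fun y => ((2 ^ n : ℝ) : ℂ) * invFT (haarQuotient φ) (2 ^ n * y) with hκdef
  have hκm : Measurable κ :=
    ((continuous_invFT hχi).measurable.comp (measurable_const_mul _)).const_mul _
  have hκq : ∀ y, ‖κ y‖ₑ ≤ ENNReal.ofReal B * sqWeight (2 ^ n) y := by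
    intro y
    rw [sqWeight, ← ENNReal.ofReal_mul hB.le, ← ofReal_norm]
    refine ENNReal.ofReal_le_ofReal ?_
    rw [hκdef, norm_mul, Complex.norm_real, Real.norm_of_nonneg h2n.le, mul_left_comm]
    gcongr
    exact hκ _
  have hqint : ∀ t, ∫⁻ s, sqWeight (2 ^ n) (t - s) ≤ 16 := fun t =>
    (lintegral_mono fun s => sqWeight_le_cauchyWeight h2n _).trans (lintegral_cauchyWeight_le n t)
  have hκi : Integrable κ := by
    refine ⟨hκm.aestronglyMeasurable, ?_⟩
    have h0 := hqint 0
    simp_rw [zero_sub] at h0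
    rw [lintegral_neg_eq_self (fun s => sqWeight (2 ^ n) s)] at h0
    refine (lintegral_mono hκq).trans_lt ?_
    rw [lintegral_const_mul' _ _ ENNReal.ofReal_ne_top]
    exact ENNReal.mul_lt_top ENNReal.ofReal_lt_top (h0.trans_lt (by simp))
  have hκB : ∀ y, ‖κ y‖ ≤ 2 ^ n * B := by
    intro y
    rw [hκdef, norm_mul, Complex.norm_real, Real.norm_of_nonneg h2n.le]
    gcongr
    refine (hκ _).trans (mul_le_of_le_one_right hB.le (inv_le_one_of_one_le₀ ?_))
    exact one_le_pow₀ (by nlinarith [sq_nonneg (2 ^ n * y)])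
  set g := f ⋆[ContinuousLinearMap.mul ℂ ℂ, volume] haarDil n with hg
  have hgm : Measurable g := measurable_convolution hf (measurable_haarDil n)
  have hfac : f ⋆[ContinuousLinearMap.mul ℂ ℂ, volume] invFT (phiDil φ n) =
      g ⋆[ContinuousLinearMap.mul ℂ ℂ, volume] κ := by
    rw [← haarDil_convolution_invFT_haarQuotient hφ hφc hφsupp n]
    ext y
    exact (convolution_assoc_of_memLp hp hfp (integrable_haarDil n) hκi (norm_haarDil_le n) hκB
      y).symm
  have hgκ : ∀ t, ‖(g ⋆[ContinuousLinearMap.mul ℂ ℂ, volume] κ) t‖ₑ ^ 2 ≤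
      ENNReal.ofReal (16 * B ^ 2) * ∫⁻ s, ‖g s‖ₑ ^ 2 * sqWeight (2 ^ n) (t - s) := by
    intro t
    have hw : Measurable fun s => sqWeight (2 ^ n) (t - s) :=
      (measurable_sqWeight _).comp (measurable_const_sub t)
    have hpos : ∀ s, sqWeight (2 ^ n) s ≠ 0 := fun s => by
      rw [sqWeight, Ne, ENNReal.ofReal_eq_zero, not_le]; positivity
    have hne : ∀ s, sqWeight (2 ^ n) s ≠ ⊤ := fun s => ENNReal.ofReal_ne_top
    calc ‖(g ⋆[ContinuousLinearMap.mul ℂ ℂ, volume] κ) t‖ₑ ^ 2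
        ≤ (∫⁻ s, ‖g s‖ₑ * ‖κ (t - s)‖ₑ) ^ 2 := by
          gcongr
          rw [convolution_def]
          refine (enorm_integral_le_lintegral_enorm _).trans_eq ?_
          simp [enorm_mul]
      _ ≤ (∫⁻ s, ‖g s‖ₑ ^ 2 * sqWeight (2 ^ n) (t - s)) *
          ∫⁻ s, ‖κ (t - s)‖ₑ ^ 2 * (sqWeight (2 ^ n) (t - s))⁻¹ :=
          lintegral_mul_sq_le_weight hgm.enorm.aemeasurable
            (hκm.comp (measurable_const_sub t)).enorm.aemeasurable hw.aemeasurable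
            hw.inv.aemeasurable fun s => ENNReal.mul_inv_cancel (hpos _) (hne _)
      _ ≤ (∫⁻ s, ‖g s‖ₑ ^ 2 * sqWeight (2 ^ n) (t - s)) *
          ∫⁻ s, ENNReal.ofReal B ^ 2 * sqWeight (2 ^ n) (t - s) := by
          refine mul_le_mul_right (lintegral_mono fun s => ?_) _
          calc ‖κ (t - s)‖ₑ ^ 2 * (sqWeight (2 ^ n) (t - s))⁻¹
              ≤ (ENNReal.ofReal B * sqWeight (2 ^ n) (t - s)) ^ 2 *
                (sqWeight (2 ^ n) (t - s))⁻¹ := by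
                gcongr; exact hκq _
            _ = ENNReal.ofReal B ^ 2 * sqWeight (2 ^ n) (t - s) := by
                rw [mul_pow, sq (sqWeight _ _), mul_assoc, mul_assoc,
                  ENNReal.mul_inv_cancel (hpos _) (hne _), mul_one]
      _ ≤ (∫⁻ s, ‖g s‖ₑ ^ 2 * sqWeight (2 ^ n) (t - s)) * (ENNReal.ofReal B ^ 2 * 16) := by
          rw [lintegral_const_mul' _ _ (by simp)]
          gcongr
          exact hqint t
      _ = _ := by
          rw [ENNReal.ofReal_mul (by norm_num), ENNReal.ofReal_pow hB.le, ENNReal.ofReal_ofNat]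
          ring
  have hmeas : Measurable (f ⋆[ContinuousLinearMap.mul ℂ ℂ, volume] invFT (phiDil φ n)) := by
    rw [hfac]; exact measurable_convolution hgm hκm
  refine (hb m j f x hmeas).trans ?_
  rw [hfac, ENNReal.ofReal_mul hC.le, mul_assoc]
  refine mul_le_mul_right ?_ _
  calc ∫⁻ t, ‖(g ⋆[ContinuousLinearMap.mul ℂ ℂ, volume] κ) t‖ₑ ^ 2 * cauchyWeight (2 ^ j) (x - t)
      ≤ ∫⁻ t, ENNReal.ofReal (16 * B ^ 2) *
          ∫⁻ s, ‖g s‖ₑ ^ 2 * sqWeight (2 ^ n) (t - s) * cauchyWeight (2 ^ j) (x - t) := by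
        refine lintegral_mono fun t => ?_
        rw [lintegral_mul_const' _ _ (show cauchyWeight (2 ^ j) (x - t) ≠ ⊤ from
          ENNReal.ofReal_ne_top), ← mul_assoc]
        exact mul_le_mul_left (hgκ t) _
    _ = ENNReal.ofReal (16 * B ^ 2) * ∫⁻ s, ∫⁻ t,
          ‖g s‖ₑ ^ 2 * sqWeight (2 ^ n) (t - s) * cauchyWeight (2 ^ j) (x - t) := by
        rw [lintegral_const_mul' _ _ ENNReal.ofReal_ne_top, lintegral_lintegral_swap]
        refine Measurable.aemeasurable ?_
        exact (((hgm.comp measurable_snd).enorm.pow_const 2).mul ((measurable_sqWeight _).comp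
          (measurable_fst.sub measurable_snd))).mul
          ((measurable_cauchyWeight _).comp (measurable_const.sub measurable_fst))
    _ ≤ ENNReal.ofReal (16 * B ^ 2) * ∫⁻ s,
          ‖g s‖ₑ ^ 2 * (2 * cauchyWeight (2 ^ j) (x - s) * 16) := by
        gcongr with s
        calc ∫⁻ t, ‖g s‖ₑ ^ 2 * sqWeight (2 ^ n) (t - s) * cauchyWeight (2 ^ j) (x - t)
            ≤ ∫⁻ t, ‖g s‖ₑ ^ 2 * (2 * cauchyWeight (2 ^ j) (x - s) *
                cauchyWeight (2 ^ n) (s - t)) := by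
              refine lintegral_mono fun t => ?_
              rw [mul_assoc]
              refine mul_le_mul_right ?_ _
              have := sqWeight_mul_cauchyWeight_le (b := 2 ^ j) (c := 2 ^ n) (by positivity)
                (pow_le_pow_right₀ one_le_two (by omega)) (t - s) (x - s)
              rwa [sub_sub_sub_cancel_right, ← cauchyWeight_neg (2 ^ n), neg_sub] at this
          _ ≤ ‖g s‖ₑ ^ 2 * (2 * cauchyWeight (2 ^ j) (x - s) * 16) := by
              rw [lintegral_const_mul' _ _ (by simp), lintegral_const_mul' _ _
                (show 2 * cauchyWeight (2 ^ j) (x - s) ≠ ⊤ from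
                  ENNReal.mul_ne_top (by simp) ENNReal.ofReal_ne_top)]
              gcongr
              exact lintegral_cauchyWeight_le n s
    _ = _ := by
        rw [← lintegral_const_mul' _ _ ENNReal.ofReal_ne_top,
          ← lintegral_const_mul' _ _ ENNReal.ofReal_ne_top]
        refine lintegral_congr fun s => ?_
        rw [show (512 : ℝ) * B ^ 2 = 32 * (16 * B ^ 2) by ring, ENNReal.ofReal_mul (p := 32)
          (by norm_num), ENNReal.ofReal_ofNat, show (32 : ℝ≥0∞) = 2 * 16 by norm_num]
        ring

/-! ### Duality and the square function estimate -/

/-- A function `F` whose integrals against weights `v` are controlled by those of `A` against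
`dyadicMax v` is controlled by `A` in `L^q`, `q ≥ 1`: test with `v = F^{q-1}`. -/
lemma exists_lintegral_rpow_le_of_forall_dyadicMax {q : ℝ} (hq : 1 ≤ q) {K : ℝ} (hK : 0 < K) :
    ∃ C : ℝ, 0 < C ∧ ∀ F A : ℝ → ℝ≥0∞, Measurable F → Measurable A →
      (∀ v, Measurable v → ∫⁻ x, F x * v x ≤ ENNReal.ofReal K * ∫⁻ x, A x * dyadicMax v x) →
      ∫⁻ x, F x ^ q ≤ ENNReal.ofReal C * ∫⁻ x, A x ^ q := by
  rcases hq.eq_or_lt with rfl | hq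
  · refine ⟨K * 2, by positivity, fun F A _ _ h => ?_⟩
    have h1 := h (fun _ => 1) measurable_const
    simp only [mul_one] at h1
    simp only [ENNReal.rpow_one]
    refine h1.trans ?_
    rw [ENNReal.ofReal_mul hK.le, mul_assoc, ENNReal.ofReal_ofNat]
    refine mul_le_mul_right ?_ _
    rw [← lintegral_const_mul' _ _ (by simp)]
    refine lintegral_mono fun x => ?_
    rw [mul_comm]
    refine mul_le_mul_left ?_ _
    simpa using dyadicMax_le_of_le (v := fun _ => 1) (fun _ => le_rfl) x
  have hq0 : 0 < q := by linarith
  have hconj : q.HolderConjugate (q / (q - 1)) := Real.HolderConjugate.conjExponent hq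
  set q' := q / (q - 1) with hq'
  have hq'1 : 1 < q' := hconj.symm.lt
  have hq'0 : 0 < q' := by linarith
  obtain ⟨C, hC, hmax⟩ := exists_lintegral_dyadicMax_rpow_le hq'1
  refine ⟨(K * C ^ (1 / q')) ^ q, by positivity, fun F A hF hA h => ?_⟩
  -- truncations of `F` in height and in space
  set FN : ℕ → ℝ → ℝ≥0∞ := fun N => (Icc (-(N : ℝ)) N).indicator fun x => min (F x) N with hFN
  have hFNm : ∀ N, Measurable (FN N) := fun N =>
    (hF.min measurable_const).indicator measurableSet_Icc
  have hFNle : ∀ N x, FN N x ≤ F x := fun N x =>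
    (indicator_le_self _ _ x).trans (min_le_left _ _)
  have hmono : ∀ x, Monotone fun N => FN N x := by
    intro x N N' hNN
    have hc : (N : ℝ) ≤ N' := by exact_mod_cast hNN
    simp only [hFN]
    by_cases hx : x ∈ Icc (-(N : ℝ)) N
    · rw [indicator_of_mem hx, indicator_of_mem (Icc_subset_Icc (neg_le_neg hc) hc hx)]
      gcongr
    · rw [indicator_of_notMem hx]
      exact zero_le
  have htend : ∀ x, Tendsto (fun N => FN N x) atTop (𝓝 (F x)) := by
    intro x
    have h1 : Tendsto (fun N : ℕ => min (F x) N) atTop (𝓝 (min (F x) ⊤)) :=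
      tendsto_const_nhds.min ENNReal.tendsto_nat_nhds_top
    rw [min_top_right] at h1
    refine h1.congr' ?_
    obtain ⟨N0, hN0⟩ := exists_nat_ge |x|
    filter_upwards [eventually_ge_atTop N0] with N hN
    have hc : |x| ≤ N := hN0.trans (by exact_mod_cast hN)
    simp only [hFN]
    rw [indicator_of_mem (show x ∈ Icc (-(N : ℝ)) N from abs_le.1 hc)]
  have hbound : ∀ N, ∫⁻ x, FN N x ^ q ≤
      ENNReal.ofReal ((K * C ^ (1 / q')) ^ q) * ∫⁻ x, A x ^ q := by
    intro N
    set X := ∫⁻ x, FN N x ^ q with hX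
    -- the truncation makes `X` finite, so that it may be cancelled at the end
    have hXt : X ≠ ⊤ := by
      have : X ≤ ∫⁻ x in Icc (-(N : ℝ)) N, (N : ℝ≥0∞) ^ q := by
        rw [hX, ← lintegral_indicator measurableSet_Icc]
        refine lintegral_mono fun x => ?_
        by_cases hx : x ∈ Icc (-(N : ℝ)) N
        · simp only [hFN, indicator_of_mem hx]
          gcongr
          exact min_le_right _ _
        · simp only [hFN, indicator_of_notMem hx]
          simp [hq0]
      refine ne_top_of_le_ne_top ?_ this
      rw [setLIntegral_const]
      exact ENNReal.mul_ne_top (ENNReal.rpow_ne_top_of_nonneg hq0.le (by simp)) (by simp)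
    rcases eq_or_ne X 0 with hX0 | hX0
    · rw [hX0]; exact zero_le
    have hvm : Measurable fun x => FN N x ^ (q - 1) := (hFNm N).pow_const _
    have h1 : X ≤ ENNReal.ofReal K * ∫⁻ x, A x * dyadicMax (fun x => FN N x ^ (q - 1)) x := by
      refine le_trans (lintegral_mono fun x => ?_) (h _ hvm)
      have e : FN N x ^ q = FN N x * FN N x ^ (q - 1) := by
        have := ENNReal.rpow_add_of_nonneg (x := FN N x) 1 (q - 1) zero_le_one (by linarith)
        rwa [ENNReal.rpow_one, add_sub_cancel] at this
      simp only [e]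
      gcongr
      exact hFNle N x
    have h2 := ENNReal.lintegral_mul_le_Lp_mul_Lq volume hconj hA.aemeasurable
      (measurable_dyadicMax hvm).aemeasurable
    have h3 : ∫⁻ x, dyadicMax (fun x => FN N x ^ (q - 1)) x ^ q' ≤ ENNReal.ofReal C * X := by
      refine (hmax _ hvm).trans_eq ?_
      congr 1
      refine lintegral_congr fun x => ?_
      rw [← ENNReal.rpow_mul]
      congr 1
      rw [hq']
      field_simp [show q - 1 ≠ 0 by linarith]
    have h4 : X ≤ ENNReal.ofReal (K * C ^ (1 / q')) * (∫⁻ x, A x ^ q) ^ (1 / q) *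
        X ^ (1 / q') := by
      calc X ≤ ENNReal.ofReal K * ((∫⁻ x, A x ^ q) ^ (1 / q) *
            (ENNReal.ofReal C * X) ^ (1 / q')) := by
            refine h1.trans ?_
            gcongr
            refine h2.trans ?_
            gcongr
        _ = _ := by
            rw [ENNReal.mul_rpow_of_nonneg _ _ (by positivity), ENNReal.ofReal_mul hK.le,
              ← ENNReal.ofReal_rpow_of_pos hC]
            ring
    have h5 : X = X ^ (1 / q) * X ^ (1 / q') := by
      rw [← ENNReal.rpow_add _ _ hX0 hXt, one_div, one_div, hconj.inv_add_inv_eq_one,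
        ENNReal.rpow_one]
    have h6 : X ^ (1 / q) ≤ ENNReal.ofReal (K * C ^ (1 / q')) * (∫⁻ x, A x ^ q) ^ (1 / q) := by
      have h7 : X ^ (1 / q') ≠ 0 := by simp [hX0, hXt]
      have h8 : X ^ (1 / q') ≠ ⊤ := ENNReal.rpow_ne_top_of_nonneg (by positivity) hXt
      exact (ENNReal.mul_le_mul_iff_left h7 h8).1 (h5.symm.le.trans h4)
    have h7 := ENNReal.rpow_le_rpow h6 hq0.le
    rwa [ENNReal.mul_rpow_of_nonneg _ _ hq0.le, ← ENNReal.rpow_mul, ← ENNReal.rpow_mul,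
      one_div_mul_cancel hq0.ne', ENNReal.rpow_one, ENNReal.rpow_one,
      ENNReal.ofReal_rpow_of_nonneg (by positivity) hq0.le] at h7
  refine le_of_tendsto' (lintegral_tendsto_of_tendsto_of_monotone
    (fun N => ((hFNm N).pow_const q).aemeasurable) (Eventually.of_forall fun x N N' hNN => ?_)
    (Eventually.of_forall fun x => ?_)) hbound
  · exact ENNReal.rpow_le_rpow (hmono x hNN) hq0.le
  · exact (ENNReal.continuous_rpow_const.tendsto _).comp (htend x)

lemma hasCompactSupport_of_tsupport_subset_annulus {φ : ℝ → ℂ}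
    (hφsupp : tsupport φ ⊆ {x : ℝ | 1 / 10 < |x| ∧ |x| < 10}) : HasCompactSupport φ :=
  (isCompact_Icc (a := (-10 : ℝ)) (b := 10)).of_isClosed_subset (isClosed_tsupport φ)
    fun _ hx => abs_le.1 (hφsupp hx).2.le

lemma squareFn_congr_ae {φ : ℝ → ℂ} {r : ℝ → ℝ} {f g : ℝ → ℂ} (h : f =ᵐ[volume] g) (m : ℕ) :
    squareFn φ r f m = squareFn φ r g m := by
  have : piece φ r f m = piece φ r g m := by
    ext p j x
    unfold piece
    rw [convolution_congr _ h EventuallyEq.rfl]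
  ext x
  simp only [squareFn, this]

/-- The square function is bounded on `L^p`, uniformly in `m`. -/
lemma IsPhaseOn.exists_lintegral_squareFn_rpow_le {U : Set ℝ} {r : ℝ → ℝ}
    (h : IsPhaseOn U (phaseR r) r) {φ : ℝ → ℂ} (hφ : ContDiff ℝ ∞ φ)
    (hφU : tsupport φ ⊆ U) (hφsupp : tsupport φ ⊆ {x : ℝ | 1 / 10 < |x| ∧ |x| < 10})
    {p : ℝ} (hp : 2 ≤ p) :
    ∃ C : ℝ, 0 < C ∧ ∀ (m : ℕ) (f : ℝ → ℂ), MemLp f (ENNReal.ofReal p) →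
      ∫⁻ x, squareFn φ r f m x ^ p ≤ ENNReal.ofReal C * ∫⁻ x, ‖f x‖ₑ ^ p := by
  obtain ⟨C, hC, hpiece⟩ := h.exists_sum_piece_le_haarDil hφ
    (hasCompactSupport_of_tsupport_subset_annulus hφsupp) hφU hφsupp
  obtain ⟨D, hD, hdual⟩ := exists_lintegral_rpow_le_of_forall_dyadicMax
    (q := p / 2) (by linarith) (K := 1200) (by norm_num)
  have hp0 : 0 < p := by linarith
  refine ⟨C ^ (p / 2) * D, by positivity, fun m f₀ hf₀ => ?_⟩
  obtain ⟨f, hfm, hff⟩ := hf₀.1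
  have hf : MemLp f (ENNReal.ofReal p) := hf₀.ae_eq hff
  have hnorm : ∫⁻ x, ‖f₀ x‖ₑ ^ p = ∫⁻ x, ‖f x‖ₑ ^ p :=
    lintegral_congr_ae (hff.mono fun x hx => congrArg (fun z => ‖z‖ₑ ^ p) hx)
  rw [squareFn_congr_ae hff, hnorm]
  have hfm := hfm.measurable
  set g : ℕ → ℝ → ℝ≥0∞ := fun j s =>
    ‖(f ⋆[ContinuousLinearMap.mul ℂ ℂ, volume] haarDil (m + j)) s‖ₑ ^ 2 with hg
  have hgm : ∀ j, Measurable (g j) := fun j =>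
    (measurable_convolution hfm (measurable_haarDil _)).enorm.pow_const 2
  set F : ℝ → ℝ≥0∞ := fun x => ∑' j : ℕ, ∫⁻ s, g j s * cauchyWeight (2 ^ j) (x - s) with hF
  have hFjm : ∀ j : ℕ, Measurable fun x => ∫⁻ s, g j s * cauchyWeight (2 ^ j) (x - s) := fun j =>
    measurable_lintegral_mul_cauchyWeight (hgm j) _
  have hFm : Measurable F := Measurable.tsum hFjm
  have hsq : ∀ x, squareFn φ r f m x ^ p ≤ ENNReal.ofReal (C ^ (p / 2)) * F x ^ (p / 2) := by
    intro x
    rw [squareFn, ← ENNReal.rpow_mul, one_div_mul_eq_div, ← ENNReal.ofReal_rpow_of_pos hC,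
      ← ENNReal.mul_rpow_of_nonneg _ _ (by positivity)]
    gcongr
    rw [hF, ← ENNReal.tsum_mul_left]
    exact ENNReal.tsum_le_tsum fun j => hpiece m j f p (by linarith) hfm hf x
  have hweight : ∀ v, Measurable v → ∫⁻ x, F x * v x ≤
      ENNReal.ofReal 1200 * ∫⁻ x, ‖f x‖ₑ ^ 2 * dyadicMax v x := by
    intro v hv
    rw [ENNReal.ofReal_ofNat]
    refine le_trans (le_of_eq ?_) (tsum_lintegral_convolution_haarDil_mul_le hfm hv m)
    simp only [hF]
    simp_rw [← ENNReal.tsum_mul_right]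
    rw [lintegral_tsum fun j => (show Measurable fun x =>
      (∫⁻ s, g j s * cauchyWeight (2 ^ j) (x - s)) * v x from (hFjm j).mul hv).aemeasurable]
    refine tsum_congr fun j => ?_
    have hmeas : Measurable fun z : ℝ × ℝ =>
        g j z.2 * cauchyWeight (2 ^ j) (z.1 - z.2) * v z.1 :=
      (((hgm j).comp measurable_snd).mul ((measurable_cauchyWeight _).comp
        (measurable_fst.sub measurable_snd))).mul (hv.comp measurable_fst)
    have e : ∀ x, (∫⁻ s, g j s * cauchyWeight (2 ^ j) (x - s)) * v x =
        ∫⁻ s, g j s * cauchyWeight (2 ^ j) (x - s) * v x := fun x => by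
      rw [lintegral_mul_const]
      exact (hgm j).mul ((measurable_cauchyWeight _).comp (measurable_const_sub x))
    simp_rw [e]
    rw [lintegral_lintegral_swap hmeas.aemeasurable]
    refine lintegral_congr fun s => ?_
    rw [← lintegral_const_mul' _ _ (by simp)]
    refine lintegral_congr fun x => ?_
    rw [← cauchyWeight_neg, neg_sub, mul_assoc, mul_comm (v x)]
  have hfin := hdual F (fun x => ‖f x‖ₑ ^ 2) hFm (hfm.enorm.pow_const 2) hweight
  calc ∫⁻ x, squareFn φ r f m x ^ p
      ≤ ∫⁻ x, ENNReal.ofReal (C ^ (p / 2)) * F x ^ (p / 2) := lintegral_mono hsq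
    _ = ENNReal.ofReal (C ^ (p / 2)) * ∫⁻ x, F x ^ (p / 2) :=
        lintegral_const_mul' _ _ ENNReal.ofReal_ne_top
    _ ≤ ENNReal.ofReal (C ^ (p / 2)) *
          (ENNReal.ofReal D * ∫⁻ x, (‖f x‖ₑ ^ 2) ^ (p / 2)) := by gcongr
    _ = ENNReal.ofReal (C ^ (p / 2) * D) * ∫⁻ x, ‖f x‖ₑ ^ p := by
        rw [ENNReal.ofReal_mul (by positivity), mul_assoc]
        congr 2
        refine lintegral_congr fun x => ?_
        rw [← ENNReal.rpow_natCast, ← ENNReal.rpow_mul]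
        congr 1
        push_cast
        ring

theorem mainTheorem8 (γ : ℝ → ℝ) (hγ : NonFlatNearZero γ)
    (φ : ℝ → ℂ) (hφ : ContDiff ℝ ∞ φ)
    (hφsupp : tsupport φ ⊆ {x : ℝ | 1 / 10 < |x| ∧ |x| < 10})
    (r : ℝ → ℝ) (hr : ∀ s : ℝ, 0 < s → IsInverseLimitAt γ s (r s))
    (hneg : tsupport φ ⊆ Ioi 0 ∨
      ((∀ s : ℝ, s < 0 → IsInverseLimitAt γ s (r s)) ∧ IntervalIntegrable r volume (-1) 1))
    (p p' : ℝ) (hp : 2 ≤ p) (hpp' : p.HolderConjugate p') :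
    ∃ C : ℝ, 0 < C ∧ ∀ m : ℕ, 1 ≤ m → ∀ f : ℝ → ℂ, MemLp f (ENNReal.ofReal p) volume →
      eLpNorm (squareFn φ r f m) (ENNReal.ofReal p) volume
        ≤ ENNReal.ofReal (C * (m : ℝ) ^ (2 / p' - 1)) * eLpNorm f (ENNReal.ofReal p) volume := by
  obtain ⟨U, hU, hφU⟩ := exists_isPhaseOn hγ hφsupp hr hneg
  obtain ⟨C, hC, hb⟩ := hU.exists_lintegral_squareFn_rpow_le hφ hφU hφsupp hp
  have hp0 : 0 < p := by linarith
  refine ⟨C ^ (1 / p), by positivity, fun m hm f hf => ?_⟩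
  -- the exponent `2 / p' - 1 = 1 - 2 / p` is nonnegative
  have hexp : 0 ≤ 2 / p' - 1 := by
    have h1 := hpp'.inv_add_inv_eq_one
    have h2 : p⁻¹ ≤ 2⁻¹ := inv_anti₀ (by norm_num) hp
    rw [div_eq_mul_inv]
    linarith
  have hm1 : 1 ≤ (m : ℝ) ^ (2 / p' - 1) := Real.one_le_rpow (by exact_mod_cast hm) hexp
  have hpne : ENNReal.ofReal p ≠ 0 := by simpa using hp0
  rw [eLpNorm_eq_lintegral_rpow_enorm_toReal hpne (by simp),
    eLpNorm_eq_lintegral_rpow_enorm_toReal hpne (by simp), ENNReal.toReal_ofReal hp0.le]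
  simp only [enorm_eq_self]
  calc (∫⁻ x, squareFn φ r f m x ^ p) ^ (1 / p)
      ≤ (ENNReal.ofReal C * ∫⁻ x, ‖f x‖ₑ ^ p) ^ (1 / p) := by
        gcongr
        exact hb m f hf
    _ = ENNReal.ofReal (C ^ (1 / p)) * (∫⁻ x, ‖f x‖ₑ ^ p) ^ (1 / p) := by
        rw [ENNReal.mul_rpow_of_nonneg _ _ (by positivity), ENNReal.ofReal_rpow_of_pos hC]
    _ ≤ _ := by
        gcongr
        exact le_mul_of_one_le_right (by positivity) hm1
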